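/- Let $h>0$ and let $g\in L^1(0,\infty)$ be the impulse response of a (stable, causal) linear time-invariant continuous-time system $x(t)=\int_0^\infty g(\tau)u(t-\tau)\,d\tau$. Write $\operatorname{sinc}(t)=\sin(\pi t)/(\pi t)$ (with $\operatorname{sinc}(0)=1$) and $$g_{\rm BL}(kh)=\frac1h\int_0^\infty g(\tau)\operatorname{sinc}\Big(\frac{kh-\tau}{h}\Big)d\tau,\qquad k\in\mathbb Z .$$ Let $e(h),e(2h),\dots$ be white noise of variance $\lambda^2>0$, i.e. independent identically distributed real random variables with mean zero and variance $\lambda^2$, and let $v(h),v(2h),\dots$ be a zero-mean, strictly stationary and ergodic process of finite variance $\sigma^2$ that is independent of $\{e(kh)\}$. For each $N$ let the input be $u(t)=u_N(t)=\sum_{n=1}^N e(nh)\operatorname{sinc}\big(\frac{t-nh}{h}\big)$, and let the measurements be $y(kh)=x(kh)+v(kh)$, $k=1,\dots,N$. Let $M_{nc},M_c$ be integers with $M_{nc}+M_c\ge 0$ and put $$\rho^*=\big(g_{\rm BL}(-M_{nc}h),\dots,g_{\rm BL}(M_ch)\big)^\top,\qquad \varphi(kh)=h\big(u([k+M_{nc}]h),\dots,u([k-M_c]h)\big)^\top,$$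 $$w(kh)=y(kh)-\varphi^\top(kh)\rho^*=y(kh)-h\sum_{n=-M_{nc}}^{M_c}u([k-n]h)\,g_{\rm BL}(nh),$$ and consider the least-squares estimate $$\hat\rho_N=\Big[\sum_{k=1}^N\varphi(kh)\varphi^\top(kh)\Big]^{-1}\Big[\sum_{k=1}^N\varphi(kh)y(kh)\Big]$$ (set equal to $0$ where the matrix is singular). Then all the expectations below exist, the limit $$P_{\rm LS}=\lim_{N\to\infty}\frac{1}{h^4\lambda^4N}\sum_{k=1}^N\sum_{n=1}^N\mathbb E\big\{\varphi(kh)w(kh)w(nh)\varphi^\top(nh)\big\}$$ exists and is positive semidefinite, and $\sqrt N(\hat\rho_N-\rho^*)$ converges in distribution to the (possibly degenerate) Gaussian law $\mathcal N(0,P_{\rm LS})$ as $N\to\infty$. -/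

import Mathlib

open MeasureTheory ProbabilityTheory Filter Topology

noncomputable section

/-- The normalized sinc function `sinc t = sin (π t) / (π t)`, with value `1` at `t = 0`. -/
def nsinc (t : ℝ) : ℝ := Real.sinc (Real.pi * t)

/-- The band-limited input obtained by sinc interpolation of `e 1, …, e N` at the instants
`h, 2h, …, Nh`. -/
def inputSignal (h : ℝ) (N : ℕ) (e : ℕ → ℝ) (t : ℝ) : ℝ :=
  ∑ n ∈ Finset.Icc 1 N, e n * nsinc ((t - n * h) / h)

/-- Output of the causal linear time-invariant system with impulse response `g`:
`x(t) = ∫₀^∞ g(τ) u(t - τ) dτ`. -/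
def systemOutput (g u : ℝ → ℝ) (t : ℝ) : ℝ :=
  ∫ τ in Set.Ioi (0 : ℝ), g τ * u (t - τ)

/-- The band-limited equivalent impulse response
`g_BL(kh) = (1/h) ∫₀^∞ g(τ) sinc((kh - τ)/h) dτ`, `k ∈ ℤ`. -/
def gBL (h : ℝ) (g : ℝ → ℝ) (k : ℤ) : ℝ :=
  (1 / h) * ∫ τ in Set.Ioi (0 : ℝ), g τ * nsinc ((k * h - τ) / h)

/-- The set of lags `-Mnc, …, Mc`, which indexes the parameter vector. -/
abbrev Lag (Mnc Mc : ℤ) : Type := Set.Icc (-Mnc) Mc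

/-- The true parameter vector `ρ* = (g_BL(-Mnc h), …, g_BL(Mc h))`. -/
def trueParam (h : ℝ) (g : ℝ → ℝ) (Mnc Mc : ℤ) : EuclideanSpace ℝ (Lag Mnc Mc) :=
  WithLp.toLp 2 fun n => gBL h g n

/-- The regressor `φ(kh) = h (u((k + Mnc)h), …, u((k - Mc)h))`; its entry at lag `n` is
`h u((k - n)h)`. -/
def regressor (h : ℝ) (u : ℝ → ℝ) (Mnc Mc : ℤ) (k : ℕ) : Lag Mnc Mc → ℝ :=
  fun n => h * u (((k : ℝ) - ((n : ℤ) : ℝ)) * h)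

/-- The noisy samples `y(kh) = x(kh) + v(kh)`. -/
def measuredOutput (h : ℝ) (g u : ℝ → ℝ) (v : ℕ → ℝ) (k : ℕ) : ℝ :=
  systemOutput g u (k * h) + v k

/-- The least-squares estimate `[∑ φ(kh) φᵀ(kh)]⁻¹ [∑ φ(kh) y(kh)]`, sums over `1 ≤ k ≤ N`. -/
def lsEstimate (h : ℝ) (u : ℝ → ℝ) (y : ℕ → ℝ) (Mnc Mc : ℤ) (N : ℕ) :
    EuclideanSpace ℝ (Lag Mnc Mc) :=
  WithLp.toLp 2
    ((∑ k ∈ Finset.Icc 1 N,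
        Matrix.vecMulVec (regressor h u Mnc Mc k) (regressor h u Mnc Mc k))⁻¹.mulVec
      (∑ k ∈ Finset.Icc 1 N, y k • regressor h u Mnc Mc k))

/-- The residual `w(kh)`, i.e. what is left of `y(kh)` after subtracting
`φᵀ(kh) ρ* = h ∑_{n = -Mnc}^{Mc} u((k - n)h) g_BL(nh)`. -/
def residualNoise (h : ℝ) (g u : ℝ → ℝ) (v : ℕ → ℝ) (Mnc Mc : ℤ) (k : ℕ) : ℝ :=
  measuredOutput h g u v k
    - ∑ n : Lag Mnc Mc, regressor h u Mnc Mc k n * trueParam h g Mnc Mc n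

/-- The `(i, j)` entry of `φ(kh) w(kh) w(nh) φᵀ(nh)`, as a function of the realizations of the
input sequence `e` and of the output noise `v`. -/
def scoreProduct (h : ℝ) (g : ℝ → ℝ) (Mnc Mc : ℤ) (N k n : ℕ) (i j : Lag Mnc Mc)
    (e v : ℕ → ℝ) : ℝ :=
  regressor h (inputSignal h N e) Mnc Mc k i * residualNoise h g (inputSignal h N e) v Mnc Mc k
    * residualNoise h g (inputSignal h N e) v Mnc Mc n * regressor h (inputSignal h N e) Mnc Mc n j

/-- White noise of variance `lam ^ 2`: independent, identically distributed, zero mean. -/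
structure IsWhiteNoise {Ω : Type*} [MeasurableSpace Ω] (e : ℕ → Ω → ℝ) (lam : ℝ)
    (μ : Measure Ω) : Prop where
  measurable : ∀ k, Measurable (e k)
  indep : iIndepFun e μ
  identDistrib : ∀ k, IdentDistrib (e k) (e 0) μ μ
  memLp : MemLp (e 0) 2 μ
  mean_zero : ∫ ω, e 0 ω ∂μ = 0
  variance_eq : Var[e 0; μ] = lam ^ 2

/-- A strictly stationary and ergodic process with zero mean and variance `sigma ^ 2`:
the left shift on the space of sequences preserves the law of the process and is ergodic for it. -/
structure IsStationaryErgodicNoise {Ω : Type*} [MeasurableSpace Ω] (v : ℕ → Ω → ℝ) (sigma : ℝ)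
    (μ : Measure Ω) : Prop where
  measurable : ∀ k, Measurable (v k)
  ergodic : Ergodic (fun (x : ℕ → ℝ) (k : ℕ) => x (k + 1)) (μ.map fun ω k => v k ω)
  memLp : MemLp (v 0) 2 μ
  mean_zero : ∫ ω, v 0 ω ∂μ = 0
  variance_eq : Var[v 0; μ] = sigma ^ 2

end

/-! Sinc interpolation returns the input sequence at the sampling instants, so the problem is
discrete. With `a m = e (m + 1)` and `b m = v (m + 1)`, the residual is `b` plus `h` times the
convolution of `a` with the part of `g_BL` outside the modelled lags, and the estimation error is
the inverse Gram matrix applied to the score `∑ φ w`. In a direction `θ` the score is a quadratic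
form in `a` plus a bilinear form in `a` and `b`. The coefficient of each `a m ^ 2` vanishes, because
it evaluates the unmodelled response at modelled lags (`scoreCoeff_self`). Charging every product to
its later input index turns the score into `∑ a m * Z m`, where `Z m` depends on `a 0, …, a (m - 1)`
and on all of `b` (`score_eq_sum`). Since `a` is independent of `b`, this is a martingale transform,
and second moments suffice throughout.

The multipliers `Z m` depend on `N` and reach arbitrarily far back. Square summability of `g_BL`
(`summable_gBL_sq`) and orthogonality of the increments make the score close in mean square to a
transform whose multipliers are stationary finite moving averages, apart from boundary terms
(`integral_multiplierError_sq_le`). For these the martingale central limit theorem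
`IsInnovation.tendsto_integral_exp` only asks that the averages of `Z m ^ 2` converge in mean. That
follows from the ergodicity of `b`, the strong law for `a m ^ 2`, and orthogonality for the mixed
products (`meanLLN_window_sq`). A double-limit argument (`exists_tendsto_integral_exp_of_approx`)
carries both the variances and the Gaussian limit over to the true score, and yields the existence
of the limiting variance without a formula for it (`exists_tendsto_score`).

Linear combinations determine the limit law and the limit covariance
(`exists_tendsto_multivariateGaussian`). The normalized Gram matrix tends in probability to `h² λ²`
times the identity (`tendstoInMeasure_gramAvg`), and Slutsky's theorem finishes the proof. -/

set_option linter.unusedSectionVars false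

/-- `X` is a sequence of centred identically distributed random variables of variance `lam ^ 2`,
adapted to the filtration `ℱ` (with a shift by one), such that `X m` is independent of `ℱ m`. -/
structure IsInnovation {Ω : Type*} [mΩ : MeasurableSpace Ω] (X : ℕ → Ω → ℝ)
    (ℱ : ℕ → MeasurableSpace Ω) (lam : ℝ) (μ : Measure Ω) : Prop where
  le : ∀ m, ℱ m ≤ mΩ
  mono : Monotone ℱ
  meas : ∀ m, Measurable[ℱ (m + 1)] (X m)
  indep : ∀ m, Indep (MeasurableSpace.comap (X m) inferInstance) (ℱ m) μ
  ident : ∀ m n, IdentDistrib (X m) (X n) μ μ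
  memLp : ∀ m, MemLp (X m) 2 μ
  mean : ∀ m, ∫ ω, X m ω ∂μ = 0
  sq : ∀ m, ∫ ω, X m ω ^ 2 ∂μ = lam ^ 2

/-- The averages of `W` converge to `c` in mean. -/
def MeanLLN {Ω : Type*} [MeasurableSpace Ω] (μ : Measure Ω) (W : ℕ → Ω → ℝ) (c : ℝ) : Prop :=
  (∀ m, Integrable (W m) μ) ∧
    Tendsto (fun N : ℕ => ∫ ω, |(∑ m ∈ Finset.range N, W m ω) / N - c| ∂μ) atTop (𝓝 0)


/-! ### Second-moment tools and averages that converge in mean. -/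

section Basic

variable {Ω : Type*} [mΩ : MeasurableSpace Ω] {μ : Measure Ω} [IsProbabilityMeasure μ]

theorem memLp_mul_of_indepFun {X Y : Ω → ℝ} (h : IndepFun X Y μ) (hX : MemLp X 2 μ)
    (hY : MemLp Y 2 μ) : MemLp (fun ω => X ω * Y ω) 2 μ := by
  refine (memLp_two_iff_integrable_sq (hX.1.mul hY.1)).2 ?_
  have := (h.comp (φ := fun x : ℝ => x ^ 2) (ψ := fun x : ℝ => x ^ 2) (by fun_prop)
    (by fun_prop)).integrable_mul hX.integrable_sq hY.integrable_sq
  refine this.congr (ae_of_all _ fun ω => ?_)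
  simp [mul_pow]

theorem integral_abs_le_sqrt {f : Ω → ℝ} (hf : MemLp f 2 μ) :
    ∫ ω, |f ω| ∂μ ≤ √(∫ ω, f ω ^ 2 ∂μ) := by
  apply Real.le_sqrt_of_sq_le
  have h := variance_nonneg |f| μ
  rw [variance_eq_sub hf.abs] at h
  simp only [Pi.pow_apply, Pi.abs_apply, sq_abs] at h
  linarith

theorem norm_toLp_two_eq_sqrt {f : Ω → ℝ} (hf : MemLp f 2 μ) :
    ‖hf.toLp f‖ = √(∫ ω, f ω ^ 2 ∂μ) := by
  rw [← Real.sqrt_sq (norm_nonneg (hf.toLp f)), ← real_inner_self_eq_norm_sq, L2.inner_def]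
  congr 1
  refine integral_congr_ae ?_
  filter_upwards [hf.coeFn_toLp] with x hx
  rw [hx]
  simp [sq]

theorem MeanLLN.add {W W' : ℕ → Ω → ℝ} {c c' : ℝ} (h : MeanLLN μ W c) (h' : MeanLLN μ W' c') :
    MeanLLN μ (fun m ω => W m ω + W' m ω) (c + c') := by
  refine ⟨fun m => (h.1 m).add (h'.1 m), ?_⟩
  have hi : ∀ {W : ℕ → Ω → ℝ} {c : ℝ}, MeanLLN μ W c → ∀ N : ℕ,
      Integrable (fun ω => |(∑ m ∈ Finset.range N, W m ω) / N - c|) μ := fun h N =>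
    (((integrable_finsetSum _ fun m _ => h.1 m).div_const _).sub (integrable_const _)).abs
  refine squeeze_zero (fun N => integral_nonneg fun ω => abs_nonneg _) (fun N => ?_)
    (by simpa using h.2.add h'.2)
  rw [← integral_add (hi h N) (hi h' N)]
  refine integral_mono_of_nonneg (ae_of_all _ fun ω => abs_nonneg _) ((hi h N).add (hi h' N))
    (ae_of_all _ fun ω => ?_)
  simp only [Finset.sum_add_distrib, add_div]
  exact (congrArg abs (by ring)).trans_le (abs_add_le _ _)

theorem MeanLLN.const_mul {W : ℕ → Ω → ℝ} {c : ℝ} (h : MeanLLN μ W c) (r : ℝ) :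
    MeanLLN μ (fun m ω => r * W m ω) (r * c) := by
  refine ⟨fun m => (h.1 m).const_mul r, ?_⟩
  have : ∀ N : ℕ, ∫ ω, |(∑ m ∈ Finset.range N, r * W m ω) / N - r * c| ∂μ
      = |r| * ∫ ω, |(∑ m ∈ Finset.range N, W m ω) / N - c| ∂μ := fun N => by
    rw [← integral_const_mul]
    congr 1; ext ω
    rw [← abs_mul, ← Finset.mul_sum]
    congr 1; ring
  simp_rw [this]
  simpa using h.2.const_mul |r|

theorem MeanLLN.zero : MeanLLN μ (fun _ _ => (0 : ℝ)) 0 := by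
  refine ⟨fun m => integrable_zero _ _ _, by simp⟩

theorem MeanLLN.sum {ι : Type*} (s : Finset ι) {W : ι → ℕ → Ω → ℝ} {c : ι → ℝ}
    (h : ∀ i ∈ s, MeanLLN μ (W i) (c i)) :
    MeanLLN μ (fun m ω => ∑ i ∈ s, W i m ω) (∑ i ∈ s, c i) := by
  classical
  induction s using Finset.induction_on with
  | empty => simpa using MeanLLN.zero
  | insert i s hi ih =>
    simp only [Finset.sum_insert hi]
    exact (h i (by simp)).add (ih fun j hj => h j (by simp [hj]))

/-- If the variables have a common mean, it is the limit of the averages. -/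
theorem MeanLLN.eq_of_integral {W : ℕ → Ω → ℝ} {c r : ℝ} (h : MeanLLN μ W c)
    (hr : ∀ m, ∫ ω, W m ω ∂μ = r) : c = r := by
  have hb : ∀ N : ℕ, 1 ≤ N →
      |r - c| ≤ ∫ ω, |(∑ m ∈ Finset.range N, W m ω) / N - c| ∂μ := fun N hN => by
    have hN' : (N : ℝ) ≠ 0 := by positivity
    have : r - c = ∫ ω, ((∑ m ∈ Finset.range N, W m ω) / N - c) ∂μ := by
      rw [integral_sub ((integrable_finsetSum _ fun m _ => h.1 m).div_const _)
        (integrable_const _), integral_div, integral_finsetSum _ fun m _ => h.1 m]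
      simp [hr, hN']
    rw [this]
    exact abs_integral_le_integral_abs
  have := ge_of_tendsto h.2 (eventually_atTop.2 ⟨1, hb⟩)
  have := abs_nonpos_iff.1 this
  linarith

end Basic

/-! ### Orthogonality of martingale transforms. -/

namespace IsInnovation

variable {Ω : Type*} [mΩ : MeasurableSpace Ω] {μ : Measure Ω} [IsProbabilityMeasure μ]
  {X : ℕ → Ω → ℝ} {ℱ : ℕ → MeasurableSpace Ω} {lam : ℝ}

theorem shift (hX : IsInnovation X ℱ lam μ) (K : ℕ) :
    IsInnovation (fun m => X (m + K)) (fun m => ℱ (m + K)) lam μ where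
  le m := hX.le _
  mono m n h := hX.mono (by omega)
  meas m := by
    have := hX.meas (m + K)
    rwa [show m + K + 1 = m + 1 + K by ring] at this
  indep m := hX.indep _
  ident m n := hX.ident _ _
  memLp m := hX.memLp _
  mean m := hX.mean _
  sq m := hX.sq _

theorem measurable (hX : IsInnovation X ℱ lam μ) (m : ℕ) : Measurable (X m) :=
  (hX.meas m).mono (hX.le _) le_rfl

theorem meas_of_lt (hX : IsInnovation X ℱ lam μ) {m n : ℕ} (h : m < n) :
    Measurable[ℱ n] (X m) := (hX.meas m).mono (hX.mono h) le_rfl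

theorem indepFun (hX : IsInnovation X ℱ lam μ) {m : ℕ} {γ : Type*} [mγ : MeasurableSpace γ]
    {U : Ω → γ} (hU : Measurable[ℱ m] U) : IndepFun (X m) U μ := by
  rw [IndepFun_iff_Indep]
  exact indep_of_indep_of_le_right (hX.indep m) hU.comap_le

theorem memLp_mul (hX : IsInnovation X ℱ lam μ) {m : ℕ} {Z : Ω → ℝ} (hZ : Measurable[ℱ m] Z)
    (hZ2 : MemLp Z 2 μ) : MemLp (fun ω => X m ω * Z ω) 2 μ :=
  memLp_mul_of_indepFun (hX.indepFun hZ) (hX.memLp m) hZ2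

theorem memLp_sum (hX : IsInnovation X ℱ lam μ) {Z : ℕ → Ω → ℝ}
    (hZ : ∀ m, Measurable[ℱ m] (Z m)) (hZ2 : ∀ m, MemLp (Z m) 2 μ) (N : ℕ) :
    MemLp (fun ω => ∑ m ∈ Finset.range N, X m ω * Z m ω) 2 μ :=
  memLp_finsetSum _ fun m _ => hX.memLp_mul (hZ m) (hZ2 m)

/-- Orthogonality of the increments of a martingale transform. -/
theorem integral_sum_sq (hX : IsInnovation X ℱ lam μ) {Z : ℕ → Ω → ℝ}
    (hZ : ∀ m, Measurable[ℱ m] (Z m)) (hZ2 : ∀ m, MemLp (Z m) 2 μ) (N : ℕ) :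
    ∫ ω, (∑ m ∈ Finset.range N, X m ω * Z m ω) ^ 2 ∂μ
      = lam ^ 2 * ∑ m ∈ Finset.range N, ∫ ω, Z m ω ^ 2 ∂μ := by
  induction N with
  | zero => simp
  | succ N ih =>
    set S : Ω → ℝ := fun ω => ∑ m ∈ Finset.range N, X m ω * Z m ω with hS
    have hSL : MemLp S 2 μ := hX.memLp_sum hZ hZ2 N
    have hXZ := hX.memLp_mul (hZ N) (hZ2 N)
    have hSm : Measurable[ℱ N] S := by
      refine Finset.measurable_fun_sum _ fun m hm => ?_
      have hm := Finset.mem_range.1 hm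
      exact (hX.meas_of_lt hm).mul ((hZ m).mono (hX.mono hm.le) le_rfl)
    -- The cross term vanishes: `Z N * S` is `ℱ N`-measurable, hence independent of the centred `X
    -- N`.
    have h1 : ∫ ω, X N ω * (Z N ω * S ω) ∂μ = 0 := by
      have := (hX.indepFun ((hZ N).mul hSm)).integral_fun_mul_eq_mul_integral
        (hX.memLp N).1 ((hZ2 N).1.mul hSL.1)
      rw [hX.mean, zero_mul] at this
      exact this
    have h2 : ∫ ω, X N ω ^ 2 * Z N ω ^ 2 ∂μ = lam ^ 2 * ∫ ω, Z N ω ^ 2 ∂μ := by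
      have := ((hX.indepFun (hZ N)).comp (φ := fun x : ℝ => x ^ 2) (ψ := fun x : ℝ => x ^ 2)
        (by fun_prop) (by fun_prop)).integral_fun_mul_eq_mul_integral
        ((hX.memLp N).integrable_sq.1) ((hZ2 N).integrable_sq.1)
      simp only [Function.comp] at this
      rw [this, hX.sq]
    have hexp : ∀ ω, (∑ m ∈ Finset.range (N + 1), X m ω * Z m ω) ^ 2
        = S ω ^ 2 + (2 * (X N ω * (Z N ω * S ω)) + X N ω ^ 2 * Z N ω ^ 2) := fun ω => by
      rw [Finset.sum_range_succ]; simp only [hS]; ring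
    have hi1 : Integrable (fun ω => 2 * (X N ω * (Z N ω * S ω))) μ := by
      refine ((hXZ.integrable_mul hSL).const_mul 2).congr (ae_of_all _ fun ω => ?_)
      simp [mul_assoc]
    have hi2 : Integrable (fun ω => X N ω ^ 2 * Z N ω ^ 2) μ :=
      hXZ.integrable_sq.congr (ae_of_all _ fun ω => by simp [mul_pow])
    simp_rw [hexp]
    rw [integral_add (g := fun ω => 2 * (X N ω * (Z N ω * S ω)) + X N ω ^ 2 * Z N ω ^ 2)
      hSL.integrable_sq (hi1.add hi2), integral_add hi1 hi2, integral_const_mul,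
      h1, h2, ih, Finset.sum_range_succ]
    ring

theorem integral_abs_sum_le (hX : IsInnovation X ℱ lam μ) {Z : ℕ → Ω → ℝ} {C : ℝ}
    (hZ : ∀ m, Measurable[ℱ m] (Z m)) (hZ2 : ∀ m, MemLp (Z m) 2 μ) (N : ℕ)
    (hC : ∀ m, ∫ ω, Z m ω ^ 2 ∂μ ≤ C) :
    ∫ ω, |∑ m ∈ Finset.range N, X m ω * Z m ω| ∂μ ≤ √(lam ^ 2 * (N * C)) := by
  refine (integral_abs_le_sqrt (hX.memLp_sum hZ hZ2 N)).trans (Real.sqrt_le_sqrt ?_)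
  rw [hX.integral_sum_sq hZ hZ2]
  gcongr
  refine (Finset.sum_le_sum fun m _ => hC m).trans ?_
  simp

/-- By orthogonality the second moment of the sum grows at most linearly in `N`, so the average is
`O(N ^ (-1/2))` in mean. -/
theorem meanLLN (hX : IsInnovation X ℱ lam μ) {Z : ℕ → Ω → ℝ} {C : ℝ}
    (hZ : ∀ m, Measurable[ℱ m] (Z m)) (hZ2 : ∀ m, MemLp (Z m) 2 μ)
    (hC : ∀ m, ∫ ω, Z m ω ^ 2 ∂μ ≤ C) :
    MeanLLN μ (fun m ω => X m ω * Z m ω) 0 := by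
  refine ⟨fun m => (hX.memLp_mul (hZ m) (hZ2 m)).integrable one_le_two, ?_⟩
  have hlim : Tendsto (fun N : ℕ => √(lam ^ 2 * C / N)) atTop (𝓝 0) := by
    have := (tendsto_const_div_atTop_nhds_zero_nat (lam ^ 2 * C)).sqrt
    simpa using this
  refine squeeze_zero' (Eventually.of_forall fun N => integral_nonneg fun ω => abs_nonneg _)
    (eventually_atTop.2 ⟨1, fun N hN => ?_⟩) hlim
  have hN' : (0 : ℝ) < N := by positivity
  have h1 := hX.integral_abs_sum_le hZ hZ2 N hC
  simp only [sub_zero, abs_div, Nat.abs_cast, integral_div]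
  rw [div_le_iff₀ hN']
  refine h1.trans (le_of_eq ?_)
  rw [show lam ^ 2 * (N * C) = (lam ^ 2 * C / N) * N ^ 2 by field_simp,
    Real.sqrt_mul' _ (by positivity), Real.sqrt_sq hN'.le]

end IsInnovation

/-! ### Comparison with Gaussian characteristic functions. -/

namespace IsInnovation

variable {Ω : Type*} [mΩ : MeasurableSpace Ω] {μ : Measure Ω} [IsProbabilityMeasure μ]
  {X : ℕ → Ω → ℝ} {ℱ : ℕ → MeasurableSpace Ω} {lam : ℝ}

/-- The defect between the characteristic function of the innovations and that of the centred
Gaussian law with the same variance. -/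
noncomputable def gaussDefect (X : Ω → ℝ) (lam : ℝ) (μ : Measure Ω) (s : ℝ) : ℂ :=
  charFun (μ.map X) s - Complex.exp (-((lam ^ 2 * s ^ 2 / 2 : ℝ) : ℂ))

theorem continuous_gaussDefect (hX : IsInnovation X ℱ lam μ) (m : ℕ) :
    Continuous (gaussDefect (X m) lam μ) := by
  have : IsProbabilityMeasure (μ.map (X m)) :=
    Measure.isProbabilityMeasure_map (hX.measurable m).aemeasurable
  unfold gaussDefect
  have := continuous_charFun (μ := μ.map (X m))
  fun_prop

theorem norm_gaussDefect_le_two (hX : IsInnovation X ℱ lam μ) (m : ℕ) (s : ℝ) :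
    ‖gaussDefect (X m) lam μ s‖ ≤ 2 := by
  have : IsProbabilityMeasure (μ.map (X m)) :=
    Measure.isProbabilityMeasure_map (hX.measurable m).aemeasurable
  refine (norm_sub_le _ _).trans ?_
  have h1 := norm_charFun_le_one (μ := μ.map (X m)) (t := s)
  have h2 : ‖Complex.exp (-((lam ^ 2 * s ^ 2 / 2 : ℝ) : ℂ))‖ ≤ 1 := by
    rw [Complex.norm_exp]
    simp only [Complex.neg_re, Complex.ofReal_re, Real.exp_le_one_iff]
    have : 0 ≤ lam ^ 2 * s ^ 2 / 2 := by positivity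
    linarith
  linarith

/-- Both functions have the second-order expansion `1 - lam² s² / 2` at `0`: the first by centring
and finite variance, the second from the exponential series. -/
theorem gaussDefect_isLittleO (hX : IsInnovation X ℱ lam μ) (m : ℕ) :
    gaussDefect (X m) lam μ =o[𝓝 0] fun s : ℝ => s ^ 2 := by
  have hm := (hX.measurable m).aemeasurable (μ := μ)
  have : IsProbabilityMeasure (μ.map (X m)) := Measure.isProbabilityMeasure_map hm
  have hL : MemLp id 2 (μ.map (X m)) :=
    (memLp_map_measure_iff aestronglyMeasurable_id hm).2 (hX.memLp m)
  have h1 : (fun s : ℝ => charFun (μ.map (X m)) s - (1 - lam ^ 2 * s ^ 2 / 2))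
      =o[𝓝 0] fun s : ℝ => s ^ 2 := by
    have h := taylor_isLittleO_univ (f := charFun (μ.map (X m))) (x₀ := 0) (n := 2)
      (contDiff_charFun hL)
    simp only [sub_zero] at h
    refine h.congr_left fun s => ?_
    rw [taylorWithinEval_charFun_two_zero hm hL, hX.mean]
    simp [hX.sq]
  have h2 : (fun s : ℝ => Complex.exp (-((lam ^ 2 * s ^ 2 / 2 : ℝ) : ℂ))
      - (1 - lam ^ 2 * s ^ 2 / 2)) =o[𝓝 0] fun s : ℝ => s ^ 2 := by
    have h3 : (fun s : ℝ => Complex.exp (-((lam ^ 2 * s ^ 2 / 2 : ℝ) : ℂ))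
      - (1 - lam ^ 2 * s ^ 2 / 2)) =O[𝓝 0] fun s : ℝ => s ^ 4 := by
      have hc : Tendsto (fun s : ℝ => ‖(-((lam ^ 2 * s ^ 2 / 2 : ℝ) : ℂ))‖) (𝓝 0) (𝓝 0) := by
        have : Continuous fun s : ℝ => ‖(-((lam ^ 2 * s ^ 2 / 2 : ℝ) : ℂ))‖ := by fun_prop
        simpa using this.tendsto 0
      refine Asymptotics.IsBigO.of_bound ((lam ^ 2 / 2) ^ 2) ?_
      filter_upwards [hc.eventually_le_const one_pos] with s hs
      have := Complex.norm_exp_sub_one_sub_id_le hs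
      refine (le_of_eq ?_).trans (this.trans (le_of_eq ?_))
      · congr 1; push_cast; ring
      · rw [norm_neg, Complex.norm_real, Real.norm_eq_abs, Real.norm_eq_abs, sq_abs,
          abs_of_nonneg (by positivity)]
        ring
    refine h3.trans_isLittleO ?_
    exact Asymptotics.isLittleO_pow_pow (by norm_num)
  refine (h1.sub h2).congr_left fun s => ?_
  unfold gaussDefect
  ring

/-- Near `0` this is the little-o estimate; for `δ ≤ |s|` the trivial bound `2` is at most `2 s² /
δ²`. The second term is shaped so that summing it produces a Lindeberg sum. -/
theorem norm_gaussDefect_le (hX : IsInnovation X ℱ lam μ) (m : ℕ) {ε : ℝ} (hε : 0 < ε) :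
    ∃ δ > 0, ∀ s : ℝ, ‖gaussDefect (X m) lam μ s‖
      ≤ ε * s ^ 2 + 2 / δ ^ 2 * (if δ ≤ |s| then s ^ 2 else 0) := by
  obtain ⟨δ, hδ, h⟩ := Metric.eventually_nhds_iff.1 ((hX.gaussDefect_isLittleO m).bound hε)
  refine ⟨δ, hδ, fun s => ?_⟩
  split_ifs with hs
  · refine (hX.norm_gaussDefect_le_two m s).trans ?_
    have h1 : δ ^ 2 ≤ s ^ 2 := by rw [← sq_abs s]; gcongr
    have h2 : 2 ≤ 2 / δ ^ 2 * s ^ 2 := by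
      rw [div_mul_eq_mul_div, le_div_iff₀ (by positivity)]; linarith
    have : 0 ≤ ε * s ^ 2 := by positivity
    linarith
  · simp only [mul_zero, add_zero]
    have := @h s (by simpa using hs)
    simpa using this

/-- Conditioning on `ℱ m`, carried out as Fubini: the joint law of `X m` and `(U, z)` is a product,
so `X m` can be integrated out first with `z` frozen. -/
theorem integral_mul_exp (hX : IsInnovation X ℱ lam μ) {m : ℕ} {U : Ω → ℂ} {z : Ω → ℝ}
    (hU : Measurable[ℱ m] U) {C : ℝ} (hC : ∀ ω, ‖U ω‖ ≤ C) (hz : Measurable[ℱ m] z) :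
    ∫ ω, U ω * Complex.exp ((z ω * X m ω : ℝ) * Complex.I) ∂μ
      = ∫ ω, U ω * charFun (μ.map (X m)) (z ω) ∂μ := by
  have hXm := hX.measurable m
  have : IsProbabilityMeasure (μ.map (X m)) :=
    Measure.isProbabilityMeasure_map hXm.aemeasurable
  have hUm : Measurable U := hU.mono (hX.le m) le_rfl
  have hzm : Measurable z := hz.mono (hX.le m) le_rfl
  have hUz : Measurable fun ω => (U ω, z ω) := hUm.prodMk hzm
  have : IsProbabilityMeasure (μ.map fun ω => (U ω, z ω)) :=
    Measure.isProbabilityMeasure_map hUz.aemeasurable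
  have hind : IndepFun (X m) (fun ω => (U ω, z ω)) μ :=
    hX.indepFun (Measurable.prodMk hU hz)
  set F : ℝ × (ℂ × ℝ) → ℂ := fun p => p.2.1 * Complex.exp ((p.2.2 * p.1 : ℝ) * Complex.I) with hF
  have hFc : Measurable F := by fun_prop
  have hlaw := hind.map_prod_eq_prod_map_map hXm.aemeasurable hUz.aemeasurable
  have hint : Integrable F ((μ.map (X m)).prod (μ.map fun ω => (U ω, z ω))) := by
    rw [← hlaw, integrable_map_measure hFc.aestronglyMeasurable (hXm.prodMk hUz).aemeasurable]
    refine Integrable.of_bound (hFc.comp (hXm.prodMk hUz)).aestronglyMeasurable C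
      (ae_of_all _ fun ω => ?_)
    simp only [hF, Function.comp, norm_mul, Complex.norm_exp_ofReal_mul_I, mul_one]
    exact hC ω
  have e1 : ∫ ω, U ω * Complex.exp ((z ω * X m ω : ℝ) * Complex.I) ∂μ
      = ∫ p, F p ∂((μ.map (X m)).prod (μ.map fun ω => (U ω, z ω))) := by
    rw [← hlaw, integral_map (hXm.prodMk hUz).aemeasurable hFc.aestronglyMeasurable]
  rw [e1, integral_prod_symm _ hint, integral_map hUz.aemeasurable]
  · congr 1; ext ω
    simp only [hF]
    rw [integral_const_mul, charFun_apply_real]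
    push_cast
    rfl
  · exact hint.integral_prod_right.1

/-- If the innovations were Gaussian, the compensated exponential would be a martingale of mean `1`.
In general its mean changes at step `m` by a bounded factor times the defect at `y m`, and these
changes telescope. The bound `D` on the sums of squares keeps the compensator bounded. -/
theorem norm_integral_exp_sub_one_le (hX : IsInnovation X ℱ lam μ) {y : ℕ → Ω → ℝ}
    (hy : ∀ m, Measurable[ℱ m] (y m)) {D : ℝ} (hD : ∀ m ω, ∑ j ∈ Finset.range m, y j ω ^ 2 ≤ D)
    (N : ℕ) :
    ‖∫ ω, Complex.exp (((lam ^ 2 / 2 * ∑ j ∈ Finset.range N, y j ω ^ 2 : ℝ) : ℂ)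
        + ((∑ j ∈ Finset.range N, X j ω * y j ω : ℝ) : ℂ) * Complex.I) ∂μ - 1‖
      ≤ Real.exp (lam ^ 2 / 2 * D) * ∑ m ∈ Finset.range N, ∫ ω, ‖gaussDefect (X m) lam μ (y m ω)‖ ∂μ := by
  set W : ℕ → Ω → ℂ := fun N ω => Complex.exp (((lam ^ 2 / 2 * ∑ j ∈ Finset.range N, y j ω ^ 2 : ℝ) : ℂ)
        + ((∑ j ∈ Finset.range N, X j ω * y j ω : ℝ) : ℂ) * Complex.I) with hW
  -- The compensator runs one index further than in `W N`; it is still `ℱ N`-measurable because `y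
  -- N` is. Both `W N` and `W (N + 1)` then have `U N` as a common factor.
  set U : ℕ → Ω → ℂ := fun N ω => Complex.exp (((lam ^ 2 / 2 * ∑ j ∈ Finset.range (N + 1), y j ω ^ 2 : ℝ) : ℂ)
        + ((∑ j ∈ Finset.range N, X j ω * y j ω : ℝ) : ℂ) * Complex.I) with hU
  have hnorm : ∀ a b : ℝ, ‖Complex.exp ((a : ℂ) + (b : ℂ) * Complex.I)‖ = Real.exp a := fun a b => by
    rw [Complex.norm_exp]; simp
  have hle : ∀ m ω, lam ^ 2 / 2 * ∑ j ∈ Finset.range m, y j ω ^ 2 ≤ lam ^ 2 / 2 * D := fun m ω =>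
    mul_le_mul_of_nonneg_left (hD m ω) (by positivity)
  have hUb : ∀ m ω, ‖U m ω‖ ≤ Real.exp (lam ^ 2 / 2 * D) := fun m ω => by
    simp only [hU]; rw [hnorm]; exact Real.exp_le_exp.2 (hle _ _)
  have hWb : ∀ m ω, ‖W m ω‖ ≤ Real.exp (lam ^ 2 / 2 * D) := fun m ω => by
    simp only [hW]; rw [hnorm]; exact Real.exp_le_exp.2 (hle _ _)
  have hym : ∀ m, Measurable (y m) := fun m => (hy m).mono (hX.le m) le_rfl
  have hUm : ∀ m, Measurable[ℱ m] (U m) := fun m => by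
    have h1 : Measurable[ℱ m] fun ω => ∑ j ∈ Finset.range (m + 1), y j ω ^ 2 :=
      Finset.measurable_fun_sum _ fun j hj =>
        ((hy j).mono (hX.mono (by simpa [Nat.lt_succ_iff] using hj)) le_rfl).pow_const 2
    have h2 : Measurable[ℱ m] fun ω => ∑ j ∈ Finset.range m, X j ω * y j ω :=
      Finset.measurable_fun_sum _ fun j hj => by
        have hj := Finset.mem_range.1 hj
        exact (hX.meas_of_lt hj).mul ((hy j).mono (hX.mono hj.le) le_rfl)
    exact Complex.measurable_exp.comp (((Complex.measurable_ofReal.comp (h1.const_mul _))).add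
      ((Complex.measurable_ofReal.comp h2).mul_const _))
  have hXm := hX.measurable
  have hWm : ∀ m, Measurable (W m) := fun m => by simp only [hW]; fun_prop
  have hWi : ∀ m, Integrable (W m) μ := fun m =>
    Integrable.of_bound (hWm m).aestronglyMeasurable _ (ae_of_all _ (hWb m))
  induction N with
  | zero => simp
  | succ N ih =>
    have hstep : ∫ ω, W (N + 1) ω ∂μ - ∫ ω, W N ω ∂μ
        = ∫ ω, U N ω * gaussDefect (X N) lam μ (y N ω) ∂μ := by
      have e1 : ∀ ω, W (N + 1) ω = U N ω * Complex.exp ((y N ω * X N ω : ℝ) * Complex.I) := by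
        intro ω
        simp only [hW, hU, ← Complex.exp_add]
        congr 1
        rw [Finset.sum_range_succ (fun j => X j ω * y j ω)]
        push_cast; ring
      have e2 : ∀ ω, W N ω = U N ω * Complex.exp (-((lam ^ 2 * y N ω ^ 2 / 2 : ℝ) : ℂ)) := by
        intro ω
        simp only [hW, hU, ← Complex.exp_add]
        congr 1
        rw [Finset.sum_range_succ (fun j => y j ω ^ 2)]
        push_cast; ring
      have : IsProbabilityMeasure (μ.map (X N)) :=
        Measure.isProbabilityMeasure_map (hXm N).aemeasurable
      have hcf : Integrable (fun ω => U N ω * charFun (μ.map (X N)) (y N ω)) μ := by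
        refine Integrable.of_bound
          (((hUm N).mono (hX.le N) le_rfl).mul (continuous_charFun.measurable.comp
            (hym N))).aestronglyMeasurable (Real.exp (lam ^ 2 / 2 * D) * 1) (ae_of_all _ fun ω => ?_)
        rw [norm_mul]
        exact mul_le_mul (hUb N ω) (norm_charFun_le_one _) (norm_nonneg _) (Real.exp_nonneg _)
      have hWN := hWi N
      simp_rw [e1, hX.integral_mul_exp (hUm N) (hUb N) (hy N)]
      rw [← integral_sub hcf (hWi N)]
      congr 1; ext ω
      rw [e2, gaussDefect, mul_sub]
    have hb : ‖∫ ω, U N ω * gaussDefect (X N) lam μ (y N ω) ∂μ‖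
        ≤ Real.exp (lam ^ 2 / 2 * D) * ∫ ω, ‖gaussDefect (X N) lam μ (y N ω)‖ ∂μ := by
      rw [← integral_const_mul]
      refine norm_integral_le_of_norm_le ?_ (ae_of_all _ fun ω => ?_)
      · refine Integrable.const_mul ?_ _
        exact Integrable.of_bound (((hX.continuous_gaussDefect N).norm.measurable.comp
          (hym N)).aestronglyMeasurable) 2
          (ae_of_all _ fun ω => by simpa using hX.norm_gaussDefect_le_two N (y N ω))
      · rw [norm_mul]
        gcongr
        exact hUb N ω
    rw [Finset.sum_range_succ, mul_add]
    calc ‖∫ ω, W (N + 1) ω ∂μ - 1‖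
        = ‖(∫ ω, W N ω ∂μ - 1) + (∫ ω, W (N + 1) ω ∂μ - ∫ ω, W N ω ∂μ)‖ := by congr 1; ring
      _ ≤ _ := (norm_add_le _ _).trans (add_le_add ih (by rw [hstep]; exact hb))

end IsInnovation

/-! ### Lindeberg's condition and the martingale central limit theorem. -/

namespace IsInnovation

variable {Ω : Type*} [mΩ : MeasurableSpace Ω] {μ : Measure Ω} [IsProbabilityMeasure μ]
  {X : ℕ → Ω → ℝ} {ℱ : ℕ → MeasurableSpace Ω} {lam : ℝ}

/-- The factor `N` cancels the `1 / N` in the squares. The remaining indicator is eventually zero at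
each point, and `Y²` dominates. -/
theorem tendsto_lindeberg {Y : Ω → ℝ} (hY : MemLp Y 2 μ) (t ε δ : ℝ) (hδ : 0 < δ) :
    Tendsto (fun N : ℕ => (N : ℝ) * ∫ ω, (ε * (t * Y ω / √N) ^ 2
        + 2 / δ ^ 2 * (if δ ≤ |t * Y ω / √N| then (t * Y ω / √N) ^ 2 else 0)) ∂μ)
      atTop (𝓝 (t ^ 2 * ε * ∫ ω, Y ω ^ 2 ∂μ)) := by
  set F : ℕ → Ω → ℝ := fun N ω => t ^ 2 * ε * Y ω ^ 2
    + 2 / δ ^ 2 * t ^ 2 * ({ω | δ ≤ |t * Y ω / √N|}.indicator (fun ω => Y ω ^ 2) ω) with hF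
  have hYm := hY.1.aemeasurable
  have hlim : Tendsto (fun N => ∫ ω, F N ω ∂μ) atTop (𝓝 (∫ ω, t ^ 2 * ε * Y ω ^ 2 ∂μ)) := by
    refine tendsto_integral_of_dominated_convergence
      (fun ω => |t ^ 2 * ε| * Y ω ^ 2 + 2 / δ ^ 2 * t ^ 2 * Y ω ^ 2) (fun N => ?_) ?_ (fun N => ?_) ?_
    · refine (AEMeasurable.add (by fun_prop) (AEMeasurable.const_mul ?_ _)).aestronglyMeasurable
      refine AEMeasurable.indicator₀ (by fun_prop) ?_
      exact nullMeasurableSet_le (by fun_prop) (by fun_prop)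
    · exact (hY.integrable_sq.const_mul _).add (hY.integrable_sq.const_mul _)
    · refine ae_of_all _ fun ω => ?_
      refine (norm_add_le _ _).trans (add_le_add ?_ ?_)
      · simp [abs_mul]
      · rw [norm_mul, Real.norm_of_nonneg (by positivity)]
        gcongr
        refine (norm_indicator_le_norm_self _ _).trans ?_
        simp
    · refine ae_of_all _ fun ω => ?_
      have h0 : Tendsto (fun N : ℕ => |t * Y ω / √N|) atTop (𝓝 0) := by
        have h := (tendsto_const_nhds (x := t * Y ω)).div_atTop
          (Real.tendsto_sqrt_atTop.comp tendsto_natCast_atTop_atTop)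
        simpa using h.abs
      have : (fun N => F N ω) =ᶠ[atTop] fun _ => t ^ 2 * ε * Y ω ^ 2 := by
        filter_upwards [h0.eventually_lt_const hδ] with N hN
        simp only [hF]
        rw [Set.indicator_of_notMem (by simpa using hN)]
        simp
      exact tendsto_const_nhds.congr' this.symm
  rw [integral_const_mul] at hlim
  refine hlim.congr' ?_
  filter_upwards [eventually_ge_atTop 1] with N hN
  have hN' : (0 : ℝ) < N := by positivity
  rw [← integral_const_mul]
  congr 1; ext ω
  simp only [hF, Set.indicator_apply, Set.mem_ofPred_eq, div_pow, Real.sq_sqrt hN'.le, mul_pow]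
  split_ifs
  · field_simp
  · field_simp
    ring

/-- Since the `Z m` share a law, all `N` summands are bounded by one integral in `Z 0`. Only
domination is asked of `y`, so that truncated multipliers are allowed. -/
theorem tendsto_sum_gaussDefect (hX : IsInnovation X ℱ lam μ) {Z : ℕ → Ω → ℝ}
    (hZ2 : MemLp (Z 0) 2 μ) (hid : ∀ m, IdentDistrib (Z m) (Z 0) μ μ) (t : ℝ)
    {y : ℕ → ℕ → Ω → ℝ} (hy : ∀ N m ω, |y N m ω| ≤ |t * Z m ω / √N|) :
    Tendsto (fun N : ℕ => ∑ m ∈ Finset.range N, ∫ ω, ‖gaussDefect (X m) lam μ (y N m ω)‖ ∂μ)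
      atTop (𝓝 0) := by
  rw [Metric.tendsto_atTop']
  intro η hη
  set E := ∫ ω, Z 0 ω ^ 2 ∂μ with hE
  have hE0 : 0 ≤ E := integral_nonneg fun ω => sq_nonneg _
  -- The left side is the limit of the Lindeberg bound; the `+ 1` in the witness avoids division by
  -- zero.
  obtain ⟨ε, hε, hεη⟩ : ∃ ε > 0, t ^ 2 * ε * E < η := by
    refine ⟨η / (t ^ 2 * E + 1), by positivity, ?_⟩
    have : 0 ≤ t ^ 2 * E := by positivity
    rw [mul_right_comm, mul_div_assoc', div_lt_iff₀ (by positivity)]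
    nlinarith
  obtain ⟨δ, hδ, hb⟩ := hX.norm_gaussDefect_le 0 hε
  have hlaw : ∀ m, gaussDefect (X m) lam μ = gaussDefect (X 0) lam μ := fun m => by
    unfold gaussDefect; rw [(hX.ident m 0).map_eq]
  obtain ⟨N₀, hN₀⟩ := eventually_atTop.1
    ((tendsto_lindeberg hZ2 t ε δ hδ).eventually_lt_const hεη)
  refine ⟨N₀, fun N hN => ?_⟩
  rw [Real.dist_0_eq_abs, abs_of_nonneg
    (Finset.sum_nonneg fun m _ => integral_nonneg fun ω => norm_nonneg _)]
  refine lt_of_le_of_lt ?_ (hN₀ N hN.le)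
  set B : ℝ → ℝ := fun x => ε * (t * x / √N) ^ 2
        + 2 / δ ^ 2 * (if δ ≤ |t * x / √N| then (t * x / √N) ^ 2 else 0) with hB
  have hBm : Measurable B := by
    refine Measurable.add (by fun_prop) (Measurable.const_mul ?_ _)
    refine Measurable.ite (measurableSet_le (by fun_prop) (by fun_prop)) (by fun_prop) (by fun_prop)
  have hBi : Integrable (fun ω => B (Z 0 ω)) μ := by
    refine ((hZ2.integrable_sq.const_mul ((ε + 2 / δ ^ 2) * (t / √N) ^ 2))).mono'
      (hBm.comp_aemeasurable hZ2.1.aemeasurable).aestronglyMeasurable (ae_of_all _ fun ω => ?_)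
    have h0 : 0 ≤ B (Z 0 ω) := by simp only [hB]; split_ifs <;> positivity
    rw [Real.norm_of_nonneg h0]
    have h1 : (if δ ≤ |t * Z 0 ω / √N| then (t * Z 0 ω / √N) ^ 2 else 0) ≤ (t * Z 0 ω / √N) ^ 2 := by
      split_ifs
      · exact le_rfl
      · positivity
    calc B (Z 0 ω) ≤ ε * (t * Z 0 ω / √N) ^ 2 + 2 / δ ^ 2 * (t * Z 0 ω / √N) ^ 2 := by
          simp only [hB]; gcongr
      _ = _ := by ring
  have hterm : ∀ m ∈ Finset.range N, ∫ ω, ‖gaussDefect (X m) lam μ (y N m ω)‖ ∂μ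
      ≤ ∫ ω, B (Z 0 ω) ∂μ := fun m _ => by
    have hidB := (hid m).comp hBm
    rw [show ∫ ω, B (Z 0 ω) ∂μ = ∫ ω, B (Z m ω) ∂μ from hidB.integral_eq.symm]
    refine integral_mono_of_nonneg (ae_of_all _ fun ω => norm_nonneg _)
      (hidB.integrable_iff.2 hBi) (ae_of_all _ fun ω => ?_)
    simp only [hlaw m]
    refine (hb _).trans ?_
    have hsq : y N m ω ^ 2 ≤ (t * Z m ω / √N) ^ 2 := sq_le_sq.2 (hy N m ω)
    simp only [hB]
    gcongr
    split_ifs with h1 h2 h2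
    · exact hsq
    · exact absurd (h1.trans (hy N m ω)) h2
    · positivity
    · exact le_rfl
  refine (Finset.sum_le_sum hterm).trans ?_
  simp [hB]

/-- **Central limit theorem** for martingale transforms of innovations. -/
theorem tendsto_integral_exp (hX : IsInnovation X ℱ lam μ) {Z : ℕ → Ω → ℝ}
    (hZ : ∀ m, Measurable[ℱ m] (Z m)) (hZ2 : MemLp (Z 0) 2 μ)
    (hid : ∀ m, IdentDistrib (Z m) (Z 0) μ μ) {s : ℝ} (hL : MeanLLN μ (fun m ω => Z m ω ^ 2) s)
    (t : ℝ) :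
    Tendsto (fun N : ℕ => ∫ ω, Complex.exp
        ((t * ((∑ m ∈ Finset.range N, X m ω * Z m ω) / √N) : ℝ) * Complex.I) ∂μ)
      atTop (𝓝 (Complex.exp (-((lam ^ 2 * t ^ 2 * s / 2 : ℝ) : ℂ)))) := by
  have hs : s = ∫ ω, Z 0 ω ^ 2 ∂μ := hL.eq_of_integral fun m =>
    ((hid m).comp (u := fun x : ℝ => x ^ 2) (by fun_prop)).integral_eq
  have hs0 : 0 ≤ s := hs ▸ integral_nonneg fun ω => sq_nonneg _
  -- Any level above `s` would do. With a gap of `1`, exceeding it forces a deviation of at least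
  -- `1` in the average of `Z²`, so the bad event is controlled by `L N`.
  set C := s + 1 with hC
  -- The multipliers are switched off once the accumulated squares pass `C * N`. The test includes
  -- `Z m`, which is already `ℱ m`-measurable, so `y` stays predictable while its squares sum to at
  -- most `t² C`.
  set y : ℕ → ℕ → Ω → ℝ := fun N m ω =>
    if ∑ j ∈ Finset.range (m + 1), Z j ω ^ 2 ≤ C * N then t * Z m ω / √N else 0 with hy
  set B := lam ^ 2 / 2 * (t ^ 2 * C) with hB
  have hB0 : 0 ≤ B := by positivity
  have hyle : ∀ N m ω, |y N m ω| ≤ |t * Z m ω / √N| := fun N m ω => by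
    simp only [hy]; split_ifs <;> simp
  have hym : ∀ N m, Measurable[ℱ m] (y N m) := fun N m => by
    refine Measurable.ite ?_ (((hZ m).const_mul t).div_const _) measurable_const
    refine @measurableSet_le ℝ Ω _ _ _ (ℱ m) _ _ _ _ _ ?_ measurable_const
    exact Finset.measurable_fun_sum _ fun j hj =>
        ((hZ j).mono (hX.mono (by simpa [Nat.lt_succ_iff] using hj)) le_rfl).pow_const 2
  have hysq : ∀ N m ω, 1 ≤ N → y N m ω ^ 2 ≤ t ^ 2 * Z m ω ^ 2 / N := fun N m ω hN => by
    have hN' : (0 : ℝ) < N := by positivity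
    refine (sq_le_sq.2 (hyle N m ω)).trans (le_of_eq ?_)
    rw [div_pow, Real.sq_sqrt hN'.le, mul_pow]
  have hyD : ∀ N : ℕ, 1 ≤ N → ∀ m ω, ∑ j ∈ Finset.range m, y N j ω ^ 2 ≤ t ^ 2 * C := by
    intro N hN m ω
    have hN' : (0 : ℝ) < N := by positivity
    induction m with
    | zero => simp; positivity
    | succ m ih =>
      by_cases h : ∑ j ∈ Finset.range (m + 1), Z j ω ^ 2 ≤ C * N
      · refine (Finset.sum_le_sum fun j _ => hysq N j ω hN).trans ?_
        rw [← Finset.sum_div, ← Finset.mul_sum, div_le_iff₀ hN']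
        calc t ^ 2 * ∑ j ∈ Finset.range (m + 1), Z j ω ^ 2 ≤ t ^ 2 * (C * N) := by gcongr
          _ = _ := by ring
      · rw [Finset.sum_range_succ]
        have : y N m ω = 0 := by simp only [hy]; rw [if_neg h]
        simpa [this] using ih
  have hmZ : ∀ m, Measurable (Z m) := fun m => (hZ m).mono (hX.le m) le_rfl
  have hmy : ∀ N m, Measurable (y N m) := fun N m => (hym N m).mono (hX.le m) le_rfl
  have hmX := hX.measurable
  set L : ℕ → ℝ := fun N => ∫ ω, |(∑ m ∈ Finset.range N, Z m ω ^ 2) / N - s| ∂μ with hLdef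
  have hLi : ∀ N : ℕ, Integrable (fun ω => |(∑ m ∈ Finset.range N, Z m ω ^ 2) / N - s|) μ := fun N =>
    (((integrable_finsetSum _ fun m _ => hL.1 m).div_const _).sub (integrable_const _)).abs
  set Q : ℕ → ℝ := fun N => ∑ m ∈ Finset.range N, ∫ ω, ‖gaussDefect (X m) lam μ (y N m ω)‖ ∂μ
  have hbound : ∀ N : ℕ, 1 ≤ N → ‖∫ ω, Complex.exp
        ((t * ((∑ m ∈ Finset.range N, X m ω * Z m ω) / √N) : ℝ) * Complex.I) ∂μ
        - Complex.exp (-((lam ^ 2 * t ^ 2 * s / 2 : ℝ) : ℂ))‖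
      ≤ (2 + Real.exp B * B) * L N + Real.exp B * Q N := by
    intro N hN
    have hN' : (0 : ℝ) < N := by positivity
    set a := lam ^ 2 * t ^ 2 * s / 2 with ha
    have ha0 : 0 ≤ a := by positivity
    have haB : a ≤ B := by
      simp only [ha, hB, hC]
      have : 0 ≤ lam ^ 2 * t ^ 2 := by positivity
      nlinarith
    set A : Ω → ℝ := fun ω => lam ^ 2 / 2 * ∑ j ∈ Finset.range N, y N j ω ^ 2 with hA
    set S : Ω → ℝ := fun ω => ∑ j ∈ Finset.range N, X j ω * y N j ω with hS
    set T : Ω → ℝ := fun ω => t * ((∑ m ∈ Finset.range N, X m ω * Z m ω) / √N) with hT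
    have hAB : ∀ ω, A ω ≤ B := fun ω => mul_le_mul_of_nonneg_left (hyD N hN N ω) (by positivity)
    have hA0 : ∀ ω, 0 ≤ A ω := fun ω =>
      mul_nonneg (by positivity) (Finset.sum_nonneg fun j _ => sq_nonneg _)
    have hgood : ∀ ω, ∑ j ∈ Finset.range N, Z j ω ^ 2 ≤ C * N → ∀ j ∈ Finset.range N,
        y N j ω = t * Z j ω / √N := fun ω hω j hj => by
      simp only [hy]
      rw [if_pos]
      refine le_trans (Finset.sum_le_sum_of_subset_of_nonneg ?_ fun _ _ _ => sq_nonneg _) hω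
      exact Finset.range_subset_range.2 (Finset.mem_range.1 hj)
    have hbad : ∀ ω, ¬ ∑ j ∈ Finset.range N, Z j ω ^ 2 ≤ C * N →
        1 ≤ |(∑ m ∈ Finset.range N, Z m ω ^ 2) / N - s| := fun ω hω => by
      refine le_trans ?_ (le_abs_self _)
      have : C ≤ (∑ m ∈ Finset.range N, Z m ω ^ 2) / N := by
        rw [le_div_iff₀ hN']; exact (not_le.1 hω).le
      linarith
    have hTS : ∀ ω, ‖Complex.exp ((T ω : ℂ) * Complex.I) - Complex.exp ((S ω : ℂ) * Complex.I)‖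
        ≤ 2 * |(∑ m ∈ Finset.range N, Z m ω ^ 2) / N - s| := fun ω => by
      by_cases hω : ∑ j ∈ Finset.range N, Z j ω ^ 2 ≤ C * N
      · have : T ω = S ω := by
          simp only [hT, hS]
          rw [Finset.sum_div, Finset.mul_sum]
          exact Finset.sum_congr rfl fun j hj => by rw [hgood ω hω j hj]; ring
        rw [this]; simp
      · refine (norm_sub_le _ _).trans ?_
        simp only [Complex.norm_exp_ofReal_mul_I]
        linarith [hbad ω hω]
    have haA : ∀ ω, |a - A ω| ≤ B * |(∑ m ∈ Finset.range N, Z m ω ^ 2) / N - s| := fun ω => by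
      by_cases hω : ∑ j ∈ Finset.range N, Z j ω ^ 2 ≤ C * N
      · have : A ω = lam ^ 2 * t ^ 2 / 2 * ((∑ m ∈ Finset.range N, Z m ω ^ 2) / N) := by
          simp only [hA]
          rw [Finset.sum_congr rfl fun j hj => by rw [hgood ω hω j hj, div_pow, Real.sq_sqrt hN'.le,
            mul_pow], ← Finset.sum_div, ← Finset.mul_sum]
          ring
        rw [this, show a - lam ^ 2 * t ^ 2 / 2 * ((∑ m ∈ Finset.range N, Z m ω ^ 2) / N)
          = -(lam ^ 2 * t ^ 2 / 2 * ((∑ m ∈ Finset.range N, Z m ω ^ 2) / N - s)) by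
          simp only [ha]; ring, abs_neg, abs_mul, abs_of_nonneg (by positivity)]
        gcongr
        simp only [hB, hC]
        have : 0 ≤ lam ^ 2 * t ^ 2 := by positivity
        nlinarith
      · have h1 : |a - A ω| ≤ B := abs_le.2 ⟨by linarith [hAB ω], by linarith [hA0 ω]⟩
        nlinarith [hbad ω hω]
    have hexp : ∀ ω, |Real.exp a - Real.exp (A ω)|
        ≤ Real.exp B * (B * |(∑ m ∈ Finset.range N, Z m ω ^ 2) / N - s|) := fun ω => by
      refine le_trans ?_ (mul_le_mul_of_nonneg_left (haA ω) (Real.exp_nonneg B))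
      have key : ∀ u v : ℝ, u ≤ v → v ≤ B → Real.exp v - Real.exp u ≤ Real.exp B * (v - u) := by
        intro u v huv hv
        have h1 := Real.add_one_le_exp (u - v)
        have h2 : Real.exp u = Real.exp v * Real.exp (u - v) := by rw [← Real.exp_add]; ring_nf
        have h3 : Real.exp v ≤ Real.exp B := Real.exp_le_exp.2 hv
        have h4 := Real.exp_pos v
        rw [h2]
        nlinarith
      rcases le_total a (A ω) with h | h
      · rw [abs_sub_comm, abs_sub_comm a, abs_of_nonneg (by linarith [Real.exp_le_exp.2 h]),
          abs_of_nonneg (by linarith)]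
        exact key _ _ h (hAB ω)
      · rw [abs_of_nonneg (by linarith [Real.exp_le_exp.2 h]), abs_of_nonneg (by linarith)]
        exact key _ _ h haB
    have hTm : Measurable T := by simp only [hT]; fun_prop
    have hmyN := hmy N
    have hSm : Measurable S := by simp only [hS]; fun_prop
    have hAm : Measurable A := by simp only [hA]; fun_prop
    have hiT : Integrable (fun ω => Complex.exp ((T ω : ℂ) * Complex.I)) μ :=
      Integrable.of_bound (by fun_prop) 1 (ae_of_all _ fun ω => by simp)
    have hiS : Integrable (fun ω => Complex.exp ((S ω : ℂ) * Complex.I)) μ :=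
      Integrable.of_bound (by fun_prop) 1 (ae_of_all _ fun ω => by simp)
    have hiAS : Integrable (fun ω => Complex.exp ((A ω : ℂ) + (S ω : ℂ) * Complex.I)) μ :=
      Integrable.of_bound (by fun_prop) (Real.exp B) (ae_of_all _ fun ω => by
        rw [Complex.norm_exp]; simpa using hAB ω)
    have p1 : ‖∫ ω, Complex.exp ((T ω : ℂ) * Complex.I) ∂μ
        - ∫ ω, Complex.exp ((S ω : ℂ) * Complex.I) ∂μ‖ ≤ 2 * L N := by
      rw [← integral_sub hiT hiS, hLdef, ← integral_const_mul]
      exact norm_integral_le_of_norm_le ((hLi N).const_mul 2) (ae_of_all _ hTS)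
    have p2 : ‖Complex.exp (a : ℂ) * ∫ ω, Complex.exp ((S ω : ℂ) * Complex.I) ∂μ
        - ∫ ω, Complex.exp ((A ω : ℂ) + (S ω : ℂ) * Complex.I) ∂μ‖ ≤ Real.exp B * B * L N := by
      rw [← integral_const_mul, ← integral_sub (hiS.const_mul _) hiAS, hLdef, ← integral_const_mul]
      refine norm_integral_le_of_norm_le ((hLi N).const_mul _) (ae_of_all _ fun ω => ?_)
      rw [Complex.exp_add, ← sub_mul, norm_mul, Complex.norm_exp_ofReal_mul_I, mul_one,
        ← Complex.ofReal_exp, ← Complex.ofReal_exp, ← Complex.ofReal_sub, Complex.norm_real,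
        Real.norm_eq_abs, mul_assoc]
      exact hexp ω
    have p3 : ‖∫ ω, Complex.exp ((A ω : ℂ) + (S ω : ℂ) * Complex.I) ∂μ - 1‖ ≤ Real.exp B * Q N :=
      hX.norm_integral_exp_sub_one_le (hym N) (hyD N hN) N
    -- The random compensator `exp A` has been traded for the constant `exp a`, which can now be
    -- divided out; `exp (-a)` has norm at most `1`.
    have p4 : ‖∫ ω, Complex.exp ((S ω : ℂ) * Complex.I) ∂μ - Complex.exp (-(a : ℂ))‖
        ≤ Real.exp B * B * L N + Real.exp B * Q N := by
      have : ∫ ω, Complex.exp ((S ω : ℂ) * Complex.I) ∂μ - Complex.exp (-(a : ℂ))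
          = Complex.exp (-(a : ℂ)) * ((Complex.exp (a : ℂ) * ∫ ω, Complex.exp ((S ω : ℂ) * Complex.I) ∂μ
        - ∫ ω, Complex.exp ((A ω : ℂ) + (S ω : ℂ) * Complex.I) ∂μ)
          + (∫ ω, Complex.exp ((A ω : ℂ) + (S ω : ℂ) * Complex.I) ∂μ - 1)) := by
        rw [sub_add_sub_cancel, mul_sub, ← mul_assoc, ← Complex.exp_add]
        simp
      rw [this, norm_mul]
      have h1 : ‖Complex.exp (-(a : ℂ))‖ ≤ 1 := by
        rw [Complex.norm_exp]; simpa using ha0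
      calc _ ≤ 1 * (Real.exp B * B * L N + Real.exp B * Q N) := by
            refine mul_le_mul h1 ((norm_add_le _ _).trans (add_le_add p2 p3)) (norm_nonneg _) zero_le_one
        _ = _ := one_mul _
    calc _ ≤ _ := norm_sub_le_norm_sub_add_norm_sub _ (∫ ω, Complex.exp ((S ω : ℂ) * Complex.I) ∂μ) _
      _ ≤ 2 * L N + (Real.exp B * B * L N + Real.exp B * Q N) := add_le_add p1 p4
      _ = _ := by ring
  have hQ : Tendsto Q atTop (𝓝 0) := hX.tendsto_sum_gaussDefect hZ2 hid t hyle
  have hlim : Tendsto (fun N => (2 + Real.exp B * B) * L N + Real.exp B * Q N) atTop (𝓝 0) := by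
    simpa using (hL.2.const_mul (2 + Real.exp B * B)).add (hQ.const_mul (Real.exp B))
  rw [tendsto_iff_norm_sub_tendsto_zero]
  exact squeeze_zero' (Eventually.of_forall fun N => norm_nonneg _)
    (eventually_atTop.2 ⟨1, hbound⟩) hlim

end IsInnovation

/-! ### The mean ergodic theorem for averages of a single function. -/

section MeanErgodic

variable {α : Type*} [MeasurableSpace α] {ν : Measure α} [IsProbabilityMeasure ν] {T : α → α}

/-- Von Neumann's theorem for the composition isometry on `L²` gives convergence to the projection
onto invariant functions. By ergodicity that projection is constant, and invariance of the mean
identifies the constant. -/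
theorem Ergodic.tendsto_integral_abs_average_of_memLp (hT : Ergodic T ν) {f : α → ℝ}
    (hf : MemLp f 2 ν) :
    Tendsto (fun N : ℕ => ∫ x, |(∑ m ∈ Finset.range N, f (T^[m] x)) / N - ∫ x, f x ∂ν| ∂ν)
      atTop (𝓝 0) := by
  have hTm := hT.toMeasurePreserving
  have hfm : ∀ m : ℕ, MemLp (f ∘ T^[m]) 2 ν := fun m => hf.comp_measurePreserving (hTm.iterate m)
  set U : Lp ℝ 2 ν →L[ℝ] Lp ℝ 2 ν := (Lp.compMeasurePreservingₗᵢ ℝ T hTm).toContinuousLinearMap with hU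
  have hUn : ‖U‖ ≤ 1 := LinearIsometry.norm_toContinuousLinearMap_le _
  set F : Lp ℝ 2 ν := hf.toLp f with hF
  have hconv := U.tendsto_birkhoffAverage_orthogonalProjection hUn F
  set p : Lp ℝ 2 ν := ((U.eqLocus (1 : Lp ℝ 2 ν →L[ℝ] Lp ℝ 2 ν)).orthogonalProjectionOnto F : Lp ℝ 2 ν)
    with hp
  have hpU : Lp.compMeasurePreserving T hTm p = p := by
    have : U p = (1 : Lp ℝ 2 ν →L[ℝ] Lp ℝ 2 ν) p :=
      ((U.eqLocus (1 : Lp ℝ 2 ν →L[ℝ] Lp ℝ 2 ν)).orthogonalProjectionOnto F).2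
    exact this
  obtain ⟨c, hc⟩ := hT.ae_eq_const_of_ae_eq_comp_ae (g := p) (Lp.aestronglyMeasurable p) (by
    have := Lp.coeFn_compMeasurePreserving p hTm
    rw [hpU] at this
    exact this.symm)
  have hpc : p = (memLp_const c).toLp (fun _ => c) := by
    apply Lp.ext
    exact hc.trans (MemLp.coeFn_toLp _).symm
  have hit : ∀ m : ℕ, U^[m] F = (hfm m).toLp _ := fun m => by
    induction m with
    | zero => rfl
    | succ m ih =>
      rw [Function.iterate_succ_apply', ih]
      exact Lp.toLp_compMeasurePreserving (hfm m) hTm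
  have hsm : ∀ N : ℕ, MemLp (fun x => ∑ m ∈ Finset.range N, f (T^[m] x)) 2 ν := fun N =>
    memLp_finsetSum _ fun m _ => hfm m
  have hsum : ∀ N : ℕ, birkhoffSum U _root_.id N F = (hsm N).toLp _ := fun N => by
    induction N with
    | zero =>
      simp only [birkhoffSum_zero']
      exact (MemLp.toLp_zero (hsm 0)).symm
    | succ N ih =>
      rw [birkhoffSum_succ, ih, _root_.id, hit, ← MemLp.toLp_add]
      congr 1
      ext x
      simp [Finset.sum_range_succ]
  have hdm : ∀ N : ℕ, MemLp (fun x => (N : ℝ)⁻¹ * (∑ m ∈ Finset.range N, f (T^[m] x)) - c) 2 ν := fun N =>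
    ((hsm N).const_mul _).sub (memLp_const c)
  have hdist : ∀ N : ℕ, birkhoffAverage ℝ U _root_.id N F - p = (hdm N).toLp _ := fun N => by
    rw [birkhoffAverage, hsum, hpc, ← MemLp.toLp_const_smul, ← MemLp.toLp_sub]
    rfl
  have h0 : Tendsto (fun N => ‖(hdm N).toLp _‖) atTop (𝓝 0) := by
    simp_rw [← hdist]
    exact tendsto_iff_norm_sub_tendsto_zero.1 hconv
  have h1 : Tendsto (fun N : ℕ => ∫ x, |(∑ m ∈ Finset.range N, f (T^[m] x)) / N - c| ∂ν)
      atTop (𝓝 0) := by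
    refine squeeze_zero (fun N => integral_nonneg fun ω => abs_nonneg _) (fun N => ?_) h0
    refine (le_of_eq ?_).trans ((integral_abs_le_sqrt (hdm N)).trans (le_of_eq ?_))
    · congr 1; ext x; congr 1; ring
    · exact (norm_toLp_two_eq_sqrt (hdm N)).symm
  have hLLN : MeanLLN ν (fun m x => f (T^[m] x)) c :=
    ⟨fun m => (hfm m).integrable one_le_two, h1⟩
  have : c = ∫ x, f x ∂ν := hLLN.eq_of_integral fun m => by
      have h2 := integral_map (hTm.iterate m).measurable.aemeasurable
        (f := f) (by rw [(hTm.iterate m).map_eq]; exact hf.1)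
      rw [(hTm.iterate m).map_eq] at h2
      exact h2.symm
  rw [← this]
  exact h1

/-- The **mean ergodic theorem** in `L¹`. -/
theorem Ergodic.meanLLN (hT : Ergodic T ν) {f : α → ℝ} (hf : Integrable f ν) :
    MeanLLN ν (fun m x => f (T^[m] x)) (∫ x, f x ∂ν) := by
  have hTm := hT.toMeasurePreserving
  have hcomp : ∀ {g : α → ℝ}, Integrable g ν → ∀ m : ℕ, Integrable (fun x => g (T^[m] x)) ν :=
    fun hg m => (hTm.iterate m).integrable_comp_of_integrable hg
  have hint : ∀ {g : α → ℝ}, AEStronglyMeasurable g ν → ∀ m : ℕ,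
      ∫ x, g (T^[m] x) ∂ν = ∫ x, g x ∂ν := fun {g} hg m => by
    have h2 := integral_map (hTm.iterate m).measurable.aemeasurable
        (f := g) (by rw [(hTm.iterate m).map_eq]; exact hg)
    rw [(hTm.iterate m).map_eq] at h2
    exact h2.symm
  refine ⟨hcomp hf, ?_⟩
  rw [Metric.tendsto_atTop']
  intro η hη
  -- The `L²` case passes to `L¹` by density of simple functions, with the error split into three
  -- thirds.
  obtain ⟨g, hg, hg2⟩ := (memLp_one_iff_integrable.2 hf).exists_simpleFunc_eLpNorm_sub_lt
    (by simp) (ε := ENNReal.ofReal (η / 3)) (by simpa using by linarith)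
  have hg2' : MemLp g 2 ν := g.memLp_of_isFiniteMeasure 2 ν
  have hgi : Integrable g ν := memLp_one_iff_integrable.1 hg2
  have hfg : ∫ x, |f x - g x| ∂ν < η / 3 := by
    rw [eLpNorm_one_eq_lintegral_enorm] at hg
    have h2 := ofReal_integral_norm_eq_lintegral_enorm (hf.sub hgi)
    rw [← h2] at hg
    simpa using (ENNReal.ofReal_lt_ofReal_iff (by positivity)).1 hg
  obtain ⟨N₀, hN₀⟩ := eventually_atTop.1
    ((hT.tendsto_integral_abs_average_of_memLp hg2').eventually_lt_const
      (show (0 : ℝ) < η / 3 by positivity))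
  refine ⟨N₀ + 1, fun N hN => ?_⟩
  have hN1 : 1 ≤ N := by omega
  have hN' : (0 : ℝ) < N := by positivity
  rw [Real.dist_0_eq_abs, abs_of_nonneg (integral_nonneg fun ω => abs_nonneg _)]
  have hi1 : Integrable (fun x => (∑ m ∈ Finset.range N, |f (T^[m] x) - g (T^[m] x)|) / N) ν :=
    (integrable_finsetSum _ fun m _ => ((hcomp hf m).sub (hcomp hgi m)).abs).div_const _
  have hi2 : Integrable
      (fun x => |(∑ m ∈ Finset.range N, g (T^[m] x)) / N - ∫ x, g x ∂ν|) ν :=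
    (((integrable_finsetSum _ fun m _ => hcomp hgi m).div_const _).sub (integrable_const _)).abs
  have hb : ∫ x, |(∑ m ∈ Finset.range N, f (T^[m] x)) / N - ∫ x, f x ∂ν| ∂ν
      ≤ ∫ x, ((∑ m ∈ Finset.range N, |f (T^[m] x) - g (T^[m] x)|) / N
        + |(∑ m ∈ Finset.range N, g (T^[m] x)) / N - ∫ x, g x ∂ν| + η / 3) ∂ν := by
    refine integral_mono_of_nonneg (ae_of_all _ fun x => abs_nonneg _)
      ((hi1.add hi2).add (integrable_const _)) (ae_of_all _ fun x => ?_)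
    have e : (∑ m ∈ Finset.range N, f (T^[m] x)) / N - ∫ x, f x ∂ν
      = (∑ m ∈ Finset.range N, (f (T^[m] x) - g (T^[m] x))) / N
        + ((∑ m ∈ Finset.range N, g (T^[m] x)) / N - ∫ x, g x ∂ν)
        - ∫ x, (f x - g x) ∂ν := by
      rw [integral_sub hf hgi, Finset.sum_sub_distrib]; ring
    simp only [e]
    refine (abs_sub _ _).trans (add_le_add ((abs_add_le _ _).trans (add_le_add ?_ le_rfl)) ?_)
    · rw [abs_div, Nat.abs_cast]
      gcongr
      exact Finset.abs_sum_le_sum_abs _ _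
    · exact (abs_integral_le_integral_abs).trans hfg.le
  refine hb.trans_lt ?_
  -- Invariance makes every term of the averaged approximation error equal, which gives a bound
  -- uniform in `N`.
  have e1 : ∫ x, (∑ m ∈ Finset.range N, |f (T^[m] x) - g (T^[m] x)|) / N ∂ν
      = ∫ x, |f x - g x| ∂ν := by
    rw [integral_div, integral_finsetSum (f := fun m x => |f (T^[m] x) - g (T^[m] x)|) _
      fun m _ => ((hcomp hf m).sub (hcomp hgi m)).abs]
    rw [Finset.sum_congr rfl fun m _ => hint (g := fun x => |f x - g x|) (hf.sub hgi).abs.1 m]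
    simp; field_simp
  rw [integral_add (f := fun x => (∑ m ∈ Finset.range N, |f (T^[m] x) - g (T^[m] x)|) / N
        + |(∑ m ∈ Finset.range N, g (T^[m] x)) / N - ∫ x, g x ∂ν|) (hi1.add hi2) (integrable_const _),
        integral_add hi1 hi2, e1]
  have := hN₀ N (by omega)
  simp only [integral_const, probReal_univ, one_smul]
  linarith

end MeanErgodic

/-! ### The filtration, stationarity, and limit theorems for finite moving averages. -/

section History

variable {Ω : Type*} [mΩ : MeasurableSpace Ω] {μ : Measure Ω} [IsProbabilityMeasure μ]

/-- Associativity of product measures. It makes the current input independent of the past input and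
the output noise jointly. -/
theorem IndepFun.prodMk_right_of_prodMk_left {α β γ : Type*} [MeasurableSpace α]
    [MeasurableSpace β] [MeasurableSpace γ] {X : Ω → α} {Y : Ω → β} {W : Ω → γ}
    (hX : Measurable X) (hY : Measurable Y) (hW : Measurable W) (hXY : IndepFun X Y μ)
    (hXYW : IndepFun (fun ω => (X ω, Y ω)) W μ) : IndepFun X (fun ω => (Y ω, W ω)) μ := by
  have hYW : IndepFun Y W μ := hXYW.comp (φ := Prod.snd) (ψ := id) measurable_snd measurable_id
  have := Measure.isProbabilityMeasure_map (μ := μ) hX.aemeasurable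
  have := Measure.isProbabilityMeasure_map (μ := μ) hY.aemeasurable
  have := Measure.isProbabilityMeasure_map (μ := μ) hW.aemeasurable
  rw [indepFun_iff_map_prod_eq_prod_map_map hX.aemeasurable (hY.prodMk hW).aemeasurable,
    hYW.map_prod_eq_prod_map_map hY.aemeasurable hW.aemeasurable]
  have h1 := hXYW.map_prod_eq_prod_map_map (hX.prodMk hY).aemeasurable hW.aemeasurable
  rw [hXY.map_prod_eq_prod_map_map hX.aemeasurable hY.aemeasurable] at h1
  have h2 := (measurePreserving_prodAssoc (μ.map X) (μ.map Y) (μ.map W)).map_eq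
  rw [← h1, Measure.map_map (MeasurableEquiv.measurable _) ((hX.prodMk hY).prodMk hW)] at h2
  exact h2

/-- The information in `a 0, …, a (m - 1)` and in the whole sequence `b`. -/
@[reducible] def history (a b : ℕ → Ω → ℝ) (m : ℕ) : MeasurableSpace Ω :=
  MeasurableSpace.comap
    (fun ω => ((fun j : Finset.range m => a j ω), (fun k => b k ω))) inferInstance

variable {a b : ℕ → Ω → ℝ} {lam sigma : ℝ}

theorem measurable_history_left {m j : ℕ} (h : j < m) : Measurable[history a b m] (a j) := by
  have : a j = (fun p : (Finset.range m → ℝ) × (ℕ → ℝ) => p.1 ⟨j, Finset.mem_range.2 h⟩) ∘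
    (fun ω => ((fun j : Finset.range m => a j ω), (fun k => b k ω))) := rfl
  rw [this]
  exact Measurable.comp (by fun_prop) (comap_measurable _)

theorem measurable_history_right (m k : ℕ) : Measurable[history a b m] (b k) := by
  have : b k = (fun p : (Finset.range m → ℝ) × (ℕ → ℝ) => p.2 k) ∘
    (fun ω => ((fun j : Finset.range m => a j ω), (fun k => b k ω))) := rfl
  rw [this]
  exact Measurable.comp (by fun_prop) (comap_measurable _)

theorem IsWhiteNoise.memLp_all (ha : IsWhiteNoise a lam μ) (m : ℕ) : MemLp (a m) 2 μ :=
  (ha.identDistrib m).memLp_iff.2 ha.memLp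

/-- Independence of the two sequences allows the whole of `b`, future included, in every σ-algebra.
This is needed because the score multiplies `a m` by `b` at indices on both sides of `m`. -/
theorem IsWhiteNoise.isInnovation (ha : IsWhiteNoise a lam μ) (hb : ∀ k, Measurable (b k))
    (hab : IndepFun (fun ω k => a k ω) (fun ω k => b k ω) μ) :
    IsInnovation a (history a b) lam μ where
  le m := by
    have ham := ha.measurable
    exact Measurable.comap_le (by fun_prop)
  mono m n hmn := by
    refine Measurable.comap_le ?_
    refine Measurable.prodMk ?_ ?_
    · exact (@measurable_pi_iff _ _ _ (history a b n) _ _).2 fun j =>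
        measurable_history_left ((Finset.mem_range.1 j.2).trans_le hmn)
    · exact (@measurable_pi_iff _ _ _ (history a b n) _ _).2 fun k => measurable_history_right n k
  meas m := measurable_history_left (Nat.lt_succ_self m)
  indep m := by
    have ham := ha.measurable
    have h1 : IndepFun (a m) (fun ω (j : Finset.range m) => a j ω) μ := by
      have h := ha.indep.indepFun_finset {m} (Finset.range m) (by simp) ham
      exact h.comp (φ := fun x : (({m} : Finset ℕ) → ℝ) => x ⟨m, by simp⟩) (ψ := id)
        (by fun_prop) measurable_id
    have h2 : IndepFun (fun ω => (a m ω, (fun j : Finset.range m => a j ω)))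
        (fun ω k => b k ω) μ :=
      hab.comp (φ := fun x : ℕ → ℝ => (x m, fun j : Finset.range m => x j)) (ψ := id)
        (by fun_prop) measurable_id
    exact (IndepFun_iff_Indep _ _ _).1
      (IndepFun.prodMk_right_of_prodMk_left (ham m) (by fun_prop) (by fun_prop) h1 h2)
  ident m n := (ha.identDistrib m).trans (ha.identDistrib n).symm
  memLp := ha.memLp_all
  mean m := by rw [(ha.identDistrib m).integral_eq, ha.mean_zero]
  sq m := by
    have h1 := ((ha.identDistrib m).comp (u := fun x : ℝ => x ^ 2) (by fun_prop)).integral_eq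
    have h2 := ha.variance_eq
    rw [variance_of_integral_eq_zero ha.memLp.1.aemeasurable ha.mean_zero] at h2
    exact h1.trans h2

theorem IsWhiteNoise.map_shift (ha : IsWhiteNoise a lam μ) (m : ℕ) :
    μ.map (fun ω k => a (k + m) ω) = μ.map (fun ω k => a k ω) := by
  have ham := ha.measurable
  have h2 : iIndepFun (fun k => a (k + m)) μ :=
    ha.indep.precomp (g := fun k => k + m) (add_left_injective m)
  rw [ha.indep.map_fun_eq_infinitePi_map ham, h2.map_fun_eq_infinitePi_map fun k => ham _]
  congr 1
  ext1 k
  exact ((ha.identDistrib (k + m)).trans (ha.identDistrib k).symm).map_eq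

theorem shift_iterate (m : ℕ) (x : ℕ → ℝ) :
    (fun (x : ℕ → ℝ) (k : ℕ) => x (k + 1))^[m] x = fun k => x (k + m) := by
  induction m generalizing x with
  | zero => rfl
  | succ m ih =>
    rw [Function.iterate_succ_apply, ih]
    funext k
    congr 1

theorem IsStationaryErgodicNoise.map_shift (hb : IsStationaryErgodicNoise b sigma μ) (m : ℕ) :
    μ.map (fun ω k => b (k + m) ω) = μ.map (fun ω k => b k ω) := by
  have hbm := hb.measurable
  have h := (hb.ergodic.toMeasurePreserving.iterate m)
  have h2 := h.map_eq
  rw [Measure.map_map h.measurable (by fun_prop)] at h2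
  simpa only [Function.comp_def, shift_iterate] using h2

theorem identDistrib_shift (ha : IsWhiteNoise a lam μ) (hb : IsStationaryErgodicNoise b sigma μ)
    (hab : IndepFun (fun ω k => a k ω) (fun ω k => b k ω) μ) (m : ℕ) :
    IdentDistrib (fun ω => ((fun k => a (k + m) ω), (fun k => b (k + m) ω)))
      (fun ω => ((fun k => a k ω), (fun k => b k ω))) μ μ where
  aemeasurable_fst := by
    have ham := ha.measurable
    have hbm := hb.measurable
    fun_prop
  aemeasurable_snd := by
    have ham := ha.measurable
    have hbm := hb.measurable
    fun_prop
  map_eq := by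
    have ham := ha.measurable
    have hbm := hb.measurable
    have h : IndepFun (fun ω k => a (k + m) ω) (fun ω k => b (k + m) ω) μ :=
      hab.comp (φ := fun (x : ℕ → ℝ) k => x (k + m)) (ψ := fun (x : ℕ → ℝ) k => x (k + m))
        (by fun_prop) (by fun_prop)
    rw [hab.map_prod_eq_prod_map_map (by fun_prop) (by fun_prop),
      h.map_prod_eq_prod_map_map (by fun_prop) (by fun_prop), ha.map_shift, hb.map_shift]

theorem IsStationaryErgodicNoise.meanLLN (hb : IsStationaryErgodicNoise b sigma μ)
    {F : (ℕ → ℝ) → ℝ} (hF : Measurable F) (hFi : Integrable (fun ω => F fun k => b k ω) μ) :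
    MeanLLN μ (fun m ω => F fun k => b (k + m) ω) (∫ ω, F (fun k => b k ω) ∂μ) := by
  have hbm := hb.measurable
  have hm : Measurable fun ω k => b k ω := by fun_prop
  have : IsProbabilityMeasure (μ.map fun ω k => b k ω) :=
    Measure.isProbabilityMeasure_map hm.aemeasurable
  have hFi' : Integrable F (μ.map fun ω k => b k ω) :=
    (integrable_map_measure hF.aestronglyMeasurable hm.aemeasurable).2 hFi
  have h := hb.ergodic.meanLLN hFi'
  simp only [shift_iterate] at h
  refine ⟨fun m => ?_, ?_⟩
  · exact (integrable_map_measure (f := fun ω k => b k ω) (g := fun x => F fun k => x (k + m))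
      (Measurable.aestronglyMeasurable (by fun_prop)) hm.aemeasurable).1 (h.1 m)
  · have h2 := h.2
    rw [integral_map hm.aemeasurable hF.aestronglyMeasurable] at h2
    refine h2.congr fun N => ?_
    rw [integral_map hm.aemeasurable (Measurable.aestronglyMeasurable (by fun_prop))]

theorem IsWhiteNoise.meanLLN_sq (ha : IsWhiteNoise a lam μ) (q : ℕ) :
    MeanLLN μ (fun m ω => a (m + q) ω ^ 2) (lam ^ 2) := by
  have hid : ∀ m, IdentDistrib (fun ω => a (m + q) ω ^ 2) (fun ω => a (0 + q) ω ^ 2) μ μ := fun m =>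
    ((ha.identDistrib (m + q)).trans (ha.identDistrib (0 + q)).symm).comp
      (u := fun x : ℝ => x ^ 2) (by fun_prop)
  have hint : ∀ m, Integrable (fun ω => a m ω ^ 2) μ := fun m => (ha.memLp_all m).integrable_sq
  have hmean : ∫ ω, a (0 + q) ω ^ 2 ∂μ = lam ^ 2 := by
    have h1 := ((ha.identDistrib (0 + q)).comp (u := fun x : ℝ => x ^ 2) (by fun_prop)).integral_eq
    have h2 := ha.variance_eq
    rw [variance_of_integral_eq_zero ha.memLp.1.aemeasurable ha.mean_zero] at h2
    exact h1.trans h2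
  have h := strong_law_Lp (p := 1) le_rfl (by simp) (fun m ω => a (m + q) ω ^ 2)
    (memLp_one_iff_integrable.2 (hint (0 + q))) (fun i j hij =>
      (ha.indep.indepFun (i := i + q) (j := j + q) (by omega)).comp (φ := fun x : ℝ => x ^ 2)
        (ψ := fun x : ℝ => x ^ 2) (by fun_prop) (by fun_prop)) hid
  refine ⟨fun m => hint _, ?_⟩
  have h' := (ENNReal.tendsto_toReal (by simp)).comp h
  simp only [ENNReal.toReal_zero] at h'
  refine h'.congr fun N => ?_
  have hi : Integrable (fun ω => (N : ℝ)⁻¹ • (∑ i ∈ Finset.range N, a (i + q) ω ^ 2)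
      - ∫ ω, a (0 + q) ω ^ 2 ∂μ) μ :=
    ((integrable_finsetSum _ fun m _ => hint (m + q)).smul (N : ℝ)⁻¹).sub (integrable_const _)
  simp only [Function.comp]
  rw [eLpNorm_one_eq_lintegral_enorm, ← ofReal_integral_norm_eq_lintegral_enorm hi,
    ENNReal.toReal_ofReal (integral_nonneg fun _ => norm_nonneg _), hmean]
  congr 1; ext ω
  rw [Real.norm_eq_abs, smul_eq_mul]
  congr 1
  ring

/-- A moving average of the sequences `a` and `b`. -/
def window (a b : ℕ → Ω → ℝ) (β δ : ℕ → ℝ) (P K m : ℕ) (ω : Ω) : ℝ :=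
  ∑ p ∈ Finset.range P, β p * b (p + m) ω + ∑ q ∈ Finset.range K, δ q * a (q + m) ω

theorem IsStationaryErgodicNoise.memLp_all (hb : IsStationaryErgodicNoise b sigma μ) (m : ℕ) :
    MemLp (b m) 2 μ := by
  have hbm := hb.measurable
  have h : IdentDistrib (fun ω k => b (k + m) ω) (fun ω k => b k ω) μ μ :=
    ⟨by fun_prop, by fun_prop, hb.map_shift m⟩
  have h0 := (h.comp (u := fun x : ℕ → ℝ => x 0) (by fun_prop)).memLp_iff (p := 2)
  have h1 := h0.2 hb.memLp
  simpa [Function.comp_def] using h1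

theorem IsStationaryErgodicNoise.integral_sq (hb : IsStationaryErgodicNoise b sigma μ) (m : ℕ) :
    ∫ ω, b m ω ^ 2 ∂μ = sigma ^ 2 := by
  have hbm := hb.measurable
  have h : IdentDistrib (fun ω k => b (k + m) ω) (fun ω k => b k ω) μ μ :=
    ⟨by fun_prop, by fun_prop, hb.map_shift m⟩
  have h1 := (h.comp (u := fun x : ℕ → ℝ => x 0 ^ 2) (by fun_prop)).integral_eq
  have h2 := hb.variance_eq
  rw [variance_of_integral_eq_zero hb.memLp.1.aemeasurable hb.mean_zero] at h2
  simpa [Function.comp_def] using h1.trans h2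

/-- The last input in the window has index `m + K - 1`, so the window is an admissible multiplier
for `a (m + K)`; hence the shifts by `K` below. -/
theorem measurable_window {β δ : ℕ → ℝ} {P K : ℕ} (m : ℕ) :
    Measurable[history a b (m + K)] (window a b β δ P K m) := by
  refine Measurable.add ?_ ?_
  · exact Finset.measurable_fun_sum _ fun p _ => (measurable_history_right _ _).const_mul _
  · refine Finset.measurable_fun_sum _ fun q hq => (measurable_history_left ?_).const_mul _
    have := Finset.mem_range.1 hq
    omega

theorem memLp_window (ha : IsWhiteNoise a lam μ) (hb : IsStationaryErgodicNoise b sigma μ)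
    (β δ : ℕ → ℝ) (P K m : ℕ) : MemLp (window a b β δ P K m) 2 μ :=
  (memLp_finsetSum _ fun _ _ => (hb.memLp_all _).const_mul _).add
    (memLp_finsetSum _ fun _ _ => (ha.memLp_all _).const_mul _)

theorem identDistrib_window (ha : IsWhiteNoise a lam μ) (hb : IsStationaryErgodicNoise b sigma μ)
    (hab : IndepFun (fun ω k => a k ω) (fun ω k => b k ω) μ) (β δ : ℕ → ℝ) (P K m : ℕ) :
    IdentDistrib (window a b β δ P K m) (window a b β δ P K 0) μ μ :=
  (identDistrib_shift ha hb hab m).comp (u := fun x : (ℕ → ℝ) × (ℕ → ℝ) =>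
    ∑ p ∈ Finset.range P, β p * x.2 p + ∑ q ∈ Finset.range K, δ q * x.1 q) (by fun_prop)

/-- The cross terms are grouped by their largest index, so each becomes an innovation times earlier
data. -/
theorem add_sum_mul_sq (δ x : ℕ → ℝ) (v : ℝ) (K : ℕ) :
    (v + ∑ q ∈ Finset.range K, δ q * x q) ^ 2 = v ^ 2 + ∑ q ∈ Finset.range K, δ q ^ 2 * x q ^ 2
      + ∑ q ∈ Finset.range K, x q * (2 * δ q * (v + ∑ r ∈ Finset.range q, δ r * x r)) := by
  induction K with
  | zero => simp
  | succ K ih =>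
    have : (v + ∑ q ∈ Finset.range (K + 1), δ q * x q) ^ 2
      = (v + ∑ q ∈ Finset.range K, δ q * x q) ^ 2 + δ K ^ 2 * x K ^ 2
        + x K * (2 * δ K * (v + ∑ r ∈ Finset.range K, δ r * x r)) := by
      rw [Finset.sum_range_succ]; ring
    rw [this, ih, Finset.sum_range_succ _ K, Finset.sum_range_succ _ K]
    ring

/-- The square has three parts: one in `b` alone (mean ergodic theorem), the squares of `a` (strong
law), and martingale transforms averaging to zero. No joint ergodicity of the pair is used; the
limit constant is recovered from stationarity of the mean. -/
theorem meanLLN_window_sq (ha : IsWhiteNoise a lam μ) (hb : IsStationaryErgodicNoise b sigma μ)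
    (hab : IndepFun (fun ω k => a k ω) (fun ω k => b k ω) μ) (β δ : ℕ → ℝ) (P K : ℕ) :
    MeanLLN μ (fun m ω => window a b β δ P K m ω ^ 2) (∫ ω, window a b β δ P K 0 ω ^ 2 ∂μ) := by
  have hI := ha.isInnovation hb.measurable hab
  have hV : MeanLLN μ (fun m ω => (∑ p ∈ Finset.range P, β p * b (p + m) ω) ^ 2)
      (∫ ω, (∑ p ∈ Finset.range P, β p * b p ω) ^ 2 ∂μ) :=
    hb.meanLLN (F := fun x => (∑ p ∈ Finset.range P, β p * x p) ^ 2) (by fun_prop)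
      (memLp_finsetSum _ fun _ _ => (hb.memLp_all _).const_mul _).integrable_sq
  have hA := MeanLLN.sum (Finset.range K) fun q _ => (ha.meanLLN_sq q).const_mul (δ q ^ 2)
  have hC := MeanLLN.sum (Finset.range K) (c := fun _ => (0 : ℝ))
    (W := fun q m ω => a (m + q) ω * (2 * δ q * window a b β δ P q m ω)) fun q _ => by
    refine (hI.shift q).meanLLN (C := ∫ ω, (2 * δ q * window a b β δ P q 0 ω) ^ 2 ∂μ)
      (fun m => (measurable_window m).const_mul _)
      (fun m => (memLp_window ha hb _ _ _ _ _).const_mul _) (fun m => le_of_eq ?_)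
    exact ((identDistrib_window ha hb hab β δ P q m).comp (u := fun x : ℝ => (2 * δ q * x) ^ 2)
      (by fun_prop)).integral_eq
  have h := (hV.add hA).add hC
  have hfun : (fun m ω => window a b β δ P K m ω ^ 2) = fun m ω =>
      (∑ p ∈ Finset.range P, β p * b (p + m) ω) ^ 2
      + ∑ q ∈ Finset.range K, δ q ^ 2 * a (m + q) ω ^ 2
      + ∑ q ∈ Finset.range K, a (m + q) ω * (2 * δ q * window a b β δ P q m ω) := by
    funext m ω
    simp only [window, add_comm m]
    exact add_sum_mul_sq δ (fun q => a (q + m) ω) _ K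
  rw [hfun]
  convert h using 1
  refine (MeanLLN.eq_of_integral h fun m => ?_).symm
  have h2 := ((identDistrib_window ha hb hab β δ P K m).comp (u := fun x : ℝ => x ^ 2)
      (by fun_prop)).integral_eq
  simp only [Function.comp_def] at h2
  rw [← h2]
  exact congrArg (fun f => ∫ ω, f m ω ∂μ) hfun.symm

theorem tendsto_integral_exp_window (ha : IsWhiteNoise a lam μ)
    (hb : IsStationaryErgodicNoise b sigma μ)
    (hab : IndepFun (fun ω k => a k ω) (fun ω k => b k ω) μ) (β δ : ℕ → ℝ) (P K : ℕ) (t : ℝ) :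
    Tendsto (fun N : ℕ => ∫ ω, Complex.exp
        ((t * ((∑ m ∈ Finset.range N, a (m + K) ω * window a b β δ P K m ω) / √N) : ℝ)
          * Complex.I) ∂μ)
      atTop (𝓝 (Complex.exp
        (-((lam ^ 2 * t ^ 2 * (∫ ω, window a b β δ P K 0 ω ^ 2 ∂μ) / 2 : ℝ) : ℂ)))) :=
  ((ha.isInnovation hb.measurable hab).shift K).tendsto_integral_exp (fun m => measurable_window m)
    (memLp_window ha hb _ _ _ _ _) (identDistrib_window ha hb hab _ _ _ _)
    (meanLLN_window_sq ha hb hab _ _ _ _) t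

theorem integral_sum_window_sq (ha : IsWhiteNoise a lam μ)
    (hb : IsStationaryErgodicNoise b sigma μ)
    (hab : IndepFun (fun ω k => a k ω) (fun ω k => b k ω) μ) (β δ : ℕ → ℝ) (P K N : ℕ) :
    ∫ ω, (∑ m ∈ Finset.range N, a (m + K) ω * window a b β δ P K m ω) ^ 2 ∂μ
      = N * (lam ^ 2 * ∫ ω, window a b β δ P K 0 ω ^ 2 ∂μ) := by
  have hid : ∀ m, ∫ ω, window a b β δ P K m ω ^ 2 ∂μ = ∫ ω, window a b β δ P K 0 ω ^ 2 ∂μ :=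
    fun m => ((identDistrib_window ha hb hab β δ P K m).comp (u := fun x : ℝ => x ^ 2)
      (by fun_prop)).integral_eq
  rw [((ha.isInnovation hb.measurable hab).shift K).integral_sum_sq (fun m => measurable_window m)
    (fun m => memLp_window ha hb _ _ _ _ _)]
  simp [hid]
  ring

end History

/-! ### Transfer of limits along mean-square approximations. -/

/-- The approximations force `x` to be Cauchy, so the limit need not be known in advance. It serves
for `L²` norms and again for characteristic functions. -/
theorem exists_tendsto_of_eventually_dist_le {E : Type*} [MetricSpace E] [CompleteSpace E]
    {x : ℕ → E} {y : ℕ → ℕ → E} {z : ℕ → E} {ε : ℕ → ℝ} (hε : Tendsto ε atTop (𝓝 0))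
    (hy : ∀ L, Tendsto (y L) atTop (𝓝 (z L))) (hxy : ∀ L, ∀ᶠ N in atTop, dist (x N) (y L N) ≤ ε L) :
    ∃ w, Tendsto x atTop (𝓝 w) ∧ Tendsto z atTop (𝓝 w) := by
  have hc : CauchySeq x := by
    rw [Metric.cauchySeq_iff']
    intro η hη
    obtain ⟨L, hL⟩ := (hε.eventually_lt_const (show (0 : ℝ) < η / 4 by positivity)).exists
    have h1 := (hxy L).and ((hy L).eventually (Metric.ball_mem_nhds _ (show 0 < η / 4 by positivity)))
    obtain ⟨N₀, hN₀⟩ := eventually_atTop.1 h1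
    refine ⟨N₀, fun n hn => ?_⟩
    obtain ⟨a1, a2⟩ := hN₀ n hn
    obtain ⟨b1, b2⟩ := hN₀ N₀ le_rfl
    have t1 := dist_triangle (x n) (y L n) (x N₀)
    have t2 := dist_triangle (y L n) (z L) (x N₀)
    have t3 := dist_triangle (z L) (y L N₀) (x N₀)
    have t4 := dist_comm (z L) (y L N₀)
    have t5 := dist_comm (y L N₀) (x N₀)
    linarith
  obtain ⟨w, hw⟩ := cauchySeq_tendsto_of_complete hc
  refine ⟨w, hw, ?_⟩
  rw [tendsto_iff_dist_tendsto_zero]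
  refine squeeze_zero (fun _ => dist_nonneg) (fun L => ?_) hε
  rw [dist_comm]
  exact le_of_tendsto (hw.dist (hy L)) (hxy L)

section

variable {Ω : Type*} [mΩ : MeasurableSpace Ω] {μ : Measure Ω} [IsProbabilityMeasure μ]

theorem abs_sqrt_integral_sq_sub_le {f g : Ω → ℝ} (hf : MemLp f 2 μ) (hg : MemLp g 2 μ) :
    |√(∫ ω, f ω ^ 2 ∂μ) - √(∫ ω, g ω ^ 2 ∂μ)| ≤ √(∫ ω, (f ω - g ω) ^ 2 ∂μ) := by
  have h := abs_norm_sub_norm_le (hf.toLp f) (hg.toLp g)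
  rw [← MemLp.toLp_sub, norm_toLp_two_eq_sqrt, norm_toLp_two_eq_sqrt, norm_toLp_two_eq_sqrt] at h
  exact h

theorem norm_integral_exp_sub_le {f g : Ω → ℝ} (hf : MemLp f 2 μ) (hg : MemLp g 2 μ) (t : ℝ) :
    ‖∫ ω, Complex.exp ((t * f ω : ℝ) * Complex.I) ∂μ - ∫ ω, Complex.exp ((t * g ω : ℝ) * Complex.I) ∂μ‖
      ≤ |t| * √(∫ ω, (f ω - g ω) ^ 2 ∂μ) := by
  have hfm := hf.1.aemeasurable
  have hgm := hg.1.aemeasurable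
  have hi : ∀ {f : Ω → ℝ}, AEMeasurable f μ →
      Integrable (fun ω => Complex.exp ((t * f ω : ℝ) * Complex.I)) μ := fun hf =>
    Integrable.of_bound (AEMeasurable.aestronglyMeasurable (by fun_prop)) 1
      (ae_of_all _ fun ω => by rw [Complex.norm_exp_ofReal_mul_I])
  rw [← integral_sub (hi hfm) (hi hgm)]
  refine le_trans ?_ (mul_le_mul_of_nonneg_left (integral_abs_le_sqrt (hf.sub hg)) (abs_nonneg t))
  rw [← integral_const_mul]
  refine norm_integral_le_of_norm_le (((hf.sub hg).integrable one_le_two).abs.const_mul _)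
    (ae_of_all _ fun ω => ?_)
  have e : Complex.exp ((t * f ω : ℝ) * Complex.I) - Complex.exp ((t * g ω : ℝ) * Complex.I)
      = Complex.exp ((t * g ω : ℝ) * Complex.I)
        * (Complex.exp (Complex.I * (t * (f ω - g ω) : ℝ)) - 1) := by
    rw [mul_sub, ← Complex.exp_add, mul_one]
    congr 2
    push_cast; ring
  rw [e, norm_mul, Complex.norm_exp_ofReal_mul_I, one_mul]
  refine (Real.norm_exp_I_mul_ofReal_sub_one_le).trans (le_of_eq ?_)
  simp

/-- A sequence which is approximated in mean square by asymptotically Gaussian sequences is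
asymptotically Gaussian. -/
theorem exists_tendsto_integral_exp_of_approx {X : ℕ → Ω → ℝ} {Y : ℕ → ℕ → Ω → ℝ} {s ε : ℕ → ℝ}
    (hX : ∀ N, MemLp (X N) 2 μ) (hY : ∀ L N, MemLp (Y L N) 2 μ)
    (hs : ∀ L, Tendsto (fun N => ∫ ω, Y L N ω ^ 2 ∂μ) atTop (𝓝 (s L)))
    (hc : ∀ L t, Tendsto (fun N => ∫ ω, Complex.exp ((t * Y L N ω : ℝ) * Complex.I) ∂μ) atTop
      (𝓝 (Complex.exp (-((t ^ 2 * s L / 2 : ℝ) : ℂ)))))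
    (hε : Tendsto ε atTop (𝓝 0))
    (hXY : ∀ L, ∀ᶠ N in atTop, ∫ ω, (X N ω - Y L N ω) ^ 2 ∂μ ≤ ε L) :
    ∃ s : ℝ, Tendsto (fun N => ∫ ω, X N ω ^ 2 ∂μ) atTop (𝓝 s) ∧
      ∀ t : ℝ, Tendsto (fun N => ∫ ω, Complex.exp ((t * X N ω : ℝ) * Complex.I) ∂μ) atTop
        (𝓝 (Complex.exp (-((t ^ 2 * s / 2 : ℝ) : ℂ)))) := by
  have hε' : Tendsto (fun L => √(ε L)) atTop (𝓝 0) := by simpa using hε.sqrt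
  -- Square roots of second moments are used because the `L²` norm, unlike its square, is
  -- 1-Lipschitz for the `L²` distance.
  obtain ⟨w, hw, hw'⟩ := exists_tendsto_of_eventually_dist_le hε' (fun L => (hs L).sqrt)
    (x := fun N => √(∫ ω, X N ω ^ 2 ∂μ)) fun L => by
      filter_upwards [hXY L] with N hN
      exact (abs_sqrt_integral_sq_sub_le (hX N) (hY L N)).trans (Real.sqrt_le_sqrt hN)
  have hsn : ∀ L, 0 ≤ s L := fun L => ge_of_tendsto' (hs L) fun N => integral_nonneg fun _ => sq_nonneg _
  have hsw : Tendsto s atTop (𝓝 (w ^ 2)) := (hw'.pow 2).congr fun L => Real.sq_sqrt (hsn L)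
  refine ⟨w ^ 2, (hw.pow 2).congr fun N => Real.sq_sqrt (integral_nonneg fun _ => sq_nonneg _),
    fun t => ?_⟩
  have hε'' : Tendsto (fun L => |t| * √(ε L)) atTop (𝓝 0) := by simpa using hε'.const_mul |t|
  obtain ⟨w', hw1, hw2⟩ := exists_tendsto_of_eventually_dist_le hε'' (fun L => hc L t)
    (x := fun N => ∫ ω, Complex.exp ((t * X N ω : ℝ) * Complex.I) ∂μ) fun L => by
      filter_upwards [hXY L] with N hN
      rw [dist_eq_norm]
      refine (norm_integral_exp_sub_le (hX N) (hY L N) t).trans ?_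
      gcongr
  have hcont : Continuous fun s : ℝ => Complex.exp (-((t ^ 2 * s / 2 : ℝ) : ℂ)) := by fun_prop
  rwa [tendsto_nhds_unique hw2 ((hcont.tendsto _).comp hsw)] at hw1

end

/-! ### Sinc estimates and square summability of the band-limited response. -/

section Sinc

theorem continuous_nsinc : Continuous nsinc := by
  unfold nsinc
  exact Real.continuous_sinc.comp (by fun_prop)

theorem nsinc_zero : nsinc 0 = 1 := by simp [nsinc]

theorem abs_nsinc_le_one (x : ℝ) : |nsinc x| ≤ 1 := Real.abs_sinc_le_one _

theorem nsinc_intCast {n : ℤ} (hn : n ≠ 0) : nsinc n = 0 := by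
  have : Real.pi * n ≠ 0 := mul_ne_zero Real.pi_ne_zero (by exact_mod_cast hn)
  rw [nsinc, Real.sinc_of_ne_zero this, mul_comm, Real.sin_int_mul_pi, zero_div]

theorem abs_nsinc_le_inv {x : ℝ} (hx : x ≠ 0) : |nsinc x| ≤ |x|⁻¹ := by
  have hp : Real.pi * x ≠ 0 := mul_ne_zero Real.pi_ne_zero hx
  rw [nsinc, Real.sinc_of_ne_zero hp, abs_div, abs_mul, abs_of_pos Real.pi_pos]
  have h1 := Real.abs_sin_le_one (Real.pi * x)
  have h2 : 0 < |x| := abs_pos.2 hx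
  have h3 : 1 ≤ Real.pi := by linarith [Real.pi_gt_three]
  rw [div_le_iff₀ (by positivity)]
  field_simp
  linarith

/-- Translating the summation set by `⌊x⌋` reduces to a shift in `[0, 1)`, where a summable bound of
order `1 / j²` applies, with the value `1` at `j = 0`. -/
theorem exists_sum_nsinc_sq_le :
    ∃ C : ℝ, ∀ (F : Finset ℤ) (x : ℝ), ∑ k ∈ F, nsinc (k - x) ^ 2 ≤ C := by
  set B : ℤ → ℝ := fun j => 8 * (1 / (j : ℝ) ^ 2) + if j = 0 then 1 else 0 with hB
  have hBs : Summable B := by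
    refine ((Real.summable_one_div_int_pow.2 one_lt_two).mul_left 8).add ?_
    exact (hasSum_ite_eq (0 : ℤ) (1 : ℝ)).summable
  have hB0 : ∀ j, 0 ≤ B j := fun j => by
    simp only [hB]; split_ifs <;> positivity
  have key : ∀ (j : ℤ) (f : ℝ), 0 ≤ f → f < 1 → nsinc (j - f) ^ 2 ≤ B j := by
    intro j f hf0 hf1
    have h1 : nsinc (j - f) ^ 2 ≤ 1 := by
      rw [← sq_abs]; exact pow_le_one₀ (abs_nonneg _) (abs_nsinc_le_one _)
    by_cases h0 : j = 0
    · simpa [hB, h0] using h1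
    simp only [hB, h0, if_false, add_zero]
    have hj : (j : ℝ) ≠ 0 := by exact_mod_cast h0
    have hj2 : 0 < (j : ℝ) ^ 2 := by positivity
    by_cases hs : |j| ≤ 1
    · have : (j : ℝ) ^ 2 ≤ 1 := by
        rw [← sq_abs]; exact pow_le_one₀ (abs_nonneg _) (by exact_mod_cast hs)
      refine h1.trans ?_
      rw [mul_one_div, le_div_iff₀ hj2]
      linarith
    · have h2 : (2 : ℝ) ≤ |(j : ℝ)| := by
        have : 2 ≤ |j| := by omega
        exact_mod_cast this
      have h3 : |(j : ℝ)| / 2 ≤ |(j : ℝ) - f| := by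
        have h4 := abs_sub_abs_le_abs_sub (j : ℝ) f
        rw [abs_of_nonneg hf0] at h4
        linarith
      have h5 : (j : ℝ) - f ≠ 0 := by
        rw [← abs_pos]; linarith
      have h6 := abs_nsinc_le_inv h5
      calc nsinc (j - f) ^ 2 = |nsinc (j - f)| ^ 2 := (sq_abs _).symm
        _ ≤ (|(j : ℝ) - f|⁻¹) ^ 2 := by gcongr
        _ ≤ ((|(j : ℝ)| / 2)⁻¹) ^ 2 := by gcongr
        _ = 4 * (1 / (j : ℝ) ^ 2) := by
          rw [inv_div, div_pow, sq_abs]; ring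
        _ ≤ _ := by gcongr; norm_num
  refine ⟨∑' j, B j, fun F x => ?_⟩
  calc ∑ k ∈ F, nsinc (k - x) ^ 2 ≤ ∑ k ∈ F, B (k - ⌊x⌋) := by
        refine Finset.sum_le_sum fun k _ => ?_
        have := key (k - ⌊x⌋) (Int.fract x) (Int.fract_nonneg x) (Int.fract_lt_one x)
        refine (le_of_eq ?_).trans this
        congr 2
        rw [Int.fract]; push_cast; ring
    _ = ∑ j ∈ F.image (fun k => k - ⌊x⌋), B j := by
        rw [Finset.sum_image]
        intro a _ b _ h
        simpa using h
    _ ≤ ∑' j, B j := hBs.sum_le_tsum _ fun j _ => hB0 j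

theorem nsinc_sample {h : ℝ} (hh : 0 < h) (k : ℤ) (τ : ℝ) :
    nsinc ((k * h - τ) / h) = nsinc (k - τ / h) := by
  congr 1
  field_simp

theorem integrableOn_mul_nsinc {g : ℝ → ℝ} (hg : IntegrableOn g (Set.Ioi 0)) {φ : ℝ → ℝ}
    (hφ : Continuous φ) : IntegrableOn (fun τ => g τ * nsinc (φ τ)) (Set.Ioi 0) :=
  Integrable.mul_bdd (c := 1) hg (continuous_nsinc.comp hφ).aestronglyMeasurable
    (ae_of_all _ fun τ => by simpa using abs_nsinc_le_one _)

/-- The band-limited equivalent impulse response is square summable. -/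
theorem summable_gBL_sq {h : ℝ} (hh : 0 < h) {g : ℝ → ℝ} (hg : IntegrableOn g (Set.Ioi 0)) :
    Summable fun k => gBL h g k ^ 2 := by
  obtain ⟨C, hC⟩ := exists_sum_nsinc_sq_le
  set G := ∫ τ in Set.Ioi (0 : ℝ), |g τ| with hG
  have hG0 : 0 ≤ G := integral_nonneg fun _ => abs_nonneg _
  have hC0 : 0 ≤ C := by simpa using hC ∅ 0
  refine summable_of_sum_le (c := (1 / h * G * √C) ^ 2) (fun _ => sq_nonneg _) fun F => ?_
  set A := ∑ k ∈ F, gBL h g k ^ 2 with hA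
  have hA0 : 0 ≤ A := Finset.sum_nonneg fun _ _ => sq_nonneg _
  have hint : ∀ k : ℤ, IntegrableOn (fun τ => g τ * nsinc ((k * h - τ) / h)) (Set.Ioi 0) := fun k =>
    integrableOn_mul_nsinc hg (by fun_prop)
  -- Duality: one factor of each square is expanded as its integral. Cauchy–Schwarz in `k`,
  -- uniformly in `τ`, then gives `A ≤ const * √A`, and one `√A` cancels.
  have e1 : A = 1 / h * ∫ τ in Set.Ioi (0 : ℝ), g τ * ∑ k ∈ F, gBL h g k * nsinc (k - τ / h) := by
    have : ∀ τ, g τ * ∑ k ∈ F, gBL h g k * nsinc (k - τ / h)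
        = ∑ k ∈ F, gBL h g k * (g τ * nsinc ((k * h - τ) / h)) := fun τ => by
      rw [Finset.mul_sum]
      refine Finset.sum_congr rfl fun k _ => ?_
      rw [nsinc_sample hh]; ring
    simp_rw [this]
    rw [integral_finsetSum _ fun k _ => (hint k).const_mul _, Finset.mul_sum]
    refine Finset.sum_congr rfl fun k _ => ?_
    rw [integral_const_mul, sq]
    nth_rw 2 [gBL]
    ring
  have e2 : A ≤ 1 / h * (G * (√A * √C)) := by
    refine e1.trans_le ?_
    refine mul_le_mul_of_nonneg_left ?_ (by positivity)
    rw [hG, ← integral_mul_const]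
    refine (le_abs_self _).trans ((abs_integral_le_integral_abs).trans ?_)
    refine integral_mono_of_nonneg (ae_of_all _ fun _ => abs_nonneg _)
      (Integrable.mul_const hg.abs _) (ae_of_all _ fun τ => ?_)
    simp only [abs_mul]
    refine mul_le_mul_of_nonneg_left ?_ (abs_nonneg _)
    refine Real.abs_le_sqrt ?_ |>.trans (Real.sqrt_mul hA0 C).le
    exact (Finset.sum_mul_sq_le_sq_mul_sq _ _ _).trans
      (mul_le_mul_of_nonneg_left (hC F _) hA0)
  have e3 : √A ≤ 1 / h * G * √C := by
    rcases hA0.eq_or_lt with h0 | h0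
    · rw [← h0]; simp; positivity
    · have hs : 0 < √A := Real.sqrt_pos.2 h0
      have e4 : √A * √A ≤ (1 / h * G * √C) * √A := by
        rw [Real.mul_self_sqrt hA0]; linarith
      exact le_of_mul_le_mul_right e4 hs
  calc A = √A ^ 2 := (Real.sq_sqrt hA0).symm
    _ ≤ _ := by gcongr

end Sinc

/-! ### The score as a polynomial in the input and the output noise. -/

section Deterministic

/-- The entry at `j` of the sequence `a` cut off outside `0, …, N - 1`. -/
def gated (N : ℕ) (a : ℕ → ℝ) (j : ℤ) : ℝ := if 0 ≤ j ∧ j < N then a j.toNat else 0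

/-- The band-limited impulse response with the modelled lags removed. -/
noncomputable def unmodelled (h : ℝ) (g : ℝ → ℝ) (Mnc Mc : ℤ) (j : ℤ) : ℝ :=
  if j ∈ Set.Icc (-Mnc) Mc then 0 else gBL h g j

theorem gated_eq_sum (N : ℕ) (a : ℕ → ℝ) (j : ℤ) :
    gated N a j = ∑ n ∈ Finset.range N, if (n : ℤ) = j then a n else 0 := by
  unfold gated
  split_ifs with hj
  · obtain ⟨h0, h1⟩ := hj
    lift j to ℕ using h0
    have : j ∈ Finset.range N := Finset.mem_range.2 (by exact_mod_cast h1)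
    rw [Finset.sum_eq_single_of_mem j this]
    · simp
    · intro n _ hn
      rw [if_neg (by exact_mod_cast hn)]
  · symm
    refine Finset.sum_eq_zero fun n hn => if_neg ?_
    rintro rfl
    exact hj ⟨by positivity, by exact_mod_cast Finset.mem_range.1 hn⟩

theorem sum_Icc_one_eq_sum_range {M : Type*} [AddCommMonoid M] (N : ℕ) (f : ℕ → M) :
    ∑ n ∈ Finset.Icc 1 N, f n = ∑ n ∈ Finset.range N, f (n + 1) := by
  rw [Finset.range_eq_Ico, Finset.sum_Ico_add' f 0 N 1]
  rfl

variable {h : ℝ} (hh : 0 < h)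
include hh

/-- At integer points `sinc` is a Kronecker delta. The index `k - 1` reflects that the sequence is
renumbered from `0`. -/
theorem inputSignal_int (N : ℕ) (e : ℕ → ℝ) (k : ℤ) :
    inputSignal h N e (k * h) = gated N (fun m => e (m + 1)) (k - 1) := by
  rw [inputSignal, sum_Icc_one_eq_sum_range, gated_eq_sum]
  refine Finset.sum_congr rfl fun n _ => ?_
  have : ((k : ℝ) * h - ((n + 1 : ℕ) : ℝ) * h) / h = ((k - (n + 1) : ℤ) : ℝ) := by
    push_cast; field_simp
  rw [this]
  split_ifs with hn
  · have : k - (n + 1 : ℤ) = 0 := by omega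
    rw [this, Int.cast_zero, nsinc_zero, mul_one]
  · rw [nsinc_intCast (by omega), mul_zero]

theorem regressor_succ (N : ℕ) (e : ℕ → ℝ) (Mnc Mc : ℤ) (k : ℕ) (i : Lag Mnc Mc) :
    regressor h (inputSignal h N e) Mnc Mc (k + 1) i
      = h * gated N (fun m => e (m + 1)) (k - (i : ℤ)) := by
  have := inputSignal_int hh N e ((k : ℤ) + 1 - i)
  rw [regressor]
  push_cast at this ⊢
  rw [this]
  congr 2
  ring

theorem systemOutput_succ {g : ℝ → ℝ} (hg : IntegrableOn g (Set.Ioi 0)) (N : ℕ) (e : ℕ → ℝ)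
    (k : ℕ) :
    systemOutput g (inputSignal h N e) ((k + 1 : ℕ) * h)
      = h * ∑ n ∈ Finset.range N, e (n + 1) * gBL h g (k - n) := by
  have e1 : ∀ τ, g τ * inputSignal h N e ((k + 1 : ℕ) * h - τ)
      = ∑ n ∈ Finset.range N,
        e (n + 1) * (g τ * nsinc (((((k : ℤ) - n : ℤ) : ℝ) * h - τ) / h)) := by
    intro τ
    rw [inputSignal, sum_Icc_one_eq_sum_range, Finset.mul_sum]
    refine Finset.sum_congr rfl fun n _ => ?_
    rw [mul_left_comm]
    congr 4
    push_cast; ring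
  rw [systemOutput]
  simp_rw [e1]
  rw [integral_finsetSum _ fun n _ => (integrableOn_mul_nsinc hg (by fun_prop)).const_mul _,
    Finset.mul_sum]
  refine Finset.sum_congr rfl fun n _ => ?_
  rw [integral_const_mul, gBL]
  field_simp

/-- The sampled output is a discrete convolution with `g_BL`, and the model removes exactly the lags
in its range. Both sums see the same cut-off input, so no boundary terms arise. -/
theorem residualNoise_succ {g : ℝ → ℝ} (hg : IntegrableOn g (Set.Ioi 0)) (N : ℕ) (e v : ℕ → ℝ)
    (Mnc Mc : ℤ) (k : ℕ) :
    residualNoise h g (inputSignal h N e) v Mnc Mc (k + 1)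
      = v (k + 1) + h * ∑ n ∈ Finset.range N, e (n + 1) * unmodelled h g Mnc Mc (k - n) := by
  have e1 : ∑ i : Lag Mnc Mc, regressor h (inputSignal h N e) Mnc Mc (k + 1) i
      * trueParam h g Mnc Mc i
      = h * ∑ n ∈ Finset.range N, e (n + 1)
        * (if (k - n : ℤ) ∈ Set.Icc (-Mnc) Mc then gBL h g (k - n) else 0) := by
    have e2 : ∀ i : Lag Mnc Mc, regressor h (inputSignal h N e) Mnc Mc (k + 1) i
      * trueParam h g Mnc Mc i = ∑ n ∈ Finset.range N, h * (e (n + 1) *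
        if (k - n : ℤ) = (i : ℤ) then gBL h g i else 0) := fun i => by
      rw [regressor_succ hh, gated_eq_sum, mul_assoc, Finset.sum_mul, Finset.mul_sum]
      refine Finset.sum_congr rfl fun n _ => ?_
      have : ((n : ℤ) = k - (i : ℤ)) ↔ ((k - n : ℤ) = (i : ℤ)) := by omega
      simp only [trueParam, this, ite_mul, mul_ite, zero_mul, mul_zero]
    rw [Finset.sum_congr rfl fun i _ => e2 i, Finset.sum_comm, Finset.mul_sum]
    refine Finset.sum_congr rfl fun n _ => ?_
    rw [← Finset.mul_sum, ← Finset.mul_sum]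
    congr 2
    split_ifs with hn
    · rw [Finset.sum_eq_single (⟨(k - n : ℤ), hn⟩ : Lag Mnc Mc)]
      · simp
      · intro i _ hi
        refine if_neg fun hc => hi (Subtype.ext hc.symm)
      · simp
    · refine Finset.sum_eq_zero fun i _ => if_neg fun hc => hn (by rw [hc]; exact i.2)
  rw [residualNoise, measuredOutput, e1, systemOutput_succ hh hg]
  rw [add_sub_right_comm, add_comm, ← mul_sub, ← Finset.sum_sub_distrib]
  congr 2
  refine Finset.sum_congr rfl fun n _ => ?_
  rw [← mul_sub, unmodelled]
  split_ifs <;> simp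

omit hh

theorem sum_gated_mul (N : ℕ) (a F : ℕ → ℝ) (i : ℤ) :
    ∑ k ∈ Finset.range N, gated N a (k - i) * F k
      = ∑ m ∈ Finset.range N, a m * gated N F (m + i) := by
  simp only [gated_eq_sum, Finset.sum_mul, Finset.mul_sum]
  rw [Finset.sum_comm]
  refine Finset.sum_congr rfl fun m _ => Finset.sum_congr rfl fun k _ => ?_
  have : (m : ℤ) = k - i ↔ (k : ℤ) = m + i := by omega
  simp only [this]
  split_ifs <;> simp

/-- Each unordered pair is charged to its larger index; with no diagonal, the inner sum is strictly
in the past. -/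
theorem sum_sum_eq_sum_lt (N : ℕ) (a : ℕ → ℝ) (q : ℕ → ℕ → ℝ) (hq : ∀ m, q m m = 0) :
    ∑ m ∈ Finset.range N, a m * ∑ n ∈ Finset.range N, a n * q m n
      = ∑ m ∈ Finset.range N, a m * ∑ n ∈ Finset.range m, a n * (q m n + q n m) := by
  induction N with
  | zero => simp
  | succ N ih =>
    have e1 : ∀ m, ∑ n ∈ Finset.range (N + 1), a n * q m n
        = ∑ n ∈ Finset.range N, a n * q m n + a N * q m N := fun m => Finset.sum_range_succ _ _
    rw [Finset.sum_range_succ,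
      Finset.sum_range_succ (fun m => a m * ∑ n ∈ Finset.range m, a n * (q m n + q n m)), ← ih]
    have e2 : ∑ m ∈ Finset.range N, a m * ∑ n ∈ Finset.range (N + 1), a n * q m n
        = ∑ m ∈ Finset.range N, a m * ∑ n ∈ Finset.range N, a n * q m n
          + a N * ∑ n ∈ Finset.range N, a n * q n N := by
      rw [Finset.mul_sum, ← Finset.sum_add_distrib]
      exact Finset.sum_congr rfl fun m _ => by rw [e1]; ring
    have e3 : ∑ n ∈ Finset.range N, a n * (q N n + q n N)
        = ∑ n ∈ Finset.range N, a n * q N n + ∑ n ∈ Finset.range N, a n * q n N := by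
      rw [← Finset.sum_add_distrib]
      exact Finset.sum_congr rfl fun m _ => mul_add _ _ _
    rw [e1, e2, e3, hq]
    ring

/-- Coefficients of the quadratic part of the score in the direction `θ`. -/
noncomputable def scoreCoeff (h : ℝ) (g : ℝ → ℝ) {Mnc Mc : ℤ} (θ : Lag Mnc Mc → ℝ) (N m n : ℕ) :
    ℝ :=
  ∑ i : Lag Mnc Mc, h ^ 2 * θ i * gated N (fun k => unmodelled h g Mnc Mc (k - n)) (m + (i : ℤ))

/-- The predictable multiplier of `a m` in the score in the direction `θ`. -/
noncomputable def scoreMultiplier (h : ℝ) (g : ℝ → ℝ) {Mnc Mc : ℤ} (θ : Lag Mnc Mc → ℝ) (N : ℕ)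
    (a b : ℕ → ℝ) (m : ℕ) : ℝ :=
  ∑ i : Lag Mnc Mc, h * θ i * gated N b (m + (i : ℤ))
    + ∑ n ∈ Finset.range m, a n * (scoreCoeff h g θ N m n + scoreCoeff h g θ N n m)

theorem gated_of_mem {N : ℕ} {a : ℕ → ℝ} {j : ℤ} (h0 : 0 ≤ j) (h1 : j < N) :
    gated N a j = a j.toNat := if_pos ⟨h0, h1⟩

theorem gated_add_mul_sum (N : ℕ) (b : ℕ → ℝ) (h : ℝ) (a : ℕ → ℝ) (c : ℤ → ℝ) (j : ℤ) :
    gated N (fun k => b k + h * ∑ n ∈ Finset.range N, a n * c (k - n)) j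
      = gated N b j + h * ∑ n ∈ Finset.range N, a n * gated N (fun k => c (k - n)) j := by
  unfold gated
  split_ifs <;> simp

/-- On the diagonal the convolution lag equals the regressor lag `i`, which is modelled. This is
what makes the score a martingale transform. -/
theorem scoreCoeff_self (h : ℝ) (g : ℝ → ℝ) {Mnc Mc : ℤ} (θ : Lag Mnc Mc → ℝ) (N m : ℕ) :
    scoreCoeff h g θ N m m = 0 := by
  refine Finset.sum_eq_zero fun i _ => ?_
  rw [gated]
  split_ifs with hi
  · have : (((m + (i : ℤ)).toNat : ℕ) : ℤ) - m = i := by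
      rw [Int.toNat_of_nonneg hi.1]; ring
    rw [this, unmodelled, if_pos i.2, mul_zero]
  · simp

include hh in
theorem score_eq_sum {g : ℝ → ℝ} (hg : IntegrableOn g (Set.Ioi 0)) (N : ℕ) (e v : ℕ → ℝ)
    {Mnc Mc : ℤ} (θ : Lag Mnc Mc → ℝ) :
    ∑ k ∈ Finset.Icc 1 N, (∑ i : Lag Mnc Mc, θ i * regressor h (inputSignal h N e) Mnc Mc k i)
        * residualNoise h g (inputSignal h N e) v Mnc Mc k
      = ∑ m ∈ Finset.range N, e (m + 1)
        * scoreMultiplier h g θ N (fun m => e (m + 1)) (fun m => v (m + 1)) m := by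
  set a : ℕ → ℝ := fun m => e (m + 1) with ha
  set b : ℕ → ℝ := fun m => v (m + 1) with hb
  rw [sum_Icc_one_eq_sum_range]
  set F : ℕ → ℝ := fun k =>
    b k + h * ∑ n ∈ Finset.range N, a n * unmodelled h g Mnc Mc (k - n) with hF
  have e1 : ∀ k, (∑ i : Lag Mnc Mc, θ i * regressor h (inputSignal h N e) Mnc Mc (k + 1) i)
      * residualNoise h g (inputSignal h N e) v Mnc Mc (k + 1)
      = ∑ i : Lag Mnc Mc, h * θ i * (gated N a (k - (i : ℤ)) * F k) := fun k => by
    rw [residualNoise_succ hh hg, Finset.sum_mul]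
    refine Finset.sum_congr rfl fun i _ => ?_
    rw [regressor_succ hh]; ring
  have e2 : ∀ (m : ℕ) (i : Lag Mnc Mc), h * θ i * (a m * gated N F (m + (i : ℤ)))
      = a m * (h * θ i * gated N b (m + (i : ℤ))) + ∑ n ∈ Finset.range N, a m * (a n *
        (h ^ 2 * θ i * gated N (fun k => unmodelled h g Mnc Mc (k - n)) (m + (i : ℤ)))) := by
    intro m i
    rw [hF, gated_add_mul_sum (c := unmodelled h g Mnc Mc)]
    simp only [mul_add, Finset.mul_sum]
    congr 1
    · ring
    · exact Finset.sum_congr rfl fun n _ => by ring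
  simp_rw [e1]
  rw [Finset.sum_comm]
  simp_rw [← Finset.mul_sum, sum_gated_mul, Finset.mul_sum, e2]
  rw [Finset.sum_comm]
  have e3 : ∑ m ∈ Finset.range N, a m * scoreMultiplier h g θ N a b m
      = ∑ m ∈ Finset.range N, a m * ∑ i : Lag Mnc Mc, h * θ i * gated N b (m + (i : ℤ))
        + ∑ m ∈ Finset.range N, a m * ∑ n ∈ Finset.range m,
          a n * (scoreCoeff h g θ N m n + scoreCoeff h g θ N n m) := by
    rw [← Finset.sum_add_distrib]
    exact Finset.sum_congr rfl fun m _ => mul_add _ _ _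
  refine Eq.trans ?_ e3.symm
  rw [← sum_sum_eq_sum_lt N a (scoreCoeff h g θ N) (scoreCoeff_self h g θ N)]
  simp_rw [Finset.sum_add_distrib, Finset.mul_sum]
  congr 1
  refine Finset.sum_congr rfl fun m _ => ?_
  rw [Finset.sum_comm]
  refine Finset.sum_congr rfl fun n _ => ?_
  simp_rw [scoreCoeff, Finset.mul_sum]

end Deterministic

/-! ### Lag-wise bounds and limits for the quadratic coefficients. -/

section ScoreCoefficients

variable {h : ℝ} {g : ℝ → ℝ} {Mnc Mc : ℤ}

/-- The limit of the coefficients of `a m * a (m - l)` in the score in the direction `θ`. -/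
noncomputable def lagCoeff (h : ℝ) (g : ℝ → ℝ) {Mnc Mc : ℤ} (θ : Lag Mnc Mc → ℝ) (l : ℕ) : ℝ :=
  ∑ i : Lag Mnc Mc, h ^ 2 * θ i
    * (unmodelled h g Mnc Mc ((i : ℤ) + l) + unmodelled h g Mnc Mc ((i : ℤ) - l))

/-- A bound for the coefficients of `a m * a (m - l)` in the score in the direction `θ`. -/
noncomputable def lagBound (h : ℝ) (g : ℝ → ℝ) {Mnc Mc : ℤ} (θ : Lag Mnc Mc → ℝ) (l : ℕ) : ℝ :=
  ∑ i : Lag Mnc Mc, h ^ 2 * |θ i|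
    * (|unmodelled h g Mnc Mc ((i : ℤ) + l)| + |unmodelled h g Mnc Mc ((i : ℤ) - l)|)

theorem lagBound_nonneg (θ : Lag Mnc Mc → ℝ) (l : ℕ) : 0 ≤ lagBound h g θ l :=
  Finset.sum_nonneg fun i _ => by positivity

theorem abs_lagCoeff_le (θ : Lag Mnc Mc → ℝ) (l : ℕ) : |lagCoeff h g θ l| ≤ lagBound h g θ l := by
  refine (Finset.abs_sum_le_sum_abs _ _).trans (Finset.sum_le_sum fun i _ => ?_)
  rw [abs_mul, abs_mul, abs_of_nonneg (sq_nonneg h)]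
  gcongr
  exact abs_add_le _ _

theorem Summable.sq_add {ι : Type*} {f f' : ι → ℝ} (hf : Summable fun l => f l ^ 2)
    (hf' : Summable fun l => f' l ^ 2) : Summable fun l => (f l + f' l) ^ 2 := by
  refine Summable.of_nonneg_of_le (fun _ => sq_nonneg _) (fun l => ?_)
    ((hf.mul_left 2).add (hf'.mul_left 2))
  nlinarith [sq_nonneg (f l - f' l)]

theorem Summable.sq_sum {ι κ : Type*} (s : Finset κ) {f : κ → ι → ℝ}
    (hf : ∀ i ∈ s, Summable fun l => f i l ^ 2) : Summable fun l => (∑ i ∈ s, f i l) ^ 2 := by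
  classical
  induction s using Finset.induction_on with
  | empty => simp
  | insert i s hi ih =>
    simp only [Finset.sum_insert hi]
    exact (hf i (by simp)).sq_add (ih fun j hj => hf j (by simp [hj]))

theorem summable_unmodelled_sq (hh : 0 < h) (hg : IntegrableOn g (Set.Ioi 0)) :
    Summable fun j => unmodelled h g Mnc Mc j ^ 2 := by
  refine Summable.of_nonneg_of_le (fun _ => sq_nonneg _) (fun j => ?_) (summable_gBL_sq hh hg)
  unfold unmodelled
  split_ifs
  · simp [sq_nonneg]
  · exact le_rfl

theorem summable_lagBound_sq (hh : 0 < h) (hg : IntegrableOn g (Set.Ioi 0))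
    (θ : Lag Mnc Mc → ℝ) : Summable fun l => lagBound h g θ l ^ 2 := by
  have hs := summable_unmodelled_sq (Mnc := Mnc) (Mc := Mc) hh hg
  refine Summable.sq_sum _ fun i _ => ?_
  simp_rw [mul_pow]
  refine Summable.mul_left _ (Summable.sq_add ?_ ?_)
  · simp_rw [sq_abs]
    exact hs.comp_injective (i := fun l : ℕ => (i : ℤ) + l) fun a b hab => by simpa using hab
  · simp_rw [sq_abs]
    exact hs.comp_injective (i := fun l : ℕ => (i : ℤ) - l) fun a b hab => by simpa using hab

theorem gated_comp_sub (N n : ℕ) (c : ℤ → ℝ) (j : ℤ) :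
    gated N (fun k => c (k - n)) j = if 0 ≤ j ∧ j < N then c (j - n) else 0 := by
  unfold gated
  split_ifs with hj
  · simp only [Int.toNat_of_nonneg hj.1]
  · rfl

/-- Gating can only delete terms, so a bound depending on the lag alone holds for every `N`. -/
theorem abs_scoreCoeff_add_le (θ : Lag Mnc Mc → ℝ) (N : ℕ) {m n : ℕ} (hnm : n < m) :
    |scoreCoeff h g θ N m n + scoreCoeff h g θ N n m| ≤ lagBound h g θ (m - n) := by
  rw [scoreCoeff, scoreCoeff, ← Finset.sum_add_distrib]
  refine (Finset.abs_sum_le_sum_abs _ _).trans (Finset.sum_le_sum fun i _ => ?_)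
  rw [← mul_add, abs_mul, abs_mul, abs_of_nonneg (sq_nonneg h)]
  gcongr
  refine (abs_add_le _ _).trans (add_le_add ?_ ?_)
  · rw [gated_comp_sub]
    split_ifs
    · refine le_of_eq ?_; congr 2; push_cast [hnm.le]; ring
    · simp
  · rw [gated_comp_sub]
    split_ifs
    · refine le_of_eq ?_; congr 2; push_cast [hnm.le]; ring
    · simp

/-- At distance `K` from both ends no gate is active, and the coefficient is stationary. -/
theorem scoreCoeff_add_eq (θ : Lag Mnc Mc → ℝ) {N m n K : ℕ} (hnm : n < m)
    (hK : ∀ i : Lag Mnc Mc, |(i : ℤ)| ≤ K) (hn : K ≤ n) (hm : m + K < N) :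
    scoreCoeff h g θ N m n + scoreCoeff h g θ N n m = lagCoeff h g θ (m - n) := by
  rw [scoreCoeff, scoreCoeff, ← Finset.sum_add_distrib]
  refine Finset.sum_congr rfl fun i _ => ?_
  have := abs_le.1 (hK i)
  rw [gated_comp_sub, gated_comp_sub, if_pos (by omega), if_pos (by omega), ← mul_add]
  congr 3
  · push_cast [hnm.le]; ring
  · push_cast [hnm.le]; ring

end ScoreCoefficients

/-! ### Second moments of linear combinations of inputs and output noise. -/

section ScoreMoments

variable {Ω : Type*} [mΩ : MeasurableSpace Ω] {μ : Measure Ω} [IsProbabilityMeasure μ]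
  {a b : ℕ → Ω → ℝ} {lam sigma : ℝ}

theorem integral_sum_mul_sq (ha : IsWhiteNoise a lam μ) (hb : ∀ k, Measurable (b k))
    (hab : IndepFun (fun ω k => a k ω) (fun ω k => b k ω) μ) (γ : ℕ → ℝ) (m : ℕ) :
    ∫ ω, (∑ n ∈ Finset.range m, a n ω * γ n) ^ 2 ∂μ = lam ^ 2 * ∑ n ∈ Finset.range m, γ n ^ 2 := by
  have := (ha.isInnovation hb hab).integral_sum_sq (Z := fun n _ => γ n)
    (fun n => measurable_const) (fun n => memLp_const _) m
  simpa using this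

/-- Cauchy–Schwarz with weights `|ρ i|` uses only the common variance; nothing is assumed about the
correlations of `b`. -/
theorem integral_sum_mul_noise_sq_le (hb : IsStationaryErgodicNoise b sigma μ) {ι : Type*}
    (s : Finset ι) (ρ : ι → ℝ) (idx : ι → ℕ) :
    ∫ ω, (∑ i ∈ s, ρ i * b (idx i) ω) ^ 2 ∂μ ≤ (∑ i ∈ s, |ρ i|) ^ 2 * sigma ^ 2 := by
  have hpt : ∀ ω, (∑ i ∈ s, ρ i * b (idx i) ω) ^ 2
      ≤ (∑ i ∈ s, |ρ i|) * ∑ i ∈ s, |ρ i| * b (idx i) ω ^ 2 := fun ω => by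
    refine Finset.sum_sq_le_sum_mul_sum_of_sq_le_mul s (fun i _ => abs_nonneg _)
      (fun i _ => by positivity) fun i _ => le_of_eq ?_
    rw [mul_pow, ← sq_abs (ρ i)]; ring
  have hi : ∀ i ∈ s, Integrable (fun ω => |ρ i| * b (idx i) ω ^ 2) μ := fun i _ =>
    (hb.memLp_all _).integrable_sq.const_mul _
  refine (integral_mono_of_nonneg (ae_of_all _ fun _ => sq_nonneg _)
    ((integrable_finsetSum s hi).const_mul _) (ae_of_all _ hpt)).trans (le_of_eq ?_)
  rw [integral_const_mul, integral_finsetSum s hi]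
  simp_rw [integral_const_mul, hb.integral_sq, ← Finset.sum_mul]
  ring

theorem integral_sq_le_of_coeff (ha : IsWhiteNoise a lam μ) (hb : IsStationaryErgodicNoise b sigma μ)
    (hab : IndepFun (fun ω k => a k ω) (fun ω k => b k ω) μ) {ι : Type*}
    (s : Finset ι) (ρ : ι → ℝ) (idx : ι → ℕ) (γ : ℕ → ℝ) (m : ℕ) :
    ∫ ω, (∑ i ∈ s, ρ i * b (idx i) ω + ∑ n ∈ Finset.range m, a n ω * γ n) ^ 2 ∂μ
      ≤ 2 * ((∑ i ∈ s, |ρ i|) ^ 2 * sigma ^ 2) + 2 * (lam ^ 2 * ∑ n ∈ Finset.range m, γ n ^ 2) := by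
  have h1 : MemLp (fun ω => ∑ i ∈ s, ρ i * b (idx i) ω) 2 μ :=
    memLp_finsetSum _ fun _ _ => (hb.memLp_all _).const_mul _
  have h2 : MemLp (fun ω => ∑ n ∈ Finset.range m, a n ω * γ n) 2 μ :=
    memLp_finsetSum _ fun _ _ => (ha.memLp_all _).mul_const _
  rw [← integral_sum_mul_sq ha hb.measurable hab γ m]
  refine le_trans ?_ (add_le_add_left (mul_le_mul_of_nonneg_left
    (integral_sum_mul_noise_sq_le hb s ρ idx) zero_le_two) _)
  rw [← integral_const_mul, ← integral_const_mul,
    ← integral_add (h1.integrable_sq.const_mul _) (h2.integrable_sq.const_mul _)]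
  refine integral_mono_of_nonneg (ae_of_all _ fun _ => sq_nonneg _)
    ((h1.integrable_sq.const_mul _).add (h2.integrable_sq.const_mul _)) (ae_of_all _ fun ω => ?_)
  simp only
  nlinarith [sq_nonneg (∑ i ∈ s, ρ i * b (idx i) ω - ∑ n ∈ Finset.range m, a n ω * γ n)]

end ScoreMoments

/-! ### Approximation of the score by stationary finite-memory transforms. -/

section ScoreApproximation

variable {Ω : Type*} [mΩ : MeasurableSpace Ω] {μ : Measure Ω} [IsProbabilityMeasure μ]
  {a b : ℕ → Ω → ℝ} {lam sigma : ℝ} {h : ℝ} {g : ℝ → ℝ} {Mnc Mc : ℤ}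

/-- Weights of the output noise in the moving average approximating the score multiplier. -/
noncomputable def noiseWeight (h : ℝ) {Mnc Mc : ℤ} (θ : Lag Mnc Mc → ℝ) (K p : ℕ) : ℝ :=
  ∑ i : Lag Mnc Mc, if (p : ℤ) = K + (i : ℤ) then h * θ i else 0

/-- Weights of the input in the moving average approximating the score multiplier. -/
noncomputable def inputWeight (h : ℝ) (g : ℝ → ℝ) {Mnc Mc : ℤ} (θ : Lag Mnc Mc → ℝ) (L l : ℕ) : ℝ :=
  if l ≤ L then lagCoeff h g θ l else 0

theorem sum_noiseWeight_mul (θ : Lag Mnc Mc → ℝ) {K : ℕ} (hK : ∀ i : Lag Mnc Mc, |(i : ℤ)| ≤ K)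
    (f : ℕ → ℝ) (m : ℕ) :
    ∑ p ∈ Finset.range (2 * K + 1), noiseWeight h θ K p * f (p + m)
      = ∑ i : Lag Mnc Mc, h * θ i * f (((m + K : ℕ) + (i : ℤ)).toNat) := by
  simp only [noiseWeight, Finset.sum_mul]
  rw [Finset.sum_comm]
  refine Finset.sum_congr rfl fun i _ => ?_
  have hi := abs_le.1 (hK i)
  rw [Finset.sum_eq_single ((K + (i : ℤ)).toNat)]
  · rw [if_pos (by omega)]
    congr 2
    omega
  · intro p _ hp
    rw [if_neg (by omega), zero_mul]
  · intro hp
    exact absurd (Finset.mem_range.2 (by omega)) hp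

/-- The window is recentred at `m + K`. Its input part extends to the full past because indices
below `m` have lag greater than `K ≥ L`, where the weight is zero. -/
theorem window_eq (θ : Lag Mnc Mc → ℝ) {K L : ℕ} (hK : ∀ i : Lag Mnc Mc, |(i : ℤ)| ≤ K)
    (hL : L ≤ K) (m : ℕ) (ω : Ω) :
    window a b (noiseWeight h θ K) (fun q => inputWeight h g θ L (K - q)) (2 * K + 1) K m ω
      = ∑ i : Lag Mnc Mc, h * θ i * b (((m + K : ℕ) + (i : ℤ)).toNat) ω
        + ∑ n ∈ Finset.range (m + K), a n ω * inputWeight h g θ L (m + K - n) := by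
  rw [window, sum_noiseWeight_mul θ hK (fun p => b p ω)]
  congr 1
  rw [Finset.sum_range_add, Finset.sum_eq_zero (s := Finset.range m), zero_add]
  · refine Finset.sum_congr rfl fun q _ => ?_
    rw [mul_comm, add_comm q m]
    congr 2
    omega
  · intro n hn
    have := Finset.mem_range.1 hn
    rw [inputWeight, if_neg (by omega), mul_zero]

/-- Weights of the output noise in the approximation error. -/
noncomputable def noiseError (h : ℝ) {Mnc Mc : ℤ} (θ : Lag Mnc Mc → ℝ) (N K m : ℕ)
    (i : Lag Mnc Mc) : ℝ :=
  h * θ i * ((if m < N ∧ 0 ≤ m + (i : ℤ) ∧ m + (i : ℤ) < N then 1 else 0) - if K ≤ m then 1 else 0)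

/-- Weights of the input in the approximation error. -/
noncomputable def inputError (h : ℝ) (g : ℝ → ℝ) {Mnc Mc : ℤ} (θ : Lag Mnc Mc → ℝ)
    (N K L m n : ℕ) : ℝ :=
  (if m < N then scoreCoeff h g θ N m n + scoreCoeff h g θ N n m else 0)
    - if K ≤ m then inputWeight h g θ L (m - n) else 0

/-- The approximation error of the score multiplier. -/
noncomputable def multiplierError (h : ℝ) (g : ℝ → ℝ) {Mnc Mc : ℤ} (θ : Lag Mnc Mc → ℝ)
    (N K L : ℕ) (a b : ℕ → Ω → ℝ) (m : ℕ) (ω : Ω) : ℝ :=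
  ∑ i : Lag Mnc Mc, noiseError h θ N K m i * b ((m + (i : ℤ)).toNat) ω
    + ∑ n ∈ Finset.range m, a n ω * inputError h g θ N K L m n

theorem multiplierError_eq (θ : Lag Mnc Mc → ℝ) (N K L m : ℕ) (ω : Ω) :
    multiplierError h g θ N K L a b m ω
      = (if m < N then scoreMultiplier h g θ N (fun k => a k ω) (fun k => b k ω) m else 0)
        - if K ≤ m then ∑ i : Lag Mnc Mc, h * θ i * b ((m + (i : ℤ)).toNat) ω
          + ∑ n ∈ Finset.range m, a n ω * inputWeight h g θ L (m - n) else 0 := by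
  simp only [multiplierError, noiseError, inputError, scoreMultiplier, gated]
  split_ifs with h1 h2 h2 <;>
  simp only [h2, true_and, false_and, if_false, sub_zero, zero_sub, mul_sub, sub_mul,
    Finset.sum_sub_distrib, mul_one, mul_ite, ite_mul, mul_zero, zero_mul, Finset.sum_const_zero,
    mul_neg, neg_mul, Finset.sum_neg_distrib] <;> ring

/-- The score uses `a m` for `m < N`, the window sum for `K ≤ m < N + K`. Over the union of these
ranges the difference is again a single martingale transform, so orthogonality applies to it. -/
theorem score_sub_window_eq (θ : Lag Mnc Mc → ℝ) {K L : ℕ}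
    (hK : ∀ i : Lag Mnc Mc, |(i : ℤ)| ≤ K) (hL : L ≤ K) (N : ℕ) (ω : Ω) :
    ∑ m ∈ Finset.range N,
        a m ω * scoreMultiplier h g θ N (fun k => a k ω) (fun k => b k ω) m
      - ∑ m ∈ Finset.range N, a (m + K) ω * window a b (noiseWeight h θ K)
          (fun q => inputWeight h g θ L (K - q)) (2 * K + 1) K m ω
      = ∑ m ∈ Finset.range (N + K), a m ω * multiplierError h g θ N K L a b m ω := by
  simp only [multiplierError_eq, mul_sub, Finset.sum_sub_distrib, window_eq θ hK hL]
  congr 1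
  · rw [Finset.sum_range_add, Finset.sum_eq_zero (s := Finset.range K), add_zero]
    · exact Finset.sum_congr rfl fun m hm => by rw [if_pos (Finset.mem_range.1 hm)]
    · intro m _
      rw [if_neg (by omega), mul_zero]
  · rw [add_comm N K, Finset.sum_range_add, Finset.sum_eq_zero (s := Finset.range K), zero_add]
    · refine Finset.sum_congr rfl fun m _ => ?_
      rw [if_pos (by omega), add_comm m K]
    · intro m hm
      rw [if_neg (by simpa using hm), mul_zero]

theorem abs_noiseError_le (hh : 0 < h) (θ : Lag Mnc Mc → ℝ) (N K m : ℕ) (i : Lag Mnc Mc) :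
    |noiseError h θ N K m i| ≤ h * |θ i| := by
  rw [noiseError, abs_mul, abs_mul, abs_of_pos hh]
  refine mul_le_of_le_one_right (by positivity) ?_
  split_ifs <;> simp

theorem noiseError_eq_zero (θ : Lag Mnc Mc → ℝ) {N K m : ℕ}
    (hK : ∀ i : Lag Mnc Mc, |(i : ℤ)| ≤ K) (h1 : K ≤ m) (h2 : m + K < N) (i : Lag Mnc Mc) :
    noiseError h θ N K m i = 0 := by
  have := abs_le.1 (hK i)
  rw [noiseError, if_pos (by omega), if_pos h1, sub_self, mul_zero]

theorem abs_inputError_le (θ : Lag Mnc Mc → ℝ) (N K L : ℕ) {m n : ℕ} (hnm : n < m) :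
    |inputError h g θ N K L m n| ≤ 2 * lagBound h g θ (m - n) := by
  have h0 := lagBound_nonneg (h := h) (g := g) θ (m - n)
  have h1 := abs_scoreCoeff_add_le (h := h) (g := g) θ N hnm
  have h2 := abs_lagCoeff_le (h := h) (g := g) θ (m - n)
  rw [inputError, two_mul]
  refine (abs_sub _ _).trans (add_le_add ?_ ?_)
  · split_ifs
    · exact h1
    · simpa using h0
  · unfold inputWeight
    split_ifs
    · exact h2
    · simpa using h0
    · simpa using h0

/-- In the bulk, lags up to `L` cancel exactly: then `n ≥ m - L ≥ K₀`, so the coefficient already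
has its stationary value. -/
theorem abs_inputError_le_of_mem (θ : Lag Mnc Mc → ℝ) {N K₀ L m n : ℕ}
    (hK : ∀ i : Lag Mnc Mc, |(i : ℤ)| ≤ K₀) (h1 : K₀ + L ≤ m) (h2 : m + (K₀ + L) < N)
    (hnm : n < m) :
    |inputError h g θ N (K₀ + L) L m n| ≤ if L < m - n then lagBound h g θ (m - n) else 0 := by
  rw [inputError, if_pos (by omega), if_pos h1, inputWeight]
  split_ifs with h3 h4 h4
  · omega
  · rw [scoreCoeff_add_eq θ hnm hK (by omega) (by omega), sub_self, abs_zero]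
  · rw [sub_zero]; exact abs_scoreCoeff_add_le θ N hnm
  · omega

theorem sum_range_comp_sub_le {F : ℕ → ℝ} (hF : Summable F) (h0 : ∀ l, 0 ≤ F l) (m : ℕ) :
    ∑ n ∈ Finset.range m, F (m - n) ≤ ∑' l, F l := by
  have : ∑ n ∈ Finset.range m, F (m - n) = ∑ l ∈ (Finset.range m).image (fun n => m - n), F l := by
    rw [Finset.sum_image]
    intro x hx y hy hxy
    have := Finset.mem_range.1 hx
    have := Finset.mem_range.1 hy
    simp only at hxy
    omega
  rw [this]
  exact hF.sum_le_tsum _ fun l _ => h0 l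

/-- The tails of the square sum of `lagBound`. -/
noncomputable def lagTail (h : ℝ) (g : ℝ → ℝ) {Mnc Mc : ℤ} (θ : Lag Mnc Mc → ℝ) (L : ℕ) : ℝ :=
  ∑' l, if L < l then lagBound h g θ l ^ 2 else 0

theorem tendsto_lagTail (hh : 0 < h) (hg : IntegrableOn g (Set.Ioi 0)) (θ : Lag Mnc Mc → ℝ) :
    Tendsto (lagTail h g θ) atTop (𝓝 0) := by
  have := tendsto_tsum_of_dominated_convergence (𝓕 := atTop)
    (f := fun L l => if L < l then lagBound h g θ l ^ 2 else 0) (g := fun _ => (0 : ℝ))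
    (summable_lagBound_sq hh hg θ) (fun l => by
      refine tendsto_const_nhds.congr' ?_
      filter_upwards [eventually_ge_atTop l] with L hL
      rw [if_neg (by omega)])
    (Eventually.of_forall fun L l => by
      split_ifs
      · simp
      · simp [sq_nonneg])
  rw [tsum_zero] at this
  exact this

theorem measurable_multiplierError (θ : Lag Mnc Mc → ℝ) (N K L m : ℕ) :
    Measurable[history a b m] (multiplierError h g θ N K L a b m) := by
  refine Measurable.add ?_ ?_
  · exact Finset.measurable_fun_sum _ fun p _ => (measurable_history_right _ _).const_mul _
  · refine Finset.measurable_fun_sum _ fun q hq => (measurable_history_left ?_).mul_const _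
    exact Finset.mem_range.1 hq

theorem memLp_multiplierError (ha : IsWhiteNoise a lam μ) (hb : IsStationaryErgodicNoise b sigma μ)
    (θ : Lag Mnc Mc → ℝ) (N K L m : ℕ) : MemLp (multiplierError h g θ N K L a b m) 2 μ :=
  (memLp_finsetSum _ fun _ _ => (hb.memLp_all _).const_mul _).add
    (memLp_finsetSum _ fun _ _ => (ha.memLp_all _).mul_const _)

/-- Away from the ends only the tail of the lags beyond `L` remains. Near the ends a bound
independent of `N` and `L` suffices, since few indices lie there. -/
theorem integral_multiplierError_sq_le (hh : 0 < h) (hg : IntegrableOn g (Set.Ioi 0))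
    (ha : IsWhiteNoise a lam μ) (hb : IsStationaryErgodicNoise b sigma μ)
    (hab : IndepFun (fun ω k => a k ω) (fun ω k => b k ω) μ)
    (θ : Lag Mnc Mc → ℝ) {K₀ L : ℕ} (hK : ∀ i : Lag Mnc Mc, |(i : ℤ)| ≤ K₀) (N m : ℕ) :
    ∫ ω, multiplierError h g θ N (K₀ + L) L a b m ω ^ 2 ∂μ
      ≤ 2 * lam ^ 2 * lagTail h g θ L + if K₀ + L ≤ m ∧ m + (K₀ + L) < N then 0 else
        2 * (∑ i, h * |θ i|) ^ 2 * sigma ^ 2 + 8 * lam ^ 2 * ∑' l, lagBound h g θ l ^ 2 := by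
  have hs := summable_lagBound_sq hh hg θ
  have hs' : Summable fun l => if L < l then lagBound h g θ l ^ 2 else 0 :=
    Summable.of_nonneg_of_le (fun l => by positivity) (fun l => by
      split_ifs
      · exact le_rfl
      · positivity) hs
  have hK' : ∀ i : Lag Mnc Mc, |(i : ℤ)| ≤ (K₀ + L : ℕ) := fun i => by
    have := hK i
    push_cast; omega
  have h1 := integral_sq_le_of_coeff ha hb hab Finset.univ
    (noiseError h θ N (K₀ + L) m) (fun i => (m + (i : ℤ)).toNat)
    (inputError h g θ N (K₀ + L) L m) m
  refine h1.trans ?_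
  have hT0 : 0 ≤ lagTail h g θ L := tsum_nonneg fun l => by positivity
  split_ifs with hm
  · have e1 : ∑ i, |noiseError h θ N (K₀ + L) m i| = 0 :=
      Finset.sum_eq_zero fun i _ => by rw [noiseError_eq_zero θ hK' hm.1 hm.2, abs_zero]
    have e2 : ∑ n ∈ Finset.range m, inputError h g θ N (K₀ + L) L m n ^ 2 ≤ lagTail h g θ L := by
      refine le_trans (Finset.sum_le_sum fun n hn => ?_)
        (sum_range_comp_sub_le hs' (fun l => by positivity) m)
      have := abs_inputError_le_of_mem (h := h) (g := g) θ hK hm.1 hm.2 (Finset.mem_range.1 hn)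
      rw [← sq_abs]
      refine (pow_le_pow_left₀ (abs_nonneg _) this 2).trans (le_of_eq ?_)
      split_ifs <;> simp
    rw [e1]
    have := mul_le_mul_of_nonneg_left e2 (sq_nonneg lam)
    nlinarith
  · have e1 : (∑ i, |noiseError h θ N (K₀ + L) m i|) ^ 2 ≤ (∑ i, h * |θ i|) ^ 2 := by
      gcongr with i
      exact abs_noiseError_le hh θ _ _ _ _
    have e2 : ∑ n ∈ Finset.range m, inputError h g θ N (K₀ + L) L m n ^ 2
        ≤ 4 * ∑' l, lagBound h g θ l ^ 2 := by
      refine le_trans ?_ (mul_le_mul_of_nonneg_left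
        (sum_range_comp_sub_le hs (fun l => by positivity) m) (by norm_num))
      rw [Finset.mul_sum]
      refine Finset.sum_le_sum fun n hn => ?_
      have := abs_inputError_le (h := h) (g := g) θ N (K₀ + L) L (Finset.mem_range.1 hn)
      rw [← sq_abs]
      refine (pow_le_pow_left₀ (abs_nonneg _) this 2).trans (le_of_eq ?_)
      ring
    have t1 := mul_le_mul_of_nonneg_left e2 (sq_nonneg lam)
    have t2 := mul_le_mul_of_nonneg_right e1 (sq_nonneg sigma)
    have t3 := mul_nonneg (sq_nonneg lam) hT0
    nlinarith

theorem card_boundary_le (N K : ℕ) :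
    ((Finset.range (N + K)).filter fun m => ¬ (K ≤ m ∧ m + K < N)).card ≤ 3 * K := by
  have : ((Finset.range (N + K)).filter fun m => ¬ (K ≤ m ∧ m + K < N))
      ⊆ Finset.range K ∪ Finset.Ico (N - K) (N + K) := by
    intro m hm
    simp only [Finset.mem_filter, Finset.mem_range, Finset.mem_union, Finset.mem_Ico] at hm ⊢
    omega
  refine (Finset.card_le_card this).trans ((Finset.card_union_le _ _).trans ?_)
  simp only [Finset.card_range, Nat.card_Ico]
  omega

/-- The variance of the normalized score converges, and the normalized score is asymptotically
Gaussian. -/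
theorem exists_tendsto_score (hh : 0 < h) (hg : IntegrableOn g (Set.Ioi 0))
    (ha : IsWhiteNoise a lam μ) (hb : IsStationaryErgodicNoise b sigma μ)
    (hab : IndepFun (fun ω k => a k ω) (fun ω k => b k ω) μ) (θ : Lag Mnc Mc → ℝ) :
    ∃ s : ℝ, Tendsto (fun N : ℕ => ∫ ω, ((∑ m ∈ Finset.range N, a m ω
          * scoreMultiplier h g θ N (fun k => a k ω) (fun k => b k ω) m) / √N) ^ 2 ∂μ) atTop (𝓝 s) ∧
      ∀ t : ℝ, Tendsto (fun N : ℕ => ∫ ω, Complex.exp ((t * ((∑ m ∈ Finset.range N, a m ω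
          * scoreMultiplier h g θ N (fun k => a k ω) (fun k => b k ω) m) / √N) : ℝ)
            * Complex.I) ∂μ) atTop (𝓝 (Complex.exp (-((t ^ 2 * s / 2 : ℝ) : ℂ)))) := by
  have hI := ha.isInnovation hb.measurable hab
  obtain ⟨K₀, hK₀⟩ : ∃ K₀ : ℕ, ∀ i : Lag Mnc Mc, |(i : ℤ)| ≤ K₀ :=
    ⟨Mnc.natAbs + Mc.natAbs, fun i => by
      have h1 := i.2.1
      have h2 := i.2.2
      rw [abs_le]
      omega⟩
  set Y : ℕ → ℕ → Ω → ℝ := fun L N ω => (∑ m ∈ Finset.range N, a (m + (K₀ + L)) ω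
    * window a b (noiseWeight h θ (K₀ + L)) (fun q => inputWeight h g θ L (K₀ + L - q))
        (2 * (K₀ + L) + 1) (K₀ + L) m ω) / √N with hY
  set D : ℕ → ℝ := fun L => ∫ ω, window a b (noiseWeight h θ (K₀ + L))
    (fun q => inputWeight h g θ L (K₀ + L - q)) (2 * (K₀ + L) + 1) (K₀ + L) 0 ω ^ 2 ∂μ with hD
  have hmem : ∀ N, MemLp (fun ω => (∑ m ∈ Finset.range N, a m ω
      * scoreMultiplier h g θ N (fun k => a k ω) (fun k => b k ω) m)) 2 μ := fun N => by
    -- Square integrability of the score comes from the same decomposition; any `L` would do, and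
    -- `0` is simplest.
    have hw := score_sub_window_eq (a := a) (b := b) (h := h) (g := g) θ (L := 0) hK₀ (Nat.zero_le _) N
    have e : (fun ω => (∑ m ∈ Finset.range N, a m ω
      * scoreMultiplier h g θ N (fun k => a k ω) (fun k => b k ω) m)) = fun ω =>
      ∑ m ∈ Finset.range (N + K₀), a m ω * multiplierError h g θ N K₀ 0 a b m ω
      + ∑ m ∈ Finset.range N, a (m + K₀) ω * window a b (noiseWeight h θ K₀)
          (fun q => inputWeight h g θ 0 (K₀ - q)) (2 * K₀ + 1) K₀ m ω := by
      funext ω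
      rw [← hw ω, sub_add_cancel]
    rw [e]
    exact (hI.memLp_sum (fun m => measurable_multiplierError θ N K₀ 0 m)
      (fun m => memLp_multiplierError ha hb θ N K₀ 0 m) _).add
      ((hI.shift K₀).memLp_sum (fun m => measurable_window m) (fun m => memLp_window ha hb _ _ _ _ _) N)
  refine exists_tendsto_integral_exp_of_approx (Y := Y) (s := fun L => lam ^ 2 * D L)
    -- For fixed `L` the boundary contributes `O(1 / N)`, which is below `1 / (L + 1)` once `N` is
    -- large.
    (ε := fun L : ℕ => lam ^ 2 * (2 * lam ^ 2 * lagTail h g θ L) + 1 / ((L : ℝ) + 1))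
    (fun N => ?_) (fun L N => ?_) (fun L => ?_) (fun L t => ?_) ?_ (fun L => ?_)
  · simp_rw [div_eq_mul_inv]
    exact (hmem N).mul_const _
  · simp only [hY, div_eq_mul_inv]
    exact ((hI.shift (K₀ + L)).memLp_sum (fun m => measurable_window m)
      (fun m => memLp_window ha hb _ _ _ _ _) N).mul_const _
  · refine tendsto_const_nhds.congr' ?_
    filter_upwards [eventually_ge_atTop 1] with N hN
    have hN' : (0 : ℝ) < N := by positivity
    simp only [hY, div_pow, integral_div, Real.sq_sqrt hN'.le]
    rw [integral_sum_window_sq ha hb hab]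
    field_simp
    rfl
  · have := tendsto_integral_exp_window ha hb hab (noiseWeight h θ (K₀ + L))
      (fun q => inputWeight h g θ L (K₀ + L - q)) (2 * (K₀ + L) + 1) (K₀ + L) t
    convert this using 5
    simp only [hD]
    ring
  · have h1 := ((tendsto_lagTail hh hg θ).const_mul (2 * lam ^ 2)).const_mul (lam ^ 2)
    simpa using h1.add tendsto_one_div_add_atTop_nhds_zero_nat
  · set K := K₀ + L with hKdef
    have hK' : ∀ i : Lag Mnc Mc, |(i : ℤ)| ≤ K := fun i => by
      have := hK₀ i
      rw [hKdef]
      push_cast; omega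
    set C := 2 * (∑ i, h * |θ i|) ^ 2 * sigma ^ 2 + 8 * lam ^ 2 * ∑' l, lagBound h g θ l ^ 2 with hC
    have hC0 : 0 ≤ C := by
      have : 0 ≤ ∑' l, lagBound h g θ l ^ 2 := tsum_nonneg fun l => by positivity
      positivity
    have hT0 : 0 ≤ lagTail h g θ L := tsum_nonneg fun l => by positivity
    have hb1 : ∀ N : ℕ, 1 ≤ N → ∫ ω, ((∑ m ∈ Finset.range N, a m ω
          * scoreMultiplier h g θ N (fun k => a k ω) (fun k => b k ω) m) / √N - Y L N ω) ^ 2 ∂μ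
        ≤ lam ^ 2 * (2 * lam ^ 2 * lagTail h g θ L)
          + (lam ^ 2 * (K * (2 * lam ^ 2 * lagTail h g θ L) + 3 * K * C)) / N := by
      intro N hN
      have hN' : (0 : ℝ) < N := by positivity
      have e1 : ∀ ω, ((∑ m ∈ Finset.range N, a m ω
          * scoreMultiplier h g θ N (fun k => a k ω) (fun k => b k ω) m) / √N - Y L N ω) ^ 2
          = (∑ m ∈ Finset.range (N + K), a m ω * multiplierError h g θ N K L a b m ω) ^ 2 / N := by
        intro ω
        rw [← score_sub_window_eq θ hK' (by omega), hY, ← sub_div, div_pow, Real.sq_sqrt hN'.le]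
      simp_rw [e1]
      rw [integral_div, hI.integral_sum_sq (fun m => measurable_multiplierError θ N K L m)
        (fun m => memLp_multiplierError ha hb θ N K L m)]
      have e2 : ∑ m ∈ Finset.range (N + K), ∫ ω, multiplierError h g θ N K L a b m ω ^ 2 ∂μ
          ≤ (N + K) * (2 * lam ^ 2 * lagTail h g θ L) + 3 * K * C := by
        refine (Finset.sum_le_sum fun m _ =>
          integral_multiplierError_sq_le hh hg ha hb hab θ hK₀ N m).trans ?_
        rw [Finset.sum_add_distrib, ← hC, ← hKdef]
        refine add_le_add (by simp) ?_
        have e3 : ∀ m, (if K ≤ m ∧ m + K < N then 0 else C)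
          = if ¬ (K ≤ m ∧ m + K < N) then C else 0 := fun m => by rw [ite_not]
        simp_rw [e3]
        rw [← Finset.sum_filter, Finset.sum_const, nsmul_eq_mul]
        gcongr
        exact_mod_cast card_boundary_le N K
      rw [div_le_iff₀ hN', add_mul, div_mul_cancel₀ _ hN'.ne']
      have := mul_le_mul_of_nonneg_left e2 (sq_nonneg lam)
      linarith
    have hlim := (tendsto_const_div_atTop_nhds_zero_nat
      (lam ^ 2 * (K * (2 * lam ^ 2 * lagTail h g θ L) + 3 * K * C))).eventually_lt_const
      (show (0 : ℝ) < 1 / ((L : ℝ) + 1) by positivity)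
    filter_upwards [hlim, eventually_ge_atTop 1] with N h1 h2
    exact (hb1 N h2).trans (by linarith)

end ScoreApproximation

/-! ### Entries of the Gram matrix and integrability of the score terms. -/

section Gram

variable {Ω : Type*} [mΩ : MeasurableSpace Ω] {μ : Measure Ω} [IsProbabilityMeasure μ]
  {a b : ℕ → Ω → ℝ} {lam sigma : ℝ}

theorem memLp_gated (ha : ∀ m, MemLp (a m) 2 μ) (N : ℕ) (j : ℤ) :
    MemLp (fun ω => gated N (fun m => a m ω) j) 2 μ := by
  unfold gated
  split_ifs
  · exact ha _
  · exact memLp_const 0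

theorem measurable_gated (ha : ∀ m, Measurable (a m)) (N : ℕ) (j : ℤ) :
    Measurable (fun ω => gated N (fun m => a m ω) j) := by
  unfold gated
  split_ifs
  · exact ha _
  · exact measurable_const

theorem integral_gated_sq_le (ha : ∀ m, ∫ ω, a m ω ^ 2 ∂μ = lam ^ 2) (N : ℕ) (j : ℤ) :
    ∫ ω, gated N (fun m => a m ω) j ^ 2 ∂μ ≤ lam ^ 2 := by
  unfold gated
  split_ifs
  · rw [ha]
  · simp [sq_nonneg]

theorem sum_gated_mul_gated (N : ℕ) (a : ℕ → ℝ) (i j : ℤ) :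
    ∑ k ∈ Finset.range N, gated N a (k - i) * gated N a (k - j)
      = ∑ m ∈ Finset.range N, a m *
        if 0 ≤ m + i ∧ m + i < N then gated N a (m + i - j) else 0 := by
  rw [sum_gated_mul N a (fun k => gated N a (k - j)) i]
  refine Finset.sum_congr rfl fun m _ => ?_
  rw [gated]
  split_ifs with h
  · simp only [Int.toNat_of_nonneg h.1]
  · rfl

/-- Each term pairs an input with a strictly earlier one, so the sum is a martingale transform and
its average is `O(N ^ (-1/2))` in mean. -/
theorem tendsto_integral_abs_cross_of_lt (hX : IsWhiteNoise a lam μ) (hb : ∀ k, Measurable (b k))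
    (hab : IndepFun (fun ω k => a k ω) (fun ω k => b k ω) μ) {i j : ℤ} (hij : i < j) :
    Tendsto (fun N : ℕ => ∫ ω, |(∑ k ∈ Finset.range N, gated N (fun m => a m ω) (k - i)
      * gated N (fun m => a m ω) (k - j)) / N| ∂μ) atTop (𝓝 0) := by
  have hI := hX.isInnovation hb hab
  have hlim : Tendsto (fun N : ℕ => √(lam ^ 2 * lam ^ 2 / N)) atTop (𝓝 0) := by
    have := (tendsto_const_div_atTop_nhds_zero_nat (lam ^ 2 * lam ^ 2)).sqrt
    simpa using this
  refine squeeze_zero' (Eventually.of_forall fun N => integral_nonneg fun ω => abs_nonneg _)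
    (eventually_atTop.2 ⟨1, fun N hN => ?_⟩) hlim
  have hN' : (0 : ℝ) < N := by positivity
  set Z : ℕ → Ω → ℝ := fun m ω =>
    if 0 ≤ m + i ∧ m + i < N then gated N (fun m => a m ω) (m + i - j) else 0 with hZ
  have hZm : ∀ m, Measurable[history a b m] (Z m) := fun m => by
    simp only [hZ, gated]
    split_ifs with h1 h2
    · exact measurable_history_left (by omega)
    · exact measurable_const
    · exact measurable_const
  have hZ2 : ∀ m, MemLp (Z m) 2 μ := fun m => by
    simp only [hZ]
    split_ifs with h1
    · exact memLp_gated hX.memLp_all N _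
    · exact memLp_const 0
  have hZC : ∀ m, ∫ ω, Z m ω ^ 2 ∂μ ≤ lam ^ 2 := fun m => by
    simp only [hZ]
    split_ifs with h1
    · exact integral_gated_sq_le hI.sq N _
    · simp [sq_nonneg]
  have h1 := hI.integral_abs_sum_le hZm hZ2 N hZC
  simp only [sum_gated_mul_gated, abs_div, Nat.abs_cast, integral_div]
  rw [div_le_iff₀ hN']
  refine h1.trans (le_of_eq ?_)
  rw [show lam ^ 2 * (N * lam ^ 2) = (lam ^ 2 * lam ^ 2 / N) * N ^ 2 by field_simp,
    Real.sqrt_mul' _ (by positivity), Real.sqrt_sq hN'.le]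

/-- The law of large numbers for the squares, except that gating loses at most `|i|` of them at one
end. -/
theorem tendsto_integral_abs_cross_self (hX : IsWhiteNoise a lam μ) (i : ℤ) :
    Tendsto (fun N : ℕ => ∫ ω, |(∑ k ∈ Finset.range N, gated N (fun m => a m ω) (k - i)
      * gated N (fun m => a m ω) (k - i)) / N - lam ^ 2| ∂μ) atTop (𝓝 0) := by
  have hL := hX.meanLLN_sq 0
  have hsq : ∀ m, Integrable (fun ω => a m ω ^ 2) μ := fun m => (hX.memLp_all m).integrable_sq
  have hsqI : ∀ m, ∫ ω, a m ω ^ 2 ∂μ = lam ^ 2 := fun m => by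
    have h1 := ((hX.identDistrib m).comp (u := fun x : ℝ => x ^ 2) (by fun_prop)).integral_eq
    have h2 := hX.variance_eq
    rw [variance_of_integral_eq_zero hX.memLp.1.aemeasurable hX.mean_zero] at h2
    exact h1.trans h2
  have hlim : Tendsto (fun N : ℕ => ∫ ω, |(∑ m ∈ Finset.range N, a (m + 0) ω ^ 2) / N - lam ^ 2| ∂μ
      + (i.natAbs * lam ^ 2) / N) atTop (𝓝 0) := by
    simpa using hL.2.add (tendsto_const_div_atTop_nhds_zero_nat (i.natAbs * lam ^ 2))
  refine squeeze_zero (fun N => integral_nonneg fun ω => abs_nonneg _) (fun N => ?_) hlim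
  set B := (Finset.range N).filter fun m : ℕ => ¬ (0 ≤ (m : ℤ) + i ∧ (m : ℤ) + i < N) with hB
  have hBc : (B.card : ℝ) ≤ i.natAbs := by
    have hd : B ⊆ Finset.range i.natAbs ∨ B ⊆ Finset.Ico (N - i.natAbs) N := by
      rcases le_total 0 i with h0 | h0
      · right
        intro m hm
        simp only [hB, Finset.mem_filter, Finset.mem_range, Finset.mem_Ico] at hm ⊢
        omega
      · left
        intro m hm
        simp only [hB, Finset.mem_filter, Finset.mem_range] at hm ⊢
        omega
    rcases hd with hd | hd
    · have := Finset.card_le_card hd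
      rw [Finset.card_range] at this
      exact_mod_cast this
    · have := Finset.card_le_card hd
      rw [Nat.card_Ico] at this
      exact_mod_cast this.trans (by omega)
  have e1 : ∀ ω, (∑ k ∈ Finset.range N, gated N (fun m => a m ω) (k - i)
      * gated N (fun m => a m ω) (k - i)) / N - lam ^ 2
      = ((∑ m ∈ Finset.range N, a (m + 0) ω ^ 2) / N - lam ^ 2) - (∑ m ∈ B, a m ω ^ 2) / N := by
    intro ω
    rw [sum_gated_mul_gated, sub_right_comm, ← sub_div]
    congr 2
    rw [hB, Finset.sum_filter, ← Finset.sum_sub_distrib]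
    refine Finset.sum_congr rfl fun m hm => ?_
    have hm := Finset.mem_range.1 hm
    rw [ite_not]
    split_ifs with h
    · rw [gated_of_mem (by omega) (by omega)]
      simp [sq]
    · simp
  have hi1 : Integrable (fun ω => |(∑ m ∈ Finset.range N, a (m + 0) ω ^ 2) / N - lam ^ 2|) μ :=
    (((integrable_finsetSum _ fun m _ => hsq (m + 0)).div_const _).sub (integrable_const _)).abs
  have hi2 : Integrable (fun ω => (∑ m ∈ B, a m ω ^ 2) / N) μ :=
    (integrable_finsetSum _ fun m _ => hsq m).div_const _
  calc _ ≤ ∫ ω, (|(∑ m ∈ Finset.range N, a (m + 0) ω ^ 2) / N - lam ^ 2|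
        + (∑ m ∈ B, a m ω ^ 2) / N) ∂μ := by
        refine integral_mono_of_nonneg (ae_of_all _ fun _ => abs_nonneg _) (hi1.add hi2)
          (ae_of_all _ fun ω => ?_)
        simp only [e1]
        refine (abs_sub _ _).trans (add_le_add le_rfl (le_of_eq ?_))
        exact abs_of_nonneg (by positivity)
    _ ≤ _ := by
        rw [integral_add hi1 hi2, integral_div, integral_finsetSum _ fun m _ => hsq m]
        simp_rw [hsqI]
        rw [Finset.sum_const, nsmul_eq_mul]
        gcongr

theorem tendsto_integral_abs_cross (hX : IsWhiteNoise a lam μ) (hb : ∀ k, Measurable (b k))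
    (hab : IndepFun (fun ω k => a k ω) (fun ω k => b k ω) μ) (i j : ℤ) :
    Tendsto (fun N : ℕ => ∫ ω, |(∑ k ∈ Finset.range N, gated N (fun m => a m ω) (k - i)
      * gated N (fun m => a m ω) (k - j)) / N - if i = j then lam ^ 2 else 0| ∂μ) atTop (𝓝 0) := by
  rcases lt_trichotomy i j with h | h | h
  · simpa [h.ne] using tendsto_integral_abs_cross_of_lt hX hb hab h
  · subst h
    simpa using tendsto_integral_abs_cross_self hX i
  · have := tendsto_integral_abs_cross_of_lt hX hb hab h
    simpa [h.ne', mul_comm] using this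

/-- Each summand of the score is square integrable. -/
theorem memLp_gated_mul_residual (ha : IsWhiteNoise a lam μ)
    (hb : IsStationaryErgodicNoise b sigma μ)
    (hab : IndepFun (fun ω k => a k ω) (fun ω k => b k ω) μ) (N k : ℕ) (i : ℤ) (h : ℝ)
    (c : ℤ → ℝ) (hc : c i = 0) :
    MemLp (fun ω => gated N (fun m => a m ω) (k - i)
      * (b k ω + h * ∑ n ∈ Finset.range N, a n ω * c (k - n))) 2 μ := by
  unfold gated
  split_ifs with hk
  · obtain ⟨p, hp⟩ : ∃ p : ℕ, (k : ℤ) - i = p := ⟨_, (Int.toNat_of_nonneg hk.1).symm⟩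
    simp only [hp, Int.toNat_natCast, mul_add]
    have hapb : MemLp (fun ω => a p ω * b k ω) 2 μ :=
      memLp_mul_of_indepFun (hab.comp (φ := fun x : ℕ → ℝ => x p) (ψ := fun x : ℕ → ℝ => x k)
        (by fun_prop) (by fun_prop)) (ha.memLp_all p) (hb.memLp_all k)
    refine hapb.add ?_
    simp_rw [Finset.mul_sum]
    refine memLp_finsetSum _ fun n _ => ?_
    -- The only product with a repeated factor is `a p ^ 2`, which would need a fourth moment; its
    -- coefficient is `c i = 0`.
    by_cases hn : n = p
    · have : (k : ℤ) - n = i := by omega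
      simp only [this, hc, mul_zero]
      exact memLp_const 0
    · have := (memLp_mul_of_indepFun (ha.indep.indepFun (Ne.symm hn)) (ha.memLp_all p)
        (ha.memLp_all n)).const_mul (h * c (k - n))
      refine this.ae_eq (ae_of_all _ fun ω => ?_)
      simp only
      ring
  · simp only [zero_mul]
    exact memLp_const 0

end Gram

/-! ### Convergence in probability and the algebra of the least-squares error. -/

section LeastSquares

variable {Ω : Type*} [mΩ : MeasurableSpace Ω] {μ : Measure Ω} [IsProbabilityMeasure μ]

theorem tendstoInMeasure_of_tendsto_integral_abs {ι : Type*} [Fintype ι]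
    {A : ℕ → Ω → ι → ι → ℝ} {c : ι → ι → ℝ}
    (hA : ∀ N i j, Integrable (fun ω => A N ω i j) μ)
    (h : ∀ i j, Tendsto (fun N => ∫ ω, |A N ω i j - c i j| ∂μ) atTop (𝓝 0)) :
    TendstoInMeasure μ A atTop fun _ => c := by
  rw [tendstoInMeasure_iff_measureReal_norm]
  intro ε hε
  have hi : ∀ N i j, Integrable (fun ω => |A N ω i j - c i j|) μ := fun N i j =>
    ((hA N i j).sub (integrable_const _)).abs
  have hlim : Tendsto (fun N => (∑ i, ∑ j, ∫ ω, |A N ω i j - c i j| ∂μ) / ε) atTop (𝓝 0) := by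
    have := tendsto_finsetSum Finset.univ fun i _ => tendsto_finsetSum Finset.univ fun j _ => h i j
    simpa using this.div_const ε
  refine squeeze_zero (fun N => measureReal_nonneg) (fun N => ?_) hlim
  rw [le_div_iff₀ hε]
  have hint : Integrable (fun ω => ∑ i, ∑ j, |A N ω i j - c i j|) μ :=
    integrable_finsetSum _ fun i _ => integrable_finsetSum _ fun j _ => hi N i j
  have hm := mul_meas_ge_le_integral_of_nonneg (μ := μ)
    (ae_of_all _ fun ω => Finset.sum_nonneg fun i _ => Finset.sum_nonneg fun j _ => abs_nonneg _)
    hint ε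
  have e : ∫ ω, ∑ i, ∑ j, |A N ω i j - c i j| ∂μ = ∑ i, ∑ j, ∫ ω, |A N ω i j - c i j| ∂μ := by
    rw [integral_finsetSum _ fun i _ => integrable_finsetSum _ fun j _ => hi N i j]
    exact Finset.sum_congr rfl fun i _ => integral_finsetSum _ fun j _ => hi N i j
  rw [← e, mul_comm]
  refine le_trans ?_ hm
  refine mul_le_mul_of_nonneg_left (measureReal_mono ?_) hε.le
  intro ω hω
  refine le_trans (show ε ≤ ‖A N ω - c‖ from hω) ?_
  refine (pi_norm_le_iff_of_nonneg (Finset.sum_nonneg fun i _ => Finset.sum_nonneg fun j _ =>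
    abs_nonneg _)).2 fun i => ?_
  refine (pi_norm_le_iff_of_nonneg (Finset.sum_nonneg fun i _ => Finset.sum_nonneg fun j _ =>
    abs_nonneg _)).2 fun j => ?_
  refine le_trans ?_ (Finset.single_le_sum (f := fun i => ∑ j, |A N ω i j - c i j|)
    (fun i _ => Finset.sum_nonneg fun j _ => abs_nonneg _) (Finset.mem_univ i))
  exact Finset.single_le_sum (f := fun j => |A N ω i j - c i j|)
    (fun j _ => abs_nonneg _) (Finset.mem_univ j)

theorem tendstoInMeasure_comp_continuousAt {E F : Type*} [PseudoEMetricSpace E]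
    [PseudoEMetricSpace F] {A : ℕ → Ω → E} {c : E} (hA : TendstoInMeasure μ A atTop fun _ => c)
    {f : E → F} (hf : ContinuousAt f c) :
    TendstoInMeasure μ (fun N ω => f (A N ω)) atTop fun _ => f c := by
  intro ε hε
  obtain ⟨δ, hδ, hδ'⟩ := EMetric.continuousAt_iff.1 hf ε hε
  refine tendsto_of_tendsto_of_tendsto_of_le_of_le tendsto_const_nhds (hA δ hδ)
    (fun N => zero_le) fun N => measure_mono fun ω hω => ?_
  by_contra hc
  exact absurd (hδ' (not_le.1 hc)) (not_lt.2 hω)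

theorem tendsto_measure_of_eventually {E : Type*} [PseudoEMetricSpace E] {A : ℕ → Ω → E} {c : E}
    (hA : TendstoInMeasure μ A atTop fun _ => c) {p : E → Prop} (hp : ∀ᶠ x in 𝓝 c, p x) :
    Tendsto (fun N => μ {ω | ¬ p (A N ω)}) atTop (𝓝 0) := by
  obtain ⟨δ, hδ, hδ'⟩ := EMetric.mem_nhds_iff.1 hp
  refine tendsto_of_tendsto_of_tendsto_of_le_of_le tendsto_const_nhds (hA δ hδ)
    (fun N => zero_le) fun N => measure_mono fun ω hω => ?_
  by_contra hc
  exact hω (hδ' (Metric.mem_eball.2 (not_le.1 hc)))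

/-- The inverse of a matrix given by its entries. -/
noncomputable def invEntries {ι : Type*} [Fintype ι] [DecidableEq ι] (A : ι → ι → ℝ) : ι → ι → ℝ :=
  fun i j => ((Matrix.of A)⁻¹ : Matrix ι ι ℝ) i j

theorem continuousAt_invEntries {ι : Type*} [Fintype ι] [DecidableEq ι] {A : ι → ι → ℝ}
    (hA : (Matrix.of A).det ≠ 0) : ContinuousAt (invEntries (ι := ι)) A := by
  have h1 : Continuous fun A : ι → ι → ℝ => (Matrix.of A).det :=
    Continuous.matrix_det (A := fun A : ι → ι → ℝ => Matrix.of A) continuous_id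
  have h2 : Continuous fun A : ι → ι → ℝ => (Matrix.of A).adjugate :=
    Continuous.matrix_adjugate (A := fun A : ι → ι → ℝ => Matrix.of A) continuous_id
  refine continuousAt_pi.2 fun i => continuousAt_pi.2 fun j => ?_
  have : ContinuousAt (fun A : ι → ι → ℝ =>
      ((Matrix.of A).det)⁻¹ * (Matrix.of A).adjugate i j) A :=
    (h1.continuousAt.inv₀ hA).mul ((continuous_apply_apply i j).comp h2).continuousAt
  refine this.congr (Eventually.of_forall fun B => ?_)
  simp only [invEntries, Matrix.inv_def, Ring.inverse_eq_inv', Matrix.smul_apply, smul_eq_mul]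

/-- The adjugate formula holds everywhere, since at singular matrices both sides are `0`. -/
theorem measurable_invEntries {ι : Type*} [Fintype ι] [DecidableEq ι] :
    Measurable (invEntries (ι := ι)) := by
  have h1 : Continuous fun A : ι → ι → ℝ => (Matrix.of A).det :=
    Continuous.matrix_det (A := fun A : ι → ι → ℝ => Matrix.of A) continuous_id
  have h2 : Continuous fun A : ι → ι → ℝ => (Matrix.of A).adjugate :=
    Continuous.matrix_adjugate (A := fun A : ι → ι → ℝ => Matrix.of A) continuous_id
  refine measurable_pi_iff.2 fun i => measurable_pi_iff.2 fun j => ?_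
  have : (fun A : ι → ι → ℝ => invEntries A i j)
      = fun A => ((Matrix.of A).det)⁻¹ * (Matrix.of A).adjugate i j := by
    funext A
    simp only [invEntries, Matrix.inv_def, Ring.inverse_eq_inv', Matrix.smul_apply, smul_eq_mul]
  rw [this]
  exact h1.measurable.inv.mul ((continuous_apply_apply i j).comp h2).measurable

/-- The score vector `∑ φ(kh) w(kh)`. -/
noncomputable def scoreVec (h : ℝ) (g : ℝ → ℝ) (Mnc Mc : ℤ) (N : ℕ) (e v : ℕ → ℝ) :
    Lag Mnc Mc → ℝ := fun i => ∑ k ∈ Finset.Icc 1 N,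
      regressor h (inputSignal h N e) Mnc Mc k i * residualNoise h g (inputSignal h N e) v Mnc Mc k

/-- The normalized Gram matrix of the regressors. -/
noncomputable def gramAvg (h : ℝ) (Mnc Mc : ℤ) (N : ℕ) (e : ℕ → ℝ) :
    Lag Mnc Mc → Lag Mnc Mc → ℝ := fun i j => (∑ k ∈ Finset.Icc 1 N,
      regressor h (inputSignal h N e) Mnc Mc k i * regressor h (inputSignal h N e) Mnc Mc k j) / N

variable {h : ℝ} {g : ℝ → ℝ} {Mnc Mc : ℤ}

/-- The normal equations with `y = φᵀ ρ* + w` substituted: the first part returns `ρ*` when the Gram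
matrix is invertible. -/
theorem lsEstimate_sub_eq (N : ℕ) (e v : ℕ → ℝ) {G : Matrix (Lag Mnc Mc) (Lag Mnc Mc) ℝ}
    (hG : G = ∑ k ∈ Finset.Icc 1 N, Matrix.vecMulVec (regressor h (inputSignal h N e) Mnc Mc k)
      (regressor h (inputSignal h N e) Mnc Mc k)) (hdet : G.det ≠ 0) :
    lsEstimate h (inputSignal h N e) (measuredOutput h g (inputSignal h N e) v) Mnc Mc N
        - trueParam h g Mnc Mc
      = WithLp.toLp 2 (G⁻¹.mulVec (scoreVec h g Mnc Mc N e v)) := by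
  have e1 : ∑ k ∈ Finset.Icc 1 N, measuredOutput h g (inputSignal h N e) v k
      • regressor h (inputSignal h N e) Mnc Mc k
      = G.mulVec (trueParam h g Mnc Mc).ofLp + scoreVec h g Mnc Mc N e v := by
    funext i
    simp only [hG, Finset.sum_apply, Pi.smul_apply, smul_eq_mul, Pi.add_apply, Matrix.mulVec,
      dotProduct, Matrix.sum_apply, Matrix.vecMulVec_apply, scoreVec, Finset.sum_mul]
    rw [Finset.sum_comm, ← Finset.sum_add_distrib]
    refine Finset.sum_congr rfl fun k _ => ?_
    rw [residualNoise, mul_sub, Finset.mul_sum]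
    have : ∀ n, regressor h (inputSignal h N e) Mnc Mc k i
        * regressor h (inputSignal h N e) Mnc Mc k n * trueParam h g Mnc Mc n
      = regressor h (inputSignal h N e) Mnc Mc k i
        * (regressor h (inputSignal h N e) Mnc Mc k n * trueParam h g Mnc Mc n) := fun n => by ring
    simp only [this]
    ring
  rw [lsEstimate, ← hG, e1, Matrix.mulVec_add, Matrix.mulVec_mulVec,
    Matrix.nonsing_inv_mul _ (isUnit_iff_ne_zero.2 hdet), Matrix.one_mulVec]
  ext i
  simp

theorem sqrt_smul_lsEstimate_sub_eq {N : ℕ} (e v : ℕ → ℝ)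
    (hdet : (Matrix.of (gramAvg h Mnc Mc N e)).det ≠ 0) (hN : 1 ≤ N) :
    √(N : ℝ) • (lsEstimate h (inputSignal h N e) (measuredOutput h g (inputSignal h N e) v) Mnc Mc N
        - trueParam h g Mnc Mc)
      = WithLp.toLp 2 ((Matrix.of (invEntries (gramAvg h Mnc Mc N e))).mulVec
          fun i => scoreVec h g Mnc Mc N e v i / √N) := by
  have hN' : (0 : ℝ) < N := by positivity
  set G := ∑ k ∈ Finset.Icc 1 N, Matrix.vecMulVec (regressor h (inputSignal h N e) Mnc Mc k)
      (regressor h (inputSignal h N e) Mnc Mc k) with hG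
  have e1 : Matrix.of (gramAvg h Mnc Mc N e) = (N : ℝ)⁻¹ • G := by
    ext i j
    simp [gramAvg, hG, Matrix.sum_apply, Matrix.vecMulVec_apply, div_eq_inv_mul]
  have hdetG : G.det ≠ 0 := by
    rw [e1, Matrix.det_smul] at hdet
    exact right_ne_zero_of_mul hdet
  have e2 : Matrix.of (invEntries (gramAvg h Mnc Mc N e)) = (N : ℝ) • G⁻¹ := by
    change (Matrix.of (gramAvg h Mnc Mc N e))⁻¹ = _
    rw [e1]
    refine Matrix.inv_eq_left_inv ?_
    rw [smul_mul_smul_comm, mul_inv_cancel₀ hN'.ne', one_smul,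
      Matrix.nonsing_inv_mul _ (isUnit_iff_ne_zero.2 hdetG)]
  rw [lsEstimate_sub_eq N e v hG hdetG, e2]
  ext i
  simp only [PiLp.smul_apply, smul_eq_mul, Matrix.smul_apply, Matrix.mulVec, dotProduct,
    Finset.mul_sum]
  refine Finset.sum_congr rfl fun j _ => ?_
  have : (N : ℝ) = √N * √N := (Real.mul_self_sqrt hN'.le).symm
  have hs : √(N : ℝ) ≠ 0 := (Real.sqrt_pos.2 hN').ne'
  field_simp
  rw [sq, Real.mul_self_sqrt hN'.le]
  ring

end LeastSquares

/-! ### From linear combinations to the multivariate Gaussian limit. -/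

section CramerWold

variable {Ω : Type*} [mΩ : MeasurableSpace Ω] {μ : Measure Ω} [IsProbabilityMeasure μ]

/-- A sequence of random vectors all of whose linear combinations have convergent second moments
and are asymptotically Gaussian is asymptotically Gaussian, with covariance matrix the limit of
the second-moment matrices. -/
theorem exists_tendsto_multivariateGaussian {ι : Type*} [Fintype ι] [DecidableEq ι]
    {Z : ℕ → Ω → ι → ℝ} (hZ : ∀ N i, MemLp (fun ω => Z N ω i) 2 μ)
    (h : ∀ θ : ι → ℝ, ∃ s : ℝ,
      Tendsto (fun N => ∫ ω, (∑ i, θ i * Z N ω i) ^ 2 ∂μ) atTop (𝓝 s) ∧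
      ∀ t : ℝ, Tendsto (fun N => ∫ ω, Complex.exp ((t * ∑ i, θ i * Z N ω i : ℝ) * Complex.I) ∂μ)
        atTop (𝓝 (Complex.exp (-((t ^ 2 * s / 2 : ℝ) : ℂ))))) :
    ∃ Q : Matrix ι ι ℝ, Q.PosSemidef ∧
      (∀ i j, Tendsto (fun N => ∫ ω, Z N ω i * Z N ω j ∂μ) atTop (𝓝 (Q i j))) ∧
      ∀ c : ℝ, TendstoInDistribution (fun N ω => WithLp.toLp 2 (c • Z N ω)) atTop
        (id : EuclideanSpace ℝ ι → EuclideanSpace ℝ ι) (fun _ => μ)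
        (multivariateGaussian 0 (c ^ 2 • Q)) := by
  choose s hs hexp using h
  have hint : ∀ N i j, Integrable (fun ω => Z N ω i * Z N ω j) μ := fun N i j =>
    (hZ N i).integrable_mul (hZ N j)
  have hZsum : ∀ N (θ : ι → ℝ), MemLp (fun ω => ∑ i, θ i * Z N ω i) 2 μ := fun N θ =>
    memLp_finsetSum _ fun i _ => (hZ N i).const_mul (θ i)
  have hexpand : ∀ N (θ : ι → ℝ), ∫ ω, (∑ i, θ i * Z N ω i) ^ 2 ∂μ
      = ∑ i, ∑ j, θ i * θ j * ∫ ω, Z N ω i * Z N ω j ∂μ := by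
    intro N θ
    simp_rw [← integral_const_mul]
    have : ∀ ω, (∑ i, θ i * Z N ω i) ^ 2 = ∑ i, ∑ j, θ i * θ j * (Z N ω i * Z N ω j) := by
      intro ω
      rw [sq, Finset.sum_mul_sum]
      exact Finset.sum_congr rfl fun i _ => Finset.sum_congr rfl fun j _ => by ring
    simp_rw [this]
    rw [integral_finsetSum _ fun i _ => integrable_finsetSum _ fun j _ =>
      (hint N i j).const_mul _]
    exact Finset.sum_congr rfl fun i _ => integral_finsetSum _ fun j _ =>
      (hint N i j).const_mul _
  -- Polarization: mixed moments come from the directions `e_i + e_j` and `e_i - e_j`.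
  let Q : Matrix ι ι ℝ := Matrix.of fun i j =>
    (s (Pi.single i 1 + Pi.single j 1) - s (Pi.single i 1 - Pi.single j 1)) / 4
  have hQ : ∀ i j, Tendsto (fun N => ∫ ω, Z N ω i * Z N ω j ∂μ) atTop (𝓝 (Q i j)) := by
    intro i j
    refine (((hs (Pi.single i 1 + Pi.single j 1)).sub
      (hs (Pi.single i 1 - Pi.single j 1))).div_const 4).congr fun N => ?_
    rw [← integral_sub (hZsum N _).integrable_sq (hZsum N _).integrable_sq, ← integral_div]
    refine integral_congr_ae (ae_of_all _ fun ω => ?_)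
    simp only [Pi.add_apply, Pi.sub_apply, add_mul, sub_mul, Finset.sum_add_distrib,
      Finset.sum_sub_distrib, Pi.single_apply, ite_mul, one_mul, zero_mul, Finset.sum_ite_eq',
      Finset.mem_univ, if_true]
    ring
  have hsQ : ∀ θ : ι → ℝ, s θ = ∑ i, ∑ j, θ i * θ j * Q i j := by
    intro θ
    refine tendsto_nhds_unique (hs θ) ?_
    simp_rw [hexpand]
    exact tendsto_finsetSum _ fun i _ => tendsto_finsetSum _ fun j _ => (hQ i j).const_mul _
  have hs0 : ∀ θ, 0 ≤ s θ := fun θ =>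
    ge_of_tendsto' (hs θ) fun N => integral_nonneg fun ω => sq_nonneg _
  have hquad : ∀ θ : ι → ℝ, dotProduct θ (Q.mulVec θ) = s θ := by
    intro θ
    rw [hsQ]
    simp only [dotProduct, Matrix.mulVec, Finset.mul_sum]
    exact Finset.sum_congr rfl fun i _ => Finset.sum_congr rfl fun j _ => by ring
  have hpsd : Q.PosSemidef := by
    refine Matrix.PosSemidef.of_dotProduct_mulVec_nonneg ?_ fun θ => ?_
    · ext i j
      rw [Matrix.conjTranspose_apply]
      refine tendsto_nhds_unique (hQ j i) ?_
      simpa only [mul_comm] using hQ i j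
    · rw [star_trivial, hquad]
      exact hs0 θ
  refine ⟨Q, hpsd, hQ, fun c => ?_⟩
  have hmeas : ∀ N, AEMeasurable (fun ω => (WithLp.toLp 2 (c • Z N ω) : EuclideanSpace ℝ ι)) μ :=
    fun N => (WithLp.measurable_toLp 2 (ι → ℝ)).comp_aemeasurable
      (aemeasurable_pi_iff.2 fun i => (hZ N i).aemeasurable.const_mul c)
  refine ⟨hmeas, aemeasurable_id, ProbabilityMeasure.tendsto_iff_tendsto_charFun.2 fun θ => ?_⟩
  have hc : (c ^ 2 • Q).PosSemidef := hpsd.smul (sq_nonneg c)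
  simp only [ProbabilityMeasure.coe_mk, Measure.map_id]
  rw [charFun_multivariateGaussian hc]
  have e1 : Complex.exp (-((c ^ 2 * s θ.ofLp / 2 : ℝ) : ℂ))
      = Complex.exp ((inner ℝ θ (0 : EuclideanSpace ℝ ι) : ℝ) * Complex.I
        - ((dotProduct θ.ofLp ((c ^ 2 • Q).mulVec θ.ofLp) : ℝ) : ℂ) / 2) := by
    rw [Matrix.smul_mulVec, dotProduct_smul, hquad]
    simp
  rw [← e1]
  -- Evaluating the one-dimensional limit at `t = c` gives the characteristic function of the vector
  -- scaled by `c`.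
  refine (hexp θ.ofLp c).congr fun N => ?_
  rw [charFun_apply, integral_map (hmeas N) (by fun_prop)]
  refine integral_congr_ae (ae_of_all _ fun ω => ?_)
  simp only [PiLp.inner_apply, Pi.smul_apply, smul_eq_mul, RCLike.inner_apply, conj_trivial,
    Finset.mul_sum]
  congr 3
  refine Finset.sum_congr rfl fun i _ => ?_
  ring

end CramerWold

/-! ### Measurability, the limit of the score vector, and Slutsky's theorem. -/

section LeastSquaresLimit

variable {Ω : Type*} [mΩ : MeasurableSpace Ω] {μ : Measure Ω} [IsProbabilityMeasure μ]
  {h lam sigma : ℝ} {g : ℝ → ℝ} {Mnc Mc : ℤ} {e v : ℕ → Ω → ℝ}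

theorem measurable_regressor (hh : 0 < h) (he : ∀ k, Measurable (e (k + 1))) (N k : ℕ)
    (i : Lag Mnc Mc) :
    Measurable fun ω => regressor h (inputSignal h N fun m => e m ω) Mnc Mc (k + 1) i := by
  simp_rw [regressor_succ hh]
  exact (measurable_gated (a := fun m => e (m + 1)) he N _).const_mul h

theorem measurable_residualNoise (hh : 0 < h) (hg : IntegrableOn g (Set.Ioi 0))
    (he : ∀ k, Measurable (e (k + 1))) (hv : ∀ k, Measurable (v (k + 1))) (N k : ℕ) :
    Measurable fun ω => residualNoise h g (inputSignal h N fun m => e m ω) (fun m => v m ω)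
      Mnc Mc (k + 1) := by
  simp_rw [residualNoise_succ hh hg]
  exact (hv k).add ((Finset.measurable_sum _ fun n _ => (he n).mul_const _).const_mul h)

theorem measurable_measuredOutput (hh : 0 < h) (hg : IntegrableOn g (Set.Ioi 0))
    (he : ∀ k, Measurable (e (k + 1))) (hv : ∀ k, Measurable (v (k + 1))) (N k : ℕ) :
    Measurable fun ω => measuredOutput h g (inputSignal h N fun m => e m ω) (fun m => v m ω)
      (k + 1) := by
  -- The output is rebuilt from the residual of a model with the single lag `0`, which avoids a
  -- separate treatment of the system integral.
  have : ∀ ω, measuredOutput h g (inputSignal h N fun m => e m ω) (fun m => v m ω) (k + 1)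
      = residualNoise h g (inputSignal h N fun m => e m ω) (fun m => v m ω) 0 0 (k + 1)
        + ∑ n : Lag 0 0, regressor h (inputSignal h N fun m => e m ω) 0 0 (k + 1) n
          * trueParam h g 0 0 n := fun ω => by
    rw [residualNoise, sub_add_cancel]
  simp_rw [this]
  exact (measurable_residualNoise hh hg he hv N k).add
    (Finset.measurable_sum _ fun n _ => (measurable_regressor hh he N k n).mul_const _)

theorem measurable_lsEstimate (hh : 0 < h) (hg : IntegrableOn g (Set.Ioi 0))
    (he : ∀ k, Measurable (e (k + 1))) (hv : ∀ k, Measurable (v (k + 1))) (N : ℕ) :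
    Measurable fun ω => lsEstimate h (inputSignal h N fun m => e m ω)
      (measuredOutput h g (inputSignal h N fun m => e m ω) fun m => v m ω) Mnc Mc N := by
  refine (WithLp.measurable_toLp 2 (Lag Mnc Mc → ℝ)).comp (measurable_pi_iff.2 fun i => ?_)
  simp only [sum_Icc_one_eq_sum_range, Matrix.mulVec, dotProduct, Finset.sum_apply, Pi.smul_apply,
    smul_eq_mul]
  refine Finset.measurable_sum _ fun j _ => ?_
  refine Measurable.mul ?_ (Finset.measurable_sum _ fun k _ =>
    (measurable_measuredOutput hh hg he hv N k).mul (measurable_regressor hh he N k j))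
  refine (measurable_pi_iff.1 (measurable_pi_iff.1 (measurable_invEntries (ι := Lag Mnc Mc)) i)
    j).comp (g := fun A : Lag Mnc Mc → Lag Mnc Mc → ℝ => invEntries A i j)
    (f := fun ω p q => (∑ k ∈ Finset.range N, Matrix.vecMulVec
      (regressor h (inputSignal h N fun m => e m ω) Mnc Mc (k + 1))
      (regressor h (inputSignal h N fun m => e m ω) Mnc Mc (k + 1))) p q)
    (measurable_pi_iff.2 fun p => measurable_pi_iff.2 fun q => ?_)
  simp only [Matrix.sum_apply, Matrix.vecMulVec_apply]
  exact Finset.measurable_sum _ fun k _ =>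
    (measurable_regressor hh he N k p).mul (measurable_regressor hh he N k q)

theorem memLp_regressor_mul_residualNoise (hh : 0 < h) (hg : IntegrableOn g (Set.Ioi 0))
    (he : IsWhiteNoise (fun k => e (k + 1)) lam μ)
    (hv : IsStationaryErgodicNoise (fun k => v (k + 1)) sigma μ)
    (hev : IndepFun (fun ω (k : ℕ) => e (k + 1) ω) (fun ω (k : ℕ) => v (k + 1) ω) μ) (N k : ℕ)
    (i : Lag Mnc Mc) :
    MemLp (fun ω => regressor h (inputSignal h N fun m => e m ω) Mnc Mc (k + 1) i
      * residualNoise h g (inputSignal h N fun m => e m ω) (fun m => v m ω) Mnc Mc (k + 1)) 2 μ := by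
  simp_rw [regressor_succ hh, residualNoise_succ hh hg, mul_assoc]
  exact (memLp_gated_mul_residual he hv hev N k i h (unmodelled h g Mnc Mc)
    (by rw [unmodelled, if_pos i.2])).const_mul h

theorem memLp_scoreVec (hh : 0 < h) (hg : IntegrableOn g (Set.Ioi 0))
    (he : IsWhiteNoise (fun k => e (k + 1)) lam μ)
    (hv : IsStationaryErgodicNoise (fun k => v (k + 1)) sigma μ)
    (hev : IndepFun (fun ω (k : ℕ) => e (k + 1) ω) (fun ω (k : ℕ) => v (k + 1) ω) μ) (N : ℕ)
    (i : Lag Mnc Mc) :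
    MemLp (fun ω => scoreVec h g Mnc Mc N (fun m => e m ω) (fun m => v m ω) i) 2 μ := by
  simp_rw [scoreVec, sum_Icc_one_eq_sum_range]
  exact memLp_finsetSum _ fun k _ => memLp_regressor_mul_residualNoise hh hg he hv hev N k i

theorem integrable_scoreProduct (hh : 0 < h) (hg : IntegrableOn g (Set.Ioi 0))
    (he : IsWhiteNoise (fun k => e (k + 1)) lam μ)
    (hv : IsStationaryErgodicNoise (fun k => v (k + 1)) sigma μ)
    (hev : IndepFun (fun ω (k : ℕ) => e (k + 1) ω) (fun ω (k : ℕ) => v (k + 1) ω) μ) (N k n : ℕ)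
    (i j : Lag Mnc Mc) :
    Integrable (fun ω => scoreProduct h g Mnc Mc N (k + 1) (n + 1) i j (fun m => e m ω)
      (fun m => v m ω)) μ := by
  refine ((memLp_regressor_mul_residualNoise hh hg he hv hev N k i).integrable_mul
    (memLp_regressor_mul_residualNoise hh hg he hv hev N n j)).congr (ae_of_all _ fun ω => ?_)
  simp only [scoreProduct, Pi.mul_apply]
  ring

/-- The double sum is the outer product of the score vector with itself, so the limit covariance of
the score is the normalized limit in question. -/
theorem sum_sum_integral_scoreProduct (hh : 0 < h) (hg : IntegrableOn g (Set.Ioi 0))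
    (he : IsWhiteNoise (fun k => e (k + 1)) lam μ)
    (hv : IsStationaryErgodicNoise (fun k => v (k + 1)) sigma μ)
    (hev : IndepFun (fun ω (k : ℕ) => e (k + 1) ω) (fun ω (k : ℕ) => v (k + 1) ω) μ) (N : ℕ)
    (i j : Lag Mnc Mc) :
    ∑ k ∈ Finset.Icc 1 N, ∑ n ∈ Finset.Icc 1 N,
        ∫ ω, scoreProduct h g Mnc Mc N k n i j (fun m => e m ω) (fun m => v m ω) ∂μ
      = ∫ ω, scoreVec h g Mnc Mc N (fun m => e m ω) (fun m => v m ω) i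
          * scoreVec h g Mnc Mc N (fun m => e m ω) (fun m => v m ω) j ∂μ := by
  have e1 : ∀ ω, scoreVec h g Mnc Mc N (fun m => e m ω) (fun m => v m ω) i
      * scoreVec h g Mnc Mc N (fun m => e m ω) (fun m => v m ω) j
      = ∑ k ∈ Finset.range N, ∑ n ∈ Finset.range N,
        scoreProduct h g Mnc Mc N (k + 1) (n + 1) i j (fun m => e m ω) (fun m => v m ω) := by
    intro ω
    simp_rw [scoreVec, sum_Icc_one_eq_sum_range]
    rw [Finset.sum_mul_sum]
    refine Finset.sum_congr rfl fun k _ => Finset.sum_congr rfl fun n _ => ?_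
    rw [scoreProduct]
    ring
  have hi := integrable_scoreProduct (Mnc := Mnc) (Mc := Mc) hh hg he hv hev N
  simp_rw [e1, sum_Icc_one_eq_sum_range]
  rw [integral_finsetSum _ fun k _ => integrable_finsetSum _ fun n _ => hi k n i j]
  exact Finset.sum_congr rfl fun k _ => (integral_finsetSum _ fun n _ => hi k n i j).symm

theorem measurable_gramAvg (hh : 0 < h) (he : ∀ k, Measurable (e (k + 1))) (N : ℕ) :
    Measurable fun ω => gramAvg h Mnc Mc N fun m => e m ω := by
  refine measurable_pi_iff.2 fun i => measurable_pi_iff.2 fun j => ?_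
  simp_rw [gramAvg, sum_Icc_one_eq_sum_range]
  exact (Finset.measurable_sum _ fun k _ =>
    (measurable_regressor hh he N k i).mul (measurable_regressor hh he N k j)).div_const _

theorem gramAvg_eq (hh : 0 < h) (N : ℕ) (e : ℕ → ℝ) (i j : Lag Mnc Mc) :
    gramAvg h Mnc Mc N e i j = h ^ 2 * ((∑ k ∈ Finset.range N,
      gated N (fun m => e (m + 1)) (k - (i : ℤ)) * gated N (fun m => e (m + 1)) (k - (j : ℤ))) / N)
      := by
  simp_rw [gramAvg, sum_Icc_one_eq_sum_range, regressor_succ hh]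
  rw [← mul_div_assoc, Finset.mul_sum]
  congr 1
  exact Finset.sum_congr rfl fun k _ => by ring

/-- The normalized Gram matrix converges in probability to `h² λ²` times the identity. -/
theorem tendstoInMeasure_gramAvg (hh : 0 < h) (he : IsWhiteNoise (fun k => e (k + 1)) lam μ)
    (hv : ∀ k, Measurable (v (k + 1)))
    (hev : IndepFun (fun ω (k : ℕ) => e (k + 1) ω) (fun ω (k : ℕ) => v (k + 1) ω) μ) :
    TendstoInMeasure μ (fun N ω => gramAvg h Mnc Mc N fun m => e m ω) atTop
      fun _ i j => if i = j then h ^ 2 * lam ^ 2 else 0 := by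
  refine tendstoInMeasure_of_tendsto_integral_abs (fun N i j => ?_) fun i j => ?_
  · simp_rw [gramAvg_eq hh]
    exact ((integrable_finsetSum _ fun k _ => (memLp_gated he.memLp_all N _).integrable_mul
      (memLp_gated he.memLp_all N _)).div_const _).const_mul _
  · have := (tendsto_integral_abs_cross he hv hev i j).const_mul (h ^ 2)
    rw [mul_zero] at this
    refine this.congr fun N => ?_
    rw [← integral_const_mul]
    refine integral_congr_ae (ae_of_all _ fun ω => ?_)
    simp only [gramAvg_eq hh, Subtype.ext_iff]
    rw [← abs_of_pos (pow_pos hh 2), ← abs_mul, abs_of_pos (pow_pos hh 2), mul_sub, mul_ite,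
      mul_zero]

theorem exists_tendsto_scoreVec (hh : 0 < h) (hg : IntegrableOn g (Set.Ioi 0))
    (he : IsWhiteNoise (fun k => e (k + 1)) lam μ)
    (hv : IsStationaryErgodicNoise (fun k => v (k + 1)) sigma μ)
    (hev : IndepFun (fun ω (k : ℕ) => e (k + 1) ω) (fun ω (k : ℕ) => v (k + 1) ω) μ) :
    ∃ Q : Matrix (Lag Mnc Mc) (Lag Mnc Mc) ℝ, Q.PosSemidef ∧
      (∀ i j, Tendsto (fun N : ℕ => ∫ ω,
        (scoreVec h g Mnc Mc N (fun m => e m ω) (fun m => v m ω) i / √N)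
          * (scoreVec h g Mnc Mc N (fun m => e m ω) (fun m => v m ω) j / √N) ∂μ)
        atTop (𝓝 (Q i j))) ∧
      ∀ c : ℝ, TendstoInDistribution (fun (N : ℕ) ω => WithLp.toLp 2
          (c • fun i => scoreVec h g Mnc Mc N (fun m => e m ω) (fun m => v m ω) i / √N)) atTop
        (id : EuclideanSpace ℝ (Lag Mnc Mc) → EuclideanSpace ℝ (Lag Mnc Mc)) (fun _ => μ)
        (multivariateGaussian 0 (c ^ 2 • Q)) := by
  refine exists_tendsto_multivariateGaussian
    (Z := fun N ω i => scoreVec h g Mnc Mc N (fun m => e m ω) (fun m => v m ω) i / √N)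
    (fun N i => ?_) fun θ => ?_
  · simp_rw [div_eq_mul_inv]
    exact (memLp_scoreVec hh hg he hv hev N i).mul_const _
  · have e1 : ∀ (N : ℕ) ω,
        ∑ i, θ i * (scoreVec h g Mnc Mc N (fun m => e m ω) (fun m => v m ω) i / √N)
        = (∑ m ∈ Finset.range N, e (m + 1) ω * scoreMultiplier h g θ N (fun k => e (k + 1) ω)
          (fun k => v (k + 1) ω) m) / √N := by
      intro N ω
      rw [← score_eq_sum hh hg N (fun m => e m ω) (fun m => v m ω) θ]
      simp_rw [← mul_div_assoc, ← Finset.sum_div, scoreVec, Finset.mul_sum, Finset.sum_mul]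
      rw [Finset.sum_comm]
      simp_rw [mul_assoc]
    simp_rw [e1]
    exact exists_tendsto_score hh hg he hv hev θ

/-- The normalized estimation error has the same limit law as the normalized score divided by the
limit of the normalized Gram matrix. -/
theorem tendstoInDistribution_lsEstimate (hh : 0 < h) (hlam : 0 < lam)
    (hg : IntegrableOn g (Set.Ioi 0)) (he : IsWhiteNoise (fun k => e (k + 1)) lam μ)
    (hv : ∀ k, Measurable (v (k + 1)))
    (hev : IndepFun (fun ω (k : ℕ) => e (k + 1) ω) (fun ω (k : ℕ) => v (k + 1) ω) μ)
    {ν : Measure (EuclideanSpace ℝ (Lag Mnc Mc))} [IsProbabilityMeasure ν]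
    (hν : TendstoInDistribution (fun (N : ℕ) ω => WithLp.toLp 2
          ((h ^ 2 * lam ^ 2)⁻¹ • fun i =>
            scoreVec h g Mnc Mc N (fun m => e m ω) (fun m => v m ω) i / √N)) atTop
        (id : EuclideanSpace ℝ (Lag Mnc Mc) → EuclideanSpace ℝ (Lag Mnc Mc)) (fun _ => μ) ν) :
    TendstoInDistribution
      (fun (N : ℕ) (ω : Ω) => √(N : ℝ) •
        (lsEstimate h (inputSignal h N fun m => e m ω)
            (measuredOutput h g (inputSignal h N fun m => e m ω) fun m => v m ω) Mnc Mc N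
          - trueParam h g Mnc Mc))
      atTop (id : EuclideanSpace ℝ (Lag Mnc Mc) → EuclideanSpace ℝ (Lag Mnc Mc)) (fun _ => μ)
      ν := by
  have hκ : h ^ 2 * lam ^ 2 ≠ 0 := by positivity
  have hG := tendstoInMeasure_gramAvg (Mnc := Mnc) (Mc := Mc) hh he hv hev
  set C : Lag Mnc Mc → Lag Mnc Mc → ℝ := fun i j => if i = j then h ^ 2 * lam ^ 2 else 0 with hC
  have hC1 : Matrix.of C = (h ^ 2 * lam ^ 2) • (1 : Matrix (Lag Mnc Mc) (Lag Mnc Mc) ℝ) := by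
    ext i j
    simp [hC, Matrix.one_apply]
  have hdet : (Matrix.of C).det ≠ 0 := by
    rw [hC1, Matrix.det_smul, Matrix.det_one, mul_one]
    exact pow_ne_zero _ hκ
  have hCinv : invEntries C = fun i j => if i = j then (h ^ 2 * lam ^ 2)⁻¹ else 0 := by
    have : (Matrix.of C)⁻¹ = (h ^ 2 * lam ^ 2)⁻¹ • (1 : Matrix (Lag Mnc Mc) (Lag Mnc Mc) ℝ) := by
      rw [hC1]
      refine Matrix.inv_eq_left_inv ?_
      rw [smul_mul_smul_comm, inv_mul_cancel₀ hκ, one_smul, one_mul]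
    funext i j
    rw [invEntries, this]
    simp [Matrix.one_apply]
  have hB := tendstoInMeasure_comp_continuousAt hG (continuousAt_invEntries hdet)
  have hcont : Continuous fun p : EuclideanSpace ℝ (Lag Mnc Mc) × (Lag Mnc Mc → Lag Mnc Mc → ℝ) =>
      (WithLp.toLp 2 fun i => ∑ j, p.2 i j * ((h ^ 2 * lam ^ 2) * p.1 j) :
        EuclideanSpace ℝ (Lag Mnc Mc)) := by
    fun_prop
  -- Slutsky. The score arrives divided by `h² λ²`; the continuous map multiplies this back before
  -- applying the inverse Gram matrix, whose limit cancels it again.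
  have hS := hν.continuous_comp_prodMk_of_tendstoInMeasure_const hcont hB fun N =>
    (measurable_invEntries.comp (measurable_gramAvg hh he.measurable N)).aemeasurable
  have hid : (fun x : EuclideanSpace ℝ (Lag Mnc Mc) => (WithLp.toLp 2 fun i =>
      ∑ j, invEntries C i j * ((h ^ 2 * lam ^ 2) * id x j) : EuclideanSpace ℝ (Lag Mnc Mc)))
      = id := by
    funext x
    ext i
    simp only [hCinv, ite_mul, zero_mul, Finset.sum_ite_eq, Finset.mem_univ, if_true, id,
      inv_mul_cancel_left₀ hκ]
  simp only [] at hS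
  rw [hid] at hS
  refine tendstoInDistribution_of_tendstoInMeasure_sub _ _ hS ?_ fun N => by
    have := ((measurable_lsEstimate (Mnc := Mnc) (Mc := Mc) hh hg he.measurable hv N).sub_const
      (trueParam h g Mnc Mc)).const_smul √(N : ℝ)
    exact this.aemeasurable
  -- For `N ≥ 1` the estimation error differs from the Slutsky sequence only where the Gram matrix
  -- is singular, an event of vanishing probability because the determinant is nonzero near the
  -- limit.
  intro ε hε
  refine tendsto_of_tendsto_of_tendsto_of_le_of_le' tendsto_const_nhds
    (tendsto_measure_of_eventually hG (p := fun A => (Matrix.of A).det ≠ 0) ?_)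
    (Eventually.of_forall fun N => zero_le) ?_
  · have : Continuous fun A : Lag Mnc Mc → Lag Mnc Mc → ℝ => (Matrix.of A).det :=
      Continuous.matrix_det (A := fun A : Lag Mnc Mc → Lag Mnc Mc → ℝ => Matrix.of A) continuous_id
    exact this.continuousAt.eventually_ne hdet
  · filter_upwards [eventually_ge_atTop 1] with N hN
    refine measure_mono fun ω hω hd => ?_
    have hω' : ε ≤ edist _ _ := hω
    refine absurd hε (not_lt.2 (hω'.trans (le_of_eq ?_)))
    rw [Pi.sub_apply, Pi.sub_apply, Pi.zero_apply,
      sqrt_smul_lsEstimate_sub_eq _ _ hd hN, edist_eq_zero, sub_eq_zero]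
    ext i
    simp only [Matrix.mulVec, dotProduct, Matrix.of_apply, Pi.smul_apply, smul_eq_mul,
      mul_inv_cancel_left₀ hκ]

end LeastSquaresLimit

theorem theorem2 {Ω : Type*} [MeasurableSpace Ω] (μ : Measure Ω) [IsProbabilityMeasure μ]
    (h lam sigma : ℝ) (hh : 0 < h) (hlam : 0 < lam)
    (g : ℝ → ℝ) (hg : IntegrableOn g (Set.Ioi 0))
    (Mnc Mc : ℤ) (hM : 0 ≤ Mnc + Mc)
    (e v : ℕ → Ω → ℝ)
    (he : IsWhiteNoise (fun k => e (k + 1)) lam μ)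
    (hv : IsStationaryErgodicNoise (fun k => v (k + 1)) sigma μ)
    (hev : IndepFun (fun ω (k : ℕ) => e (k + 1) ω) (fun ω (k : ℕ) => v (k + 1) ω) μ) :
    (∀ N : ℕ, ∀ k ∈ Finset.Icc 1 N, ∀ n ∈ Finset.Icc 1 N, ∀ i j : Lag Mnc Mc,
      Integrable (fun ω =>
        scoreProduct h g Mnc Mc N k n i j (fun m => e m ω) (fun m => v m ω)) μ) ∧
    ∃ P : Matrix (Lag Mnc Mc) (Lag Mnc Mc) ℝ,
      P.PosSemidef ∧
      Tendsto (fun N : ℕ => Matrix.of fun i j : Lag Mnc Mc =>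
          1 / (h ^ 4 * lam ^ 4 * N) * ∑ k ∈ Finset.Icc 1 N, ∑ n ∈ Finset.Icc 1 N,
            ∫ ω, scoreProduct h g Mnc Mc N k n i j (fun m => e m ω) (fun m => v m ω) ∂μ)
        atTop (𝓝 P) ∧
      TendstoInDistribution
        (fun (N : ℕ) (ω : Ω) => √(N : ℝ) •
          (lsEstimate h (inputSignal h N fun m => e m ω)
              (measuredOutput h g (inputSignal h N fun m => e m ω) fun m => v m ω) Mnc Mc N
            - trueParam h g Mnc Mc))
        atTop (id : EuclideanSpace ℝ (Lag Mnc Mc) → EuclideanSpace ℝ (Lag Mnc Mc))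
        (fun _ => μ) (multivariateGaussian 0 P) := by
  refine ⟨fun N k hk n hn i j => ?_, ?_⟩
  · obtain ⟨k, rfl⟩ := Nat.exists_eq_succ_of_ne_zero (Nat.one_le_iff_ne_zero.1 (Finset.mem_Icc.1 hk).1)
    obtain ⟨n, rfl⟩ := Nat.exists_eq_succ_of_ne_zero (Nat.one_le_iff_ne_zero.1 (Finset.mem_Icc.1 hn).1)
    exact integrable_scoreProduct hh hg he hv hev N k n i j
  obtain ⟨Q, hQ, hlim, hdist⟩ := exists_tendsto_scoreVec (Mnc := Mnc) (Mc := Mc) hh hg he hv hev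
  -- `Q` is the limit covariance of the score over `√N`. The inverse Gram limit acts on both sides
  -- of it, which produces the factor `1 / (h⁴ λ⁴)`.
  refine ⟨(h ^ 2 * lam ^ 2)⁻¹ ^ 2 • Q, hQ.smul (sq_nonneg _), ?_,
    tendstoInDistribution_lsEstimate hh hlam hg he hv.measurable hev (hdist _)⟩
  refine tendsto_pi_nhds.2 fun i => tendsto_pi_nhds.2 fun j => ?_
  refine ((hlim i j).const_mul ((h ^ 2 * lam ^ 2)⁻¹ ^ 2)).congr fun N => ?_
  simp only [Matrix.of_apply, sum_sum_integral_scoreProduct hh hg he hv hev, div_mul_div_comm,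
    Real.mul_self_sqrt (Nat.cast_nonneg N)]
  rw [integral_div, inv_pow, mul_pow, ← pow_mul, ← pow_mul]
  simp only [mul_inv, div_eq_mul_inv]
  ring
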